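/- **Setting.** On a probability space let $A\in\mathbb R$ be a treatment, $U$ an unobserved confounder, $X$ covariates, $Z$ and $W$ treatment- and outcome-inducing proxies (all with values in standard Borel spaces), $Y$ a real outcome with $\mathbb E[Y^2]<\infty$, and $Y(a)$ the potential outcomes; $\beta(a)=\mathbb E[Y(a)]$. Let $\mathcal A\subseteq\mathbb R$ be open with $A\in\mathcal A$ a.s., and assume that $Y(a)$ is integrable for $a\in\mathcal A$ and that $\beta$ is continuous on $\mathcal A$. Assume 1. (consistency, positivity) $Y(A)=Y$ a.s., and for every $a\in\mathcal A$ the conditional Lebesgue density satisfies $p(a\mid U,X)>0$ a.s.; 2. (latent ignorability) $Y(\cdot)\perp A\mid U,X$ for the random function $a\mapsto Y(a)$: it is jointly measurable with respect to $\mathrm{Borel}(\mathbb R)\otimes\mathcal G$ for a $\sigma$-algebra $\mathcal G$ of events with $\mathcal G\perp A\mid U,X$; 3. (proxies) $Y\perp Z\mid A,U,X$ and $W\perp(A,Z)\mid U,X$; 4. (completeness) for square-integrable functions, given $(A,X)$: $\mathbb E[\nu(U)\mid W,A,X]=0$ iff $\nu(U)=0$; $\mathbb E[\nu(Z)\mid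 W,A,X]=0$ iff $\nu(Z)=0$; $\mathbb E[\nu(U)\mid Z,A,X]=0$ iff $\nu(U)=0$; $\mathbb E[\nu(W)\mid Z,A,X]=0$ iff $\nu(W)=0$ (a.s.; $\nu$ may also depend on $(A,X)$); 5. (kernel) $K:\mathbb R\to\mathbb R$ is symmetric, bounded and Lipschitz, $K$ and $u^2K(u)$ are integrable, $\int K=1$, $\int uK(u)\,du=0$; put $\kappa_2(K)=\int u^2K(u)\,du$, $\Omega_2(K)=\int K(u)^2\,du$. Let $h_0,q_0$ be bridge functions: $\mathbb E[Y-h_0(A,W,X)\mid A,Z,X]=0$ and $\mathbb E[q_0(A,Z,X)-1/p(A\mid W,X)\mid A,W,X]=0$. Assume that on $\mathcal A$ both are bounded, $h_0$ is $C^2$ in $a$ with derivatives bounded locally uniformly in $a$ (uniformly in $(w,x)$), and $q_0$ is continuous in $a$. With $\sigma$-finite reference measures $\mu_Z,\mu_W,\mu_Y$ (and Lebesgue measure for $A$), assume that the conditional densities $p(a,z\mid w,x)$ and $p(a,w\mid z,x)$ exist and are $C^2$ in $a\in\mathcal A$, with derivatives of order $0,1,2$ dominated, locally uniformly in $a$,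 by functions integrable with respect to $\mu_Z\otimes P_{(W,X)}$, respectively $\mu_W\otimes P_{(Z,X)}$; that $p(a,y,w\mid z,x)$ exists, is continuous in $a\in\mathcal A$, and is dominated, locally uniformly in $a$, by some $M(y,w,z,x)$ with $(1+y^2)M$ integrable with respect to $\mu_Y\otimes\mu_W\otimes P_{(Z,X)}$; and that $p(a\mid z,w,x)$ exists and is bounded. **Estimator.** Fix $a\in\mathcal A$ and bandwidths $h_n>0$ with $nh_n^5=O(1)$ and $nh_n\to\infty$. Let $\hat h_n,\hat q_n$ be estimates of $h_0,q_0$ computed from an auxiliary i.i.d. sample of observations $(A,Z,W,X,Y)$ (of arbitrary size $m_n$), whose values at $a$ are bounded uniformly in $n$. Given these, let $\|\hat h-h_0\|_2^2=\int(\hat h_n(a,w,x)-h_0(a,w,x))^2\,dP_{(W,X)}$ and $\|\hat q-q_0\|_2^2=\int(\hat q_n(a,z,x)-q_0(a,z,x))^2\,dP_{(Z,X)}$, and assume, over the auxiliary sample, $\mathbb E\|\hat h-h_0\|_2^2\to0$, $\mathbb E\|\hat q-q_0\|_2^2\to0$ and $\mathbb E\big[\|\hat h-h_0\|_2^2\,\|\hat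 q-q_0\|_2^2\big]=o((nh_n)^{-1})$. On an independent i.i.d. sample of size $n$ put $$\hat\beta(a)=\frac1n\sum_{i=1}^n\Big\{\frac1{h_n}K\Big(\frac{a_i-a}{h_n}\Big)\big(y_i-\hat h_n(a,w_i,x_i)\big)\hat q_n(a,z_i,x_i)+\hat h_n(a,w_i,x_i)\Big\}.$$ **Theorem.** Then $\hat\beta(a)$ is square integrable for every $n$, the double integrals in $$B=\mathbb E\Big[q_0(a,Z,X)\int\big\{2\,\partial_ah_0(a,w,X)\,\partial_ap(a,w\mid Z,X)+\partial_a^2h_0(a,w,X)\,p(a,w\mid Z,X)\big\}\,d\mu_W(w)\Big],$$ $$V=\mathbb E\Big[q_0(a,Z,X)^2\int(y-h_0(a,w,X))^2\,p(a,y,w\mid Z,X)\,d(\mu_Y\otimes\mu_W)(y,w)\Big]$$ converge absolutely, and as $n\to\infty$ $$\mathbb E[\hat\beta(a)]-\beta(a)=\frac{h_n^2}2\kappa_2(K)B+o\big((nh_n)^{-1/2}\big),\qquad \mathrm{Var}[\hat\beta(a)]=\frac{\Omega_2(K)}{nh_n}\,(V+o(1)),$$ $$\mathrm{MSE}_n:=\mathbb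 E\big[(\hat\beta(a)-\beta(a))^2\big]=M_n(h_n)+o\big((nh_n)^{-1}\big),\qquad M_n(b)=\frac{b^4}4(\kappa_2(K)B)^2+\frac{\Omega_2(K)V}{nb}.$$ In particular, if $h_n=\Theta(n^{-1/5})$, then $\mathrm{MSE}_n=O(n^{-4/5})$. If moreover $\kappa_2(K)B\ne0$ and $V>0$, then this order of bandwidth and this rate are optimal: for every $n\ge1$, $M_n$ has on $(0,\infty)$ the unique minimizer $h_n^*=\big(\Omega_2(K)V/(\kappa_2(K)B)^2\big)^{1/5}n^{-1/5}$, with $M_n(h_n^*)=\frac54\big((\kappa_2(K)B)^2\big)^{1/5}(\Omega_2(K)V)^{4/5}n^{-4/5}$; for every $\varepsilon>0$, $\mathrm{MSE}_n\ge(1-\varepsilon)M_n(h_n^*)$ for all large $n$; $\mathrm{MSE}_n=O(n^{-4/5})$ only if $h_n=\Theta(n^{-1/5})$; and $\mathrm{MSE}_n/M_n(h_n^*)\to1$ if $h_n/h_n^*\to1$. -/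

import Mathlib

open MeasureTheory ProbabilityTheory Filter Topology Asymptotics

noncomputable section

namespace Proximal

/-! ### Kernels -/

/-- A second-order symmetric kernel. It may take negative values. "Bounded differentiable" enters
as bounded and Lipschitz, which contains every differentiable kernel with bounded derivative and
also the Epanechnikov kernel. -/
structure IsSecondOrderKernel (K : ℝ → ℝ) : Prop where
  symmetric : ∀ u, K (-u) = K u
  bounded : ∃ C : ℝ, ∀ u, |K u| ≤ C
  lipschitz : ∃ L : NNReal, LipschitzWith L K
  integrable : Integrable K
  integral_eq_one : ∫ u, K u = 1
  first_moment : ∫ u, u * K u = 0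
  integrable_second_moment : Integrable fun u => u ^ 2 * K u

/-- `κ₂(K) = ∫ u² K(u) du`. -/
def kappaTwo (K : ℝ → ℝ) : ℝ := ∫ u, u ^ 2 * K u

/-- `Ω₂(K) = ∫ K(u)² du`. -/
def omegaTwo (K : ℝ → ℝ) : ℝ := ∫ u, K u ^ 2

/-! ### Conditional densities, completeness -/

section General

variable {Ω τ σ γ : Type*} [MeasurableSpace Ω] [MeasurableSpace τ] [MeasurableSpace σ]
  [MeasurableSpace γ]

/-- `p t c` is a version of the conditional density, with respect to the reference measure `ν`,
of `T` at `t` given `C = c`: the joint law of `(T, C)` is `p(t | c) ν(dt) P_C(dc)`. -/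
structure IsCondDensity (P : Measure Ω) (ν : Measure τ) (T : Ω → τ) (C : Ω → γ)
    (p : τ → γ → ℝ) : Prop where
  measurable : Measurable (Function.uncurry p)
  nonneg : ∀ t c, 0 ≤ p t c
  map_eq : P.map (fun ω => (T ω, C ω)) =
    (ν.prod (P.map C)).withDensity fun x => ENNReal.ofReal (p x.1 x.2)

/-- Completeness of `S` for `T` given (almost every value of) `C`: a square-integrable
`g (T, C)` satisfies `E[g (T, C) | S, C] = 0` a.s. iff it vanishes a.s. -/
def IsComplete (P : Measure Ω) (T : Ω → τ) (S : Ω → σ) (C : Ω → γ) : Prop :=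
  ∀ g : τ × γ → ℝ, Measurable g → MemLp (fun ω => g (T ω, C ω)) 2 P →
    ((P[fun ω => g (T ω, C ω) | MeasurableSpace.comap (fun ω => (S ω, C ω)) inferInstance]
        =ᵐ[P] fun _ => (0 : ℝ)) ↔
      (fun ω => g (T ω, C ω)) =ᵐ[P] fun _ => (0 : ℝ))

/-- The function `p (a, t) c` is `k` times continuously differentiable in the treatment level `a`
on the open set `S`, and its derivatives in `a` up to order `k` are, locally uniformly in `a`,
dominated by a `ρ`-integrable function of the remaining variables. -/
def SmoothDominated (S : Set ℝ) (k : ℕ) (ρ : Measure (τ × γ)) (p : ℝ × τ → γ → ℝ) : Prop :=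
  (∀ t c, ContDiffOn ℝ k (fun a => p (a, t) c) S) ∧
  ∀ a ∈ S, ∃ δ > 0, ∃ M : τ × γ → ℝ, Integrable M ρ ∧
    ∀ s ∈ Metric.ball a δ ∩ S, ∀ i ≤ k, ∀ t c,
      |iteratedDeriv i (fun r => p (r, t) c) s| ≤ M (t, c)

end General

/-- `f (a, t, c)` is twice continuously differentiable in `a` on the open set `S`, with
derivatives in `a` up to order two bounded, locally uniformly in `a` and uniformly in `(t, c)`. -/
def SmoothBounded {τ γ : Type*} (S : Set ℝ) (f : ℝ → τ → γ → ℝ) : Prop :=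
  (∀ t c, ContDiffOn ℝ 2 (fun a => f a t c) S) ∧
  ∀ a ∈ S, ∃ δ > 0, ∃ C : ℝ, ∀ s ∈ Metric.ball a δ ∩ S, ∀ i ≤ 2, ∀ t c,
    |iteratedDeriv i (fun r => f r t c) s| ≤ C

/-- Boundedness of `f (a, t, c)`, uniformly over `a ∈ S` and all `(t, c)`. -/
def UniformlyBounded {τ γ : Type*} (S : Set ℝ) (f : ℝ → τ → γ → ℝ) : Prop :=
  ∃ C : ℝ, ∀ a ∈ S, ∀ t c, |f a t c| ≤ C

/-! ### The causal model -/

/-- The random variables of the proximal model: treatment `A`, unobserved confounder `U`,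
covariates `X`, treatment proxy `Z`, outcome proxy `W`, outcome `Y` and the potential outcomes
`Ypot a`, all on the same probability space. -/
structure Variables (Ω 𝒰 𝒳 𝒵 𝒲 : Type*) [MeasurableSpace Ω] [MeasurableSpace 𝒰]
    [MeasurableSpace 𝒳] [MeasurableSpace 𝒵] [MeasurableSpace 𝒲] where
  A : Ω → ℝ
  U : Ω → 𝒰
  X : Ω → 𝒳
  Z : Ω → 𝒵
  W : Ω → 𝒲
  Y : Ω → ℝ
  Ypot : ℝ → Ω → ℝ
  measurable_A : Measurable A
  measurable_U : Measurable U
  measurable_X : Measurable X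
  measurable_Z : Measurable Z
  measurable_W : Measurable W
  measurable_Y : Measurable Y

/-- The type of one observation `(A, Z, W, X, Y)`. -/
abbrev Obs (𝒳 𝒵 𝒲 : Type*) : Type _ := ℝ × 𝒵 × 𝒲 × 𝒳 × ℝ

section Model

variable {Ω 𝒰 𝒳 𝒵 𝒲 : Type*} [mΩ : MeasurableSpace Ω] [MeasurableSpace 𝒰] [MeasurableSpace 𝒳]
  [MeasurableSpace 𝒵] [MeasurableSpace 𝒲]

/-- The observation `(A, Z, W, X, Y)`. -/
def Variables.obs (v : Variables Ω 𝒰 𝒳 𝒵 𝒲) (ω : Ω) : Obs 𝒳 𝒵 𝒲 :=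
  (v.A ω, v.Z ω, v.W ω, v.X ω, v.Y ω)

/-- The causal effect `β(a) = E[Y(a)]`. -/
def Variables.beta (v : Variables Ω 𝒰 𝒳 𝒵 𝒲) (P : Measure Ω) (a : ℝ) : ℝ := ∫ ω, v.Ypot a ω ∂P

/-- Consistency: `Y(A) = Y` almost surely. -/
def Variables.Consistency (v : Variables Ω 𝒰 𝒳 𝒵 𝒲) (P : Measure Ω) : Prop :=
  ∀ᵐ ω ∂P, v.Ypot (v.A ω) ω = v.Y ω

/-- Positivity on the treatment space `S`: `p(a | U, X) > 0` almost surely, for `a ∈ S`, where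
`p(· | u, x)` is the conditional Lebesgue density of the treatment. -/
def Variables.Positivity (v : Variables Ω 𝒰 𝒳 𝒵 𝒲) (P : Measure Ω) (S : Set ℝ) : Prop :=
  ∃ p : ℝ → 𝒰 × 𝒳 → ℝ, IsCondDensity P volume v.A (fun ω => (v.U ω, v.X ω)) p ∧
    ∀ a ∈ S, ∀ᵐ ω ∂P, 0 < p a (v.U ω, v.X ω)

/-- Latent ignorability `Y(·) ⊥ A | U, X` for the random function `Y(·)`: the potential outcomes
are jointly measurable with respect to a σ-algebra of events that is conditionally independent
of the treatment given `(U, X)`. In particular `Y(a) ⊥ A | U, X` for every `a`. Without joint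
measurability (for instance `Y(a) = 1` if `a = A` and `Y(a) = 0` otherwise) the statement for
each single `a` does not connect `Y(a)` with the observed outcome. -/
def Variables.LatentIgnorability [StandardBorelSpace Ω] (v : Variables Ω 𝒰 𝒳 𝒵 𝒲)
    (P : Measure Ω) [IsFiniteMeasure P] : Prop :=
  ∃ 𝒢 : {m : MeasurableSpace Ω // m ≤ mΩ},
    Measurable[Prod.instMeasurableSpace (m₁ := borel ℝ) (m₂ := 𝒢.1)] (Function.uncurry v.Ypot) ∧
    CondIndep (MeasurableSpace.comap (fun ω => (v.U ω, v.X ω)) inferInstance) 𝒢.1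
      (MeasurableSpace.comap v.A inferInstance)
      (v.measurable_U.prodMk v.measurable_X).comap_le P

/-- Conditional independence of the proxies: `Y ⊥ Z | A, U, X` and `W ⊥ (A, Z) | U, X`. -/
structure Variables.ProxyIndependence [StandardBorelSpace Ω] (v : Variables Ω 𝒰 𝒳 𝒵 𝒲)
    (P : Measure Ω) [IsFiniteMeasure P] : Prop where
  outcome : CondIndepFun (MeasurableSpace.comap (fun ω => (v.A ω, v.U ω, v.X ω)) inferInstance)
    (v.measurable_A.prodMk (v.measurable_U.prodMk v.measurable_X)).comap_le v.Y v.Z P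
  proxy : CondIndepFun (MeasurableSpace.comap (fun ω => (v.U ω, v.X ω)) inferInstance)
    (v.measurable_U.prodMk v.measurable_X).comap_le v.W (fun ω => (v.A ω, v.Z ω)) P

/-- Completeness for outcome and for treatment bridge functions, given treatment and covariates. -/
structure Variables.Completeness (v : Variables Ω 𝒰 𝒳 𝒵 𝒲) (P : Measure Ω) : Prop where
  U_of_W : IsComplete P v.U v.W (fun ω => (v.A ω, v.X ω))
  Z_of_W : IsComplete P v.Z v.W (fun ω => (v.A ω, v.X ω))
  U_of_Z : IsComplete P v.U v.Z (fun ω => (v.A ω, v.X ω))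
  W_of_Z : IsComplete P v.W v.Z (fun ω => (v.A ω, v.X ω))

/-- `h` solves the outcome bridge equation `E[Y - h(A, W, X) | A, Z, X] = 0`. -/
structure Variables.IsOutcomeBridge (v : Variables Ω 𝒰 𝒳 𝒵 𝒲) (P : Measure Ω)
    (h : ℝ → 𝒲 → 𝒳 → ℝ) : Prop where
  measurable : Measurable fun t : ℝ × 𝒲 × 𝒳 => h t.1 t.2.1 t.2.2
  integrable : Integrable (fun ω => v.Y ω - h (v.A ω) (v.W ω) (v.X ω)) P
  bridge : P[fun ω => v.Y ω - h (v.A ω) (v.W ω) (v.X ω) |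
      MeasurableSpace.comap (fun ω => (v.A ω, v.Z ω, v.X ω)) inferInstance]
    =ᵐ[P] fun _ => (0 : ℝ)

/-- `q` solves the treatment bridge equation `E[q(A, Z, X) - 1 / p(A | W, X) | A, W, X] = 0`,
where `p(· | w, x)` is the conditional Lebesgue density of the treatment. -/
structure Variables.IsTreatmentBridge (v : Variables Ω 𝒰 𝒳 𝒵 𝒲) (P : Measure Ω)
    (q : ℝ → 𝒵 → 𝒳 → ℝ) : Prop where
  measurable : Measurable fun t : ℝ × 𝒵 × 𝒳 => q t.1 t.2.1 t.2.2
  bridge : ∃ p : ℝ → 𝒲 × 𝒳 → ℝ, IsCondDensity P volume v.A (fun ω => (v.W ω, v.X ω)) p ∧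
    Integrable (fun ω => q (v.A ω) (v.Z ω) (v.X ω) - 1 / p (v.A ω) (v.W ω, v.X ω)) P ∧
    P[fun ω => q (v.A ω) (v.Z ω) (v.X ω) - 1 / p (v.A ω) (v.W ω, v.X ω) |
        MeasurableSpace.comap (fun ω => (v.A ω, v.W ω, v.X ω)) inferInstance]
      =ᵐ[P] fun _ => (0 : ℝ)

/-! ### The estimator and its sampling distribution -/

/-- The kernel doubly robust estimator of `β(a)` with bandwidth `b` and nuisance functions
`h`, `q`, on the sample `o`:
`(1/n) ∑ᵢ [ (1/b) K((aᵢ - a)/b) (yᵢ - h(a, wᵢ, xᵢ)) q(a, zᵢ, xᵢ) + h(a, wᵢ, xᵢ) ]`. -/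
def pkdr (K : ℝ → ℝ) (b a : ℝ) (h : ℝ → 𝒲 → 𝒳 → ℝ) (q : ℝ → 𝒵 → 𝒳 → ℝ) {n : ℕ}
    (o : Fin n → Obs 𝒳 𝒵 𝒲) : ℝ :=
  (1 / (n : ℝ)) * ∑ i, match o i with
    | (ai, zi, wi, xi, yi) =>
      1 / b * K ((ai - a) / b) * (yi - h a wi xi) * q a zi xi + h a wi xi

/-- The law of `k` independent copies of the observation. -/
def Variables.sampleLaw (v : Variables Ω 𝒰 𝒳 𝒵 𝒲) (P : Measure Ω) (k : ℕ) :
    Measure (Fin k → Obs 𝒳 𝒵 𝒲) :=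
  Measure.pi fun _ => P.map v.obs

/-- The joint law of an auxiliary sample of size `m`, on which the nuisance functions are
estimated, and an independent main sample of size `n`. -/
def Variables.splitLaw (v : Variables Ω 𝒰 𝒳 𝒵 𝒲) (P : Measure Ω) (m n : ℕ) :
    Measure ((Fin m → Obs 𝒳 𝒵 𝒲) × (Fin n → Obs 𝒳 𝒵 𝒲)) :=
  (v.sampleLaw P m).prod (v.sampleLaw P n)

/-- The estimator with nuisance functions fitted on the auxiliary sample `d.1` and averaged over
the main sample `d.2`. -/
def splitPkdr (K : ℝ → ℝ) (b a : ℝ) {m n : ℕ}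
    (hhat : (Fin m → Obs 𝒳 𝒵 𝒲) → ℝ → 𝒲 → 𝒳 → ℝ)
    (qhat : (Fin m → Obs 𝒳 𝒵 𝒲) → ℝ → 𝒵 → 𝒳 → ℝ)
    (d : (Fin m → Obs 𝒳 𝒵 𝒲) × (Fin n → Obs 𝒳 𝒵 𝒲)) : ℝ :=
  pkdr K b a (hhat d.1) (qhat d.1) d.2

/-- `‖ĥ - h‖₂²` at the treatment level `a`: `E[(ĥ(a, W, X) - h(a, W, X))²]` over a fresh draw of
`(W, X)`, for a given function `ĥ`. -/
def Variables.sqErrH (v : Variables Ω 𝒰 𝒳 𝒵 𝒲) (P : Measure Ω) (a : ℝ)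
    (h' h : ℝ → 𝒲 → 𝒳 → ℝ) : ℝ :=
  ∫ ω, (h' a (v.W ω) (v.X ω) - h a (v.W ω) (v.X ω)) ^ 2 ∂P

/-- `‖q̂ - q‖₂²` at the treatment level `a`: `E[(q̂(a, Z, X) - q(a, Z, X))²]` over a fresh draw of
`(Z, X)`, for a given function `q̂`. -/
def Variables.sqErrQ (v : Variables Ω 𝒰 𝒳 𝒵 𝒲) (P : Measure Ω) (a : ℝ)
    (q' q : ℝ → 𝒵 → 𝒳 → ℝ) : ℝ :=
  ∫ ω, (q' a (v.Z ω) (v.X ω) - q a (v.Z ω) (v.X ω)) ^ 2 ∂P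

/-! ### The constants in the expansions -/

/-- The integrand of `B` in the outcome proxy:
`2 ∂ₐh(a, w, x) ∂ₐp(a, w | z, x) + ∂ₐ²h(a, w, x) p(a, w | z, x)`. -/
def biasIntegrand (h : ℝ → 𝒲 → 𝒳 → ℝ) (p : ℝ × 𝒲 → 𝒵 × 𝒳 → ℝ) (a : ℝ) (w : 𝒲) (z : 𝒵)
    (x : 𝒳) : ℝ :=
  2 * deriv (fun s => h s w x) a * deriv (fun s => p (s, w) (z, x)) a
    + iteratedDeriv 2 (fun s => h s w x) a * p (a, w) (z, x)

/-- `B = E[ q(a, Z, X) ∫ (2 ∂ₐh(a, w, X) ∂ₐp(a, w | Z, X) + ∂ₐ²h(a, w, X) p(a, w | Z, X)) μ(dw) ]`. -/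
def Variables.biasConst (v : Variables Ω 𝒰 𝒳 𝒵 𝒲) (P : Measure Ω) (μW : Measure 𝒲)
    (h : ℝ → 𝒲 → 𝒳 → ℝ) (q : ℝ → 𝒵 → 𝒳 → ℝ) (p : ℝ × 𝒲 → 𝒵 × 𝒳 → ℝ) (a : ℝ) : ℝ :=
  ∫ ω, q a (v.Z ω) (v.X ω) * (∫ w, biasIntegrand h p a w (v.Z ω) (v.X ω) ∂μW) ∂P

/-- `V = E[ 1(A = a) q(a, Z, X)² (Y - h(a, W, X))² ]`, where `1(A = a)` is the Dirac mass at `a`: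
`V = E[ q(a, Z, X)² ∫ (y - h(a, w, X))² p(a, y, w | Z, X) μ(dy, dw) ]`. -/
def Variables.varConst (v : Variables Ω 𝒰 𝒳 𝒵 𝒲) (P : Measure Ω) (μY : Measure ℝ)
    (μW : Measure 𝒲) (h : ℝ → 𝒲 → 𝒳 → ℝ) (q : ℝ → 𝒵 → 𝒳 → ℝ)
    (p : ℝ × ℝ × 𝒲 → 𝒵 × 𝒳 → ℝ) (a : ℝ) : ℝ :=
  ∫ ω, q a (v.Z ω) (v.X ω) ^ 2 *
    (∫ t : ℝ × 𝒲, (t.1 - h a t.2 (v.X ω)) ^ 2 * p (a, t) (v.Z ω, v.X ω) ∂(μY.prod μW)) ∂P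

/-- The densities `p(a, z | w, x)`, `p(a, w | z, x)`, `p(a, y, w | z, x)`, `p(a | z, w, x)` and the
regularity in `a` that the expansions need, on the treatment space `S`. -/
structure Variables.RegularDensities (v : Variables Ω 𝒰 𝒳 𝒵 𝒲) (P : Measure Ω) (S : Set ℝ)
    (μZ : Measure 𝒵) (μW : Measure 𝒲) (μY : Measure ℝ)
    (pZ : ℝ × 𝒵 → 𝒲 × 𝒳 → ℝ) (pW : ℝ × 𝒲 → 𝒵 × 𝒳 → ℝ) (pYW : ℝ × ℝ × 𝒲 → 𝒵 × 𝒳 → ℝ) :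
    Prop where
  density_Z : IsCondDensity P (volume.prod μZ) (fun ω => (v.A ω, v.Z ω))
    (fun ω => (v.W ω, v.X ω)) pZ
  density_W : IsCondDensity P (volume.prod μW) (fun ω => (v.A ω, v.W ω))
    (fun ω => (v.Z ω, v.X ω)) pW
  density_YW : IsCondDensity P (volume.prod (μY.prod μW)) (fun ω => (v.A ω, v.Y ω, v.W ω))
    (fun ω => (v.Z ω, v.X ω)) pYW
  smooth_Z : SmoothDominated S 2 (μZ.prod (P.map fun ω => (v.W ω, v.X ω))) pZ
  smooth_W : SmoothDominated S 2 (μW.prod (P.map fun ω => (v.Z ω, v.X ω))) pW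
  /-- `p(a, y, w | z, x)` is continuous in `a`, with a locally uniform dominating function that
  has a second moment in `y`. -/
  continuous_YW : ∀ t c, ContinuousOn (fun a => pYW (a, t) c) S
  dominated_YW : ∀ a ∈ S, ∃ δ > 0, ∃ M : (ℝ × 𝒲) × (𝒵 × 𝒳) → ℝ,
    Integrable (fun t => (1 + t.1.1 ^ 2) * M t)
      ((μY.prod μW).prod (P.map fun ω => (v.Z ω, v.X ω))) ∧
    ∀ s ∈ Metric.ball a δ ∩ S, ∀ t c, pYW (s, t) c ≤ M (t, c)
  /-- `p(a | z, w, x)` exists and is bounded. -/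
  bounded_A : ∃ p : ℝ → 𝒵 × 𝒲 × 𝒳 → ℝ,
    IsCondDensity P volume v.A (fun ω => (v.Z ω, v.W ω, v.X ω)) p ∧ ∃ C : ℝ, ∀ a c, p a c ≤ C

end Model

/-! ### Mean squared error -/

/-- Leading part of the mean squared error as a function of the bandwidth `b`:
`(b⁴/4) (κ₂(K) B)² + Ω₂(K) V / (n b)`. -/
def amse (K : ℝ → ℝ) (B V : ℝ) (n : ℕ) (b : ℝ) : ℝ :=
  b ^ 4 / 4 * (kappaTwo K * B) ^ 2 + omegaTwo K * V / (n * b)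

/-- The bandwidth `(Ω₂(K) V / (κ₂(K) B)²)^{1/5} n^{-1/5}`. -/
def optBandwidth (K : ℝ → ℝ) (B V : ℝ) (n : ℕ) : ℝ :=
  (omegaTwo K * V / (kappaTwo K * B) ^ 2) ^ (1 / 5 : ℝ) * (n : ℝ) ^ (-(1 / 5) : ℝ)

end Proximal

end

noncomputable section

namespace Proximal

/-! ### Integrals against laws given by densities -/

section Density

variable {Ω α : Type*} [MeasurableSpace Ω] [MeasurableSpace α] {P : Measure Ω} {X : Ω → α}
  {ρ : Measure α} {f : α → ℝ}

/-! Given the auxiliary sample, the estimator is a mean of n i.i.d. scores, so everything reduces to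
the conditional mean and the conditional second moment of one score. The fitted nuisance functions
are random, hence every expansion below is uniform over measurable functions with a common bound,
with errors expressed through their mean square distances to the bridge functions.

The causal content enters through two identities at the level a. The first is β(a) = E[h₀(a,W,X)].
By proxy independence the conditional mean of the residual Y - h₀(A,W,X) given (A,U,X,Z) is a
function of (A,U,X); the bridge equation says that its projection on (A,Z,X) vanishes, and
completeness then makes it vanish. The residual is thus orthogonal to bounded functions of (A,U,X).
Truncated inverse densities 1{p ≥ η}/p are such functions, and they turn the orthogonality into
E[Y(s)] = E[h₀(s,W,X)] for almost every s; continuity in s gives s = a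
(`Variables.IsOutcomeBridge.latent`, `ae_eq_integral_of_factor`). The second identity, ∫ q₀(a,z,x)
p(a,z|w,x) dz = 1, is the treatment bridge equation written with densities, again first for almost
every level and then by continuity (`Variables.IsTreatmentBridge.integral_eq_one`).

For the bias, let k be the rescaled kernel at A, D = h₀(a) - ĥ(a) and Δ = q̂(a) - q₀(a). Then
E[score] - β(a) is the sum of E[k (Y - h₀(A)) q̂], which is zero by the outcome bridge equation; E[k
(h₀(A) - h₀(a)) q̂], a smoothing error with leading term b²κ₂/2 times the integral B with q̂ for q₀;
E[k D Δ], at most a constant times the product of the L² errors because p(a|z,w,x) is bounded; and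
E[k D q₀] - E[D], which by the second identity is of order b² with a coefficient that is small when
D is. Replacing q̂ by q₀, and bounding the last coefficient, is done by absolute continuity: an L²
error that tends to zero is negligible against a fixed integrable density
(`Variables.Regular.exists_bias_bound`). In the same way b E[score²] tends to Ω₂V
(`Variables.Regular.exists_second_moment_bound`).

Finally one averages over the auxiliary sample. With n b⁵ = O(1) and the rate for the expected
product of squared errors, the mean square of (conditional mean - β(a) - b²κ₂B/2) is o(1/(nb))
(`tendsto_mean_sq_remainder`). This single quantity bounds both the squared bias remainder and the
variance of the conditional mean in the law of total variance (`tendsto_bias_variance`). The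
statements on the mean squared error are then calculus for c⁴/4 + x⁵/c. -/

lemma integrable_comp_iff_of_map_eq_withDensity (hX : Measurable X) (hf : Measurable f)
    (h0 : ∀ x, 0 ≤ f x) (h : P.map X = ρ.withDensity fun x => ENNReal.ofReal (f x))
    {g : α → ℝ} (hg : Measurable g) :
    Integrable (fun ω => g (X ω)) P ↔ Integrable (fun x => f x * g x) ρ := by
  have h1 := integrable_map_measure (μ := P) (f := X) (g := g) hg.aestronglyMeasurable
    hX.aemeasurable
  change Integrable (g ∘ X) P ↔ _
  rw [← h1, h, integrable_withDensity_iff_integrable_smul' (by fun_prop) (by simp)]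
  simp [ENNReal.toReal_ofReal, h0]

lemma integral_comp_of_map_eq_withDensity (hX : Measurable X) (hf : Measurable f)
    (h0 : ∀ x, 0 ≤ f x) (h : P.map X = ρ.withDensity fun x => ENNReal.ofReal (f x))
    {g : α → ℝ} (hg : Measurable g) :
    ∫ ω, g (X ω) ∂P = ∫ x, f x * g x ∂ρ := by
  rw [← integral_map hX.aemeasurable hg.aestronglyMeasurable, h,
    integral_withDensity_eq_integral_toReal_smul (by fun_prop) (by simp)]
  simp [ENNReal.toReal_ofReal, h0]

lemma ae_comp_iff_of_map_eq_withDensity (hX : Measurable X) (hf : Measurable f)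
    (h : P.map X = ρ.withDensity fun x => ENNReal.ofReal (f x))
    {s : Set α} (hs : MeasurableSet s) :
    (∀ᵐ ω ∂P, X ω ∈ s) ↔ ∀ᵐ x ∂ρ, 0 < f x → x ∈ s := by
  have h1 := ae_map_iff (μ := P) (p := fun x => x ∈ s) hX.aemeasurable hs
  rw [← h1, h, ae_withDensity_iff (by fun_prop)]
  simp

variable {τ γ : Type*} [MeasurableSpace τ] [MeasurableSpace γ]

/-- Only the treatment gets rescaled, so it has to be split off from the other variables; this is a
reassociation of the product measure. -/
lemma IsCondDensity.map_eq_prod {ν : Measure τ} [SigmaFinite ν] [IsFiniteMeasure P] {A : Ω → ℝ}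
    {T : Ω → τ} {C : Ω → γ} {p : ℝ × τ → γ → ℝ} (hA : Measurable A) (hT : Measurable T)
    (hC : Measurable C) (hp : IsCondDensity P (volume.prod ν) (fun ω => (A ω, T ω)) C p) :
    P.map (fun ω => (A ω, (T ω, C ω))) =
      (volume.prod (ν.prod (P.map C))).withDensity
        fun x => ENNReal.ofReal (p (x.1, x.2.1) x.2.2) := by
  have h1 : P.map (fun ω => (A ω, (T ω, C ω))) =
      (P.map (fun ω => ((A ω, T ω), C ω))).map MeasurableEquiv.prodAssoc := by
    rw [Measure.map_map (by fun_prop) (by fun_prop)]; rfl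
  rw [h1, hp.map_eq]
  have h2 := (measurePreserving_prodAssoc (volume : Measure ℝ) ν (P.map C))
  ext s hs
  rw [MeasurableEquiv.map_apply, withDensity_apply _ (MeasurableEquiv.measurable _ hs),
    withDensity_apply _ hs, ← h2.setLIntegral_comp_preimage hs]
  · rfl
  · have := hp.measurable
    have h3 : Measurable fun x : ℝ × τ × γ => ((x.1, x.2.1), x.2.2) := by fun_prop
    exact ENNReal.measurable_ofReal.comp (this.comp h3)

end Density

/-! ### Affine substitution in the treatment coordinate -/

section ChangeOfVariables

variable {E : Type*} [MeasurableSpace E] {m : Measure E} [SFinite m]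

lemma map_affine_prod {b : ℝ} (hb : 0 < b) (a : ℝ) :
    (volume.prod m).map (fun x : ℝ × E => (a + b * x.1, x.2)) =
      ENNReal.ofReal b⁻¹ • (volume.prod m) := by
  have h1 : (volume : Measure ℝ).map (fun u => a + b * u) = ENNReal.ofReal b⁻¹ • volume := by
    have : (fun u : ℝ => a + b * u) = (fun x => a + x) ∘ (fun u => b * u) := rfl
    rw [this, ← Measure.map_map (by fun_prop) (by fun_prop), Real.map_volume_mul_left hb.ne',
      Measure.map_smul, Measure.IsAddLeftInvariant.map_add_left_eq_self, abs_of_pos (by positivity)]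
  have h2 := Measure.map_prod_map (volume : Measure ℝ) m
    (f := fun u => a + b * u) (g := id) (by fun_prop) (by fun_prop)
  rw [h1, Measure.map_id, Measure.prod_smul_left] at h2
  rw [h2]; rfl

lemma measurableEmbedding_affine_prod {b : ℝ} (hb : 0 < b) (a : ℝ) :
    MeasurableEmbedding (fun x : ℝ × E => (a + b * x.1, x.2)) := by
  have : (fun x : ℝ × E => (a + b * x.1, x.2)) = Prod.map (fun u : ℝ => a + b * u) id := rfl
  rw [this]
  refine MeasurableEmbedding.prodMap ?_ MeasurableEmbedding.id
  exact (measurableEmbedding_addLeft a).comp (measurableEmbedding_mulLeft₀ hb.ne')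

lemma integral_affine_prod {b : ℝ} (hb : 0 < b) (a : ℝ) (g : ℝ × E → ℝ) :
    ∫ x, g x ∂(volume.prod m) = b * ∫ x, g (a + b * x.1, x.2) ∂(volume.prod m) := by
  have h := (measurableEmbedding_affine_prod (E := E) hb a).integral_map (μ := volume.prod m) g
  rw [← h, map_affine_prod hb a, integral_smul_measure, ENNReal.toReal_ofReal (by positivity)]
  simp [hb.ne']

lemma integrable_affine_prod_iff {b : ℝ} (hb : 0 < b) (a : ℝ) (g : ℝ × E → ℝ) :
    Integrable (fun x => g (a + b * x.1, x.2)) (volume.prod m) ↔ Integrable g (volume.prod m) := by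
  have h := (measurableEmbedding_affine_prod (E := E) hb a).integrable_map_iff
    (μ := volume.prod m) (g := g)
  rw [map_affine_prod hb a] at h
  rw [integrable_smul_measure (by simpa using hb) (by simp)] at h
  exact h.symm

variable {Ω : Type*} [MeasurableSpace Ω] {P : Measure Ω} {A : Ω → ℝ} {T : Ω → E} {f : ℝ × E → ℝ}

/-- The substitution s = a + b u moves the bandwidth from the kernel into the density. The factor b
cancels the 1/b of the kernel weight. -/
lemma integral_rescaled {b : ℝ} (hb : 0 < b) (a : ℝ) (hA : Measurable A) (hT : Measurable T)
    (hf : Measurable f) (h0 : ∀ x, 0 ≤ f x)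
    (h : P.map (fun ω => (A ω, T ω)) = (volume.prod m).withDensity fun x => ENNReal.ofReal (f x))
    {g : ℝ × E → ℝ} (hg : Measurable g) :
    ∫ ω, g ((A ω - a) / b, T ω) ∂P =
      b * ∫ x, f (a + b * x.1, x.2) * g x ∂(volume.prod m) := by
  have := integral_comp_of_map_eq_withDensity (hA.prodMk hT) hf h0 h
    (g := fun x => g ((x.1 - a) / b, x.2)) (by fun_prop)
  simp only at this
  rw [this, integral_affine_prod hb a]
  simp [hb.ne']

lemma integrable_rescaled_iff {b : ℝ} (hb : 0 < b) (a : ℝ) (hA : Measurable A) (hT : Measurable T)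
    (hf : Measurable f) (h0 : ∀ x, 0 ≤ f x)
    (h : P.map (fun ω => (A ω, T ω)) = (volume.prod m).withDensity fun x => ENNReal.ofReal (f x))
    {g : ℝ × E → ℝ} (hg : Measurable g) :
    Integrable (fun ω => g ((A ω - a) / b, T ω)) P ↔
      Integrable (fun x => f (a + b * x.1, x.2) * g x) (volume.prod m) := by
  have := integrable_comp_iff_of_map_eq_withDensity (hA.prodMk hT) hf h0 h
    (g := fun x => g ((x.1 - a) / b, x.2)) (by fun_prop)
  simp only at this
  rw [this, ← integrable_affine_prod_iff hb a]
  simp [hb.ne']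

end ChangeOfVariables

/-! ### Approximate identities, uniformly in bounded weights -/

section ApproximateIdentity

/-- The indicator of `|b u| < δ`. -/
def cutoff (δ b u : ℝ) : ℝ := if |b * u| < δ then 1 else 0

lemma measurable_cutoff (δ b : ℝ) : Measurable (cutoff δ b) := by
  unfold cutoff
  exact Measurable.ite (measurableSet_lt (by fun_prop) measurable_const) measurable_const
    measurable_const

lemma cutoff_nonneg (δ b u : ℝ) : 0 ≤ cutoff δ b u := by
  unfold cutoff; split_ifs <;> norm_num

lemma cutoff_le_one (δ b u : ℝ) : cutoff δ b u ≤ 1 := by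
  unfold cutoff; split_ifs <;> norm_num

lemma cutoff_neg (δ b u : ℝ) : cutoff δ b (-u) = cutoff δ b u := by
  unfold cutoff; rw [mul_neg, abs_neg]

lemma eventually_cutoff_eq_one {δ : ℝ} (hδ : 0 < δ) (u : ℝ) :
    ∀ᶠ b in 𝓝 (0 : ℝ), cutoff δ b u = 1 := by
  have : Tendsto (fun b : ℝ => |b * u|) (𝓝 0) (𝓝 0) := by
    have h : Continuous fun b : ℝ => |b * u| := by fun_prop
    simpa using h.tendsto 0
  filter_upwards [this.eventually (gt_mem_nhds hδ)] with b hb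
  simp only [cutoff, if_pos hb]

variable {E : Type*} [MeasurableSpace E] {m : Measure E} [SFinite m]
  {k : ℝ → ℝ} {Φ : ℝ → E → ℝ} {N : E → ℝ} {δ : ℝ}

omit [MeasurableSpace E] in
lemma abs_cutoff_mul_le (hΦN : ∀ h, |h| < δ → ∀ e, |Φ h e| ≤ N e) (hN : ∀ e, 0 ≤ N e)
    (b u : ℝ) (e : E) : |cutoff δ b u * Φ (b * u) e| ≤ N e := by
  unfold cutoff
  split_ifs with h
  · simpa using hΦN _ h e
  · simpa using hN e

omit [SFinite m] in
lemma integrable_kernel_cutoff (hk : Integrable k) (hΦ : Measurable (Function.uncurry Φ))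
    (hN : Integrable N m) (hN0 : ∀ e, 0 ≤ N e) (hΦN : ∀ h, |h| < δ → ∀ e, |Φ h e| ≤ N e) (b : ℝ) :
    Integrable (fun x : ℝ × E => k x.1 * (cutoff δ b x.1 * Φ (b * x.1) x.2)) (volume.prod m) := by
  have h1 : Integrable (fun x : ℝ × E => k x.1 * N x.2) (volume.prod m) := hk.mul_prod hN
  refine Integrable.mono h1 ?_ (ae_of_all _ fun x => ?_)
  · refine (hk.1.comp_fst).mul (Measurable.aestronglyMeasurable ?_)
    have h2 : Measurable fun x : ℝ × E => (b * x.1, x.2) := by fun_prop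
    exact ((measurable_cutoff δ b).comp measurable_fst).mul (hΦ.comp h2)
  · simp only [norm_mul, Real.norm_eq_abs]
    rw [← abs_mul (cutoff _ _ _), abs_of_nonneg (hN0 x.2)]
    exact mul_le_mul_of_nonneg_left (abs_cutoff_mul_le hΦN hN0 _ _ _) (abs_nonneg _)

-- Dominated convergence on the product space: the cutoff confines b u to the range where `N`
-- dominates `Φ`, and for fixed u it is eventually 1. The absolute value is taken before any weight
-- is inserted, which is what makes the next estimate uniform in the weight.
omit [SFinite m] in
lemma tendsto_integral_approx (hδ : 0 < δ) (hk : Integrable k)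
    (hΦ : Measurable (Function.uncurry Φ)) (hN : Integrable N m) (hN0 : ∀ e, 0 ≤ N e)
    (hΦN : ∀ h, |h| < δ → ∀ e, |Φ h e| ≤ N e) (hΦ0 : ∀ e, ContinuousAt (fun h => Φ h e) 0) :
    Tendsto (fun b => ∫ x : ℝ × E, |k x.1 * (cutoff δ b x.1 * Φ (b * x.1) x.2 - Φ 0 x.2)|
      ∂(volume.prod m)) (𝓝 0) (𝓝 0) := by
  suffices h : Tendsto (fun b => ∫ x : ℝ × E,
      |k x.1 * (cutoff δ b x.1 * Φ (b * x.1) x.2 - Φ 0 x.2)| ∂(volume.prod m)) (𝓝 0)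
      (𝓝 (∫ x : ℝ × E, (0 : ℝ) ∂(volume.prod m))) by simpa using h
  refine tendsto_integral_filter_of_dominated_convergence
    (fun x : ℝ × E => |k x.1| * (2 * N x.2)) ?_ ?_ ?_ ?_
  · refine Eventually.of_forall fun b => ?_
    refine AEStronglyMeasurable.norm (f := fun x : ℝ × E =>
      k x.1 * (cutoff δ b x.1 * Φ (b * x.1) x.2 - Φ 0 x.2))
      ((hk.1.comp_fst).mul (Measurable.aestronglyMeasurable ?_))
    have h2 : Measurable fun x : ℝ × E => (b * x.1, x.2) := by fun_prop
    have h3 : Measurable fun x : ℝ × E => ((0 : ℝ), x.2) := by fun_prop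
    exact (((measurable_cutoff δ b).comp measurable_fst).mul (hΦ.comp h2)).sub (hΦ.comp h3)
  · refine Eventually.of_forall fun b => ae_of_all _ fun x => ?_
    rw [Real.norm_eq_abs, abs_abs, abs_mul]
    refine mul_le_mul_of_nonneg_left ?_ (abs_nonneg _)
    have h1 := abs_cutoff_mul_le hΦN hN0 b x.1 x.2
    have h2 := hΦN 0 (by simpa using hδ) x.2
    calc _ ≤ |cutoff δ b x.1 * Φ (b * x.1) x.2| + |Φ 0 x.2| := abs_sub _ _
      _ ≤ 2 * N x.2 := by linarith
  · exact hk.norm.mul_prod (hN.const_mul 2)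
  · refine ae_of_all _ fun x => ?_
    have h1 : Tendsto (fun b : ℝ => Φ (b * x.1) x.2) (𝓝 0) (𝓝 (Φ 0 x.2)) := by
      have hc : Tendsto (fun b : ℝ => b * x.1) (𝓝 0) (𝓝 0) := by
        have h : Continuous fun b : ℝ => b * x.1 := by fun_prop
        simpa using h.tendsto 0
      exact (hΦ0 x.2).tendsto.comp hc
    have h2 : Tendsto (fun b : ℝ => cutoff δ b x.1) (𝓝 0) (𝓝 1) :=
      tendsto_const_nhds.congr' ((eventually_cutoff_eq_one hδ x.1).mono fun b hb => hb.symm)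
    have h3 := (((h2.mul h1).sub_const (Φ 0 x.2)).const_mul (k x.1)).abs
    simpa using h3

/-- The error splits into the sup bound of the weight and an L¹ error in which the weight does not
occur. Fitted nuisance functions will play the role of `G`. -/
lemma abs_integral_approx_le (hδ : 0 < δ) (hk : Integrable k)
    (hΦ : Measurable (Function.uncurry Φ)) (hN : Integrable N m) (hN0 : ∀ e, 0 ≤ N e)
    (hΦN : ∀ h, |h| < δ → ∀ e, |Φ h e| ≤ N e) (b : ℝ) {G : E → ℝ} (hG : Measurable G) {C : ℝ}
    (hGC : ∀ e, |G e| ≤ C) :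
    Integrable (fun x : ℝ × E => k x.1 * (cutoff δ b x.1 * Φ (b * x.1) x.2) * G x.2)
      (volume.prod m) ∧
    |(∫ x : ℝ × E, k x.1 * (cutoff δ b x.1 * Φ (b * x.1) x.2) * G x.2 ∂(volume.prod m))
      - (∫ u, k u) * ∫ e, Φ 0 e * G e ∂m| ≤
      C * ∫ x : ℝ × E, |k x.1 * (cutoff δ b x.1 * Φ (b * x.1) x.2 - Φ 0 x.2)| ∂(volume.prod m) := by
  have hG' : Measurable fun x : ℝ × E => G x.2 := hG.comp measurable_snd
  have hΦ0 : Measurable (Φ 0) := hΦ.comp (measurable_const.prodMk measurable_id)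
  have hi0 : Integrable (Φ 0) m := hN.mono hΦ0.aestronglyMeasurable (ae_of_all _ fun e => by
    simpa [abs_of_nonneg (hN0 e)] using hΦN 0 (by simpa using hδ) e)
  have hi1 := integrable_kernel_cutoff hk hΦ hN hN0 hΦN b
  have hi2 : Integrable (fun x : ℝ × E => k x.1 * Φ 0 x.2) (volume.prod m) := hk.mul_prod hi0
  have hj1 := hi1.mul_bdd (c := C) hG'.aestronglyMeasurable (ae_of_all _ fun x => by simpa using hGC x.2)
  have hj2 := hi2.mul_bdd (c := C) hG'.aestronglyMeasurable (ae_of_all _ fun x => by simpa using hGC x.2)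
  refine ⟨hj1, ?_⟩
  have he : (∫ u, k u) * ∫ e, Φ 0 e * G e ∂m =
      ∫ x : ℝ × E, k x.1 * Φ 0 x.2 * G x.2 ∂(volume.prod m) := by
    rw [← integral_prod_mul]; simp only [mul_assoc]
  rw [he, ← integral_sub hj1 hj2, ← integral_const_mul]
  have hd : ∀ x : ℝ × E, k x.1 * (cutoff δ b x.1 * Φ (b * x.1) x.2) * G x.2 -
      k x.1 * Φ 0 x.2 * G x.2 = k x.1 * (cutoff δ b x.1 * Φ (b * x.1) x.2 - Φ 0 x.2) * G x.2 := by
    intro x; ring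
  simp only [hd]
  have hi3 : Integrable (fun x : ℝ × E =>
      k x.1 * (cutoff δ b x.1 * Φ (b * x.1) x.2 - Φ 0 x.2)) (volume.prod m) := by
    refine (hi1.sub hi2).congr (ae_of_all _ fun x => ?_)
    simp only [Pi.sub_apply]; ring
  refine (abs_integral_le_integral_abs).trans (integral_mono_of_nonneg (ae_of_all _ fun x =>
    abs_nonneg _) (hi3.abs.const_mul C) (ae_of_all _ fun x => ?_))
  simp only
  rw [abs_mul, mul_comm]
  exact mul_le_mul_of_nonneg_right (hGC x.2) (abs_nonneg _)

end ApproximateIdentity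

/-! ### Tails and decay of the kernel -/

section Kernel

variable {K : ℝ → ℝ}

lemma IsSecondOrderKernel.continuous (hK : IsSecondOrderKernel K) : Continuous K := by
  obtain ⟨L, hL⟩ := hK.lipschitz; exact hL.continuous

lemma IsSecondOrderKernel.integrable_sq (hK : IsSecondOrderKernel K) :
    Integrable fun u => K u ^ 2 := by
  obtain ⟨C, hC⟩ := hK.bounded
  have := hK.integrable.mul_bdd (c := C) hK.continuous.aestronglyMeasurable
    (ae_of_all _ fun u => by simpa using hC u)
  simpa [sq] using this

lemma IsSecondOrderKernel.omegaTwo_pos (hK : IsSecondOrderKernel K) : 0 < omegaTwo K := by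
  unfold omegaTwo
  rw [integral_pos_iff_support_of_nonneg (fun u => sq_nonneg _) hK.integrable_sq]
  rw [pos_iff_ne_zero]
  intro h0
  have h1 : K =ᵐ[volume] 0 := by
    rw [Filter.EventuallyEq, ae_iff]
    refine measure_mono_null (fun u hu => ?_) h0
    simpa using hu
  have h2 := hK.integral_eq_one
  rw [integral_congr_ae h1] at h2
  simp at h2

/-- The part of `∫ u² |K(u)| du` over `|b u| ≥ δ`. -/
def tailMoment (K : ℝ → ℝ) (δ b : ℝ) : ℝ := ∫ u, u ^ 2 * |K u| * (1 - cutoff δ b u)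

lemma IsSecondOrderKernel.integrable_sq_mul_abs (hK : IsSecondOrderKernel K) :
    Integrable fun u => u ^ 2 * |K u| := by
  have := hK.integrable_second_moment.abs
  simpa [abs_mul] using this

lemma one_sub_cutoff_nonneg (δ b u : ℝ) : 0 ≤ 1 - cutoff δ b u := by
  linarith [cutoff_le_one δ b u]

lemma one_sub_cutoff_le_one (δ b u : ℝ) : 1 - cutoff δ b u ≤ 1 := by
  linarith [cutoff_nonneg δ b u]

lemma measurable_one_sub_cutoff (δ b : ℝ) : Measurable fun u => 1 - cutoff δ b u :=
  measurable_const.sub (measurable_cutoff δ b)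

lemma integrable_mul_one_sub_cutoff {g : ℝ → ℝ} (hg : Integrable g) (δ b : ℝ) :
    Integrable fun u => g u * (1 - cutoff δ b u) :=
  hg.mul_bdd (c := 1) (measurable_one_sub_cutoff δ b).aestronglyMeasurable
    (ae_of_all _ fun u => by
      rw [Real.norm_eq_abs, abs_of_nonneg (one_sub_cutoff_nonneg δ b u)]
      exact one_sub_cutoff_le_one δ b u)

lemma integrable_mul_cutoff {g : ℝ → ℝ} (hg : Integrable g) (δ b : ℝ) :
    Integrable fun u => g u * cutoff δ b u :=
  hg.mul_bdd (c := 1) (measurable_cutoff δ b).aestronglyMeasurable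
    (ae_of_all _ fun u => by
      rw [Real.norm_eq_abs, abs_of_nonneg (cutoff_nonneg δ b u)]
      exact cutoff_le_one δ b u)

lemma tailMoment_nonneg (K : ℝ → ℝ) (δ b : ℝ) : 0 ≤ tailMoment K δ b :=
  integral_nonneg fun u => mul_nonneg (by positivity) (one_sub_cutoff_nonneg δ b u)

lemma IsSecondOrderKernel.tendsto_tailMoment (hK : IsSecondOrderKernel K) {δ : ℝ} (hδ : 0 < δ) :
    Tendsto (tailMoment K δ) (𝓝 0) (𝓝 0) := by
  have := tendsto_integral_filter_of_dominated_convergence (l := 𝓝 (0 : ℝ)) (μ := volume)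
    (F := fun b u => u ^ 2 * |K u| * (1 - cutoff δ b u)) (f := fun _ => (0 : ℝ))
    (fun u : ℝ => u ^ 2 * |K u|) ?_ ?_ hK.integrable_sq_mul_abs ?_
  · rw [integral_zero] at this; exact this
  · exact Eventually.of_forall fun b =>
      (integrable_mul_one_sub_cutoff hK.integrable_sq_mul_abs δ b).1
  · refine Eventually.of_forall fun b => ae_of_all _ fun u => ?_
    rw [Real.norm_eq_abs, abs_mul, abs_of_nonneg (one_sub_cutoff_nonneg δ b u),
      abs_of_nonneg (by positivity : 0 ≤ u ^ 2 * |K u|)]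
    exact mul_le_of_le_one_right (by positivity) (one_sub_cutoff_le_one δ b u)
  · refine ae_of_all _ fun u => tendsto_const_nhds.congr' ?_
    filter_upwards [eventually_cutoff_eq_one hδ u] with b hb
    simp [hb]

/-- Chebyshev: outside the cutoff (b u)²/δ² is at least 1. Since the truncated second moment itself
tends to zero, the lost mass is o(b²) and does not disturb the b² term of the bias. -/
lemma IsSecondOrderKernel.integral_tail_le (hK : IsSecondOrderKernel K) {δ : ℝ} (hδ : 0 < δ)
    (b : ℝ) : ∫ u, |K u| * (1 - cutoff δ b u) ≤ b ^ 2 / δ ^ 2 * tailMoment K δ b := by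
  rw [tailMoment, ← integral_const_mul]
  refine integral_mono (integrable_mul_one_sub_cutoff hK.integrable.abs δ b)
    ((integrable_mul_one_sub_cutoff hK.integrable_sq_mul_abs δ b).const_mul _) fun u => ?_
  simp only
  unfold cutoff
  split_ifs with h
  · simp
  · have h1 : δ ^ 2 ≤ (b * u) ^ 2 := by
      rw [← sq_abs (b * u)]; exact pow_le_pow_left₀ hδ.le (not_lt.1 h) 2
    have h2 : 1 ≤ (b * u) ^ 2 / δ ^ 2 := by rwa [le_div_iff₀ (by positivity), one_mul]
    calc |K u| * (1 - 0) ≤ ((b * u) ^ 2 / δ ^ 2) * |K u| := by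
          rw [sub_zero, mul_one]; exact le_mul_of_one_le_left (abs_nonneg _) h2
      _ = _ := by ring

/-- A Lipschitz function with an integrable second moment is `O(1/u)`. -/
lemma IsSecondOrderKernel.exists_decay (hK : IsSecondOrderKernel K) :
    ∃ D, 0 ≤ D ∧ ∀ u, u ^ 2 * K u ^ 2 ≤ D := by
  obtain ⟨L, hL⟩ := hK.lipschitz
  set I := ∫ u, u ^ 2 * |K u| with hI
  -- Adding 1 keeps the Lipschitz constant positive, as it is divided by below.
  set l : ℝ := L + 1 with hl
  have hl0 : 0 < l := by positivity
  have hlip : ∀ x y, |K x - K y| ≤ l * |x - y| := fun x y => by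
    have := hL.dist_le_mul x y
    rw [Real.dist_eq, Real.dist_eq] at this
    exact this.trans (mul_le_mul_of_nonneg_right (by linarith) (abs_nonneg _))
  have key : ∀ u, 0 ≤ u → u ^ 2 * K u ^ 2 ≤ 4 * l * I := by
    intro u hu
    -- On [u, u + r] the Lipschitz bound keeps |K| above |K u|/2, so the second moment is at least r
    -- u² |K u|/2 = u² K(u)²/(4 l).
    set r := |K u| / (2 * l) with hr
    have hr0 : 0 ≤ r := by positivity
    have h1 : ∫ x in Set.Icc u (u + r), u ^ 2 * (|K u| / 2) ≤
        ∫ x in Set.Icc u (u + r), x ^ 2 * |K x| := by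
      refine setIntegral_mono_on (integrableOn_const (by simp)) hK.integrable_sq_mul_abs.integrableOn
        measurableSet_Icc fun x hx => ?_
      have hx1 : |K u| / 2 ≤ |K x| := by
        have h2 := hlip u x
        have h3 : |u - x| ≤ r := by rw [abs_le]; constructor <;> linarith [hx.1, hx.2]
        have h4 : l * |u - x| ≤ |K u| / 2 := by
          calc l * |u - x| ≤ l * r := by gcongr
            _ = |K u| / 2 := by rw [hr]; field_simp
        have h5 := abs_sub_abs_le_abs_sub (K u) (K x)
        linarith
      have hx2 : u ^ 2 ≤ x ^ 2 := pow_le_pow_left₀ hu hx.1 2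
      exact mul_le_mul hx2 hx1 (by positivity) (by positivity)
    have h2 : ∫ x in Set.Icc u (u + r), x ^ 2 * |K x| ≤ I :=
      setIntegral_le_integral hK.integrable_sq_mul_abs (ae_of_all _ fun x => by positivity)
    have h3 : ∫ x in Set.Icc u (u + r), u ^ 2 * (|K u| / 2) = r * (u ^ 2 * (|K u| / 2)) := by
      simp [hr0]
    rw [h3] at h1
    have h4 : r * (u ^ 2 * (|K u| / 2)) * (4 * l) = u ^ 2 * K u ^ 2 := by
      rw [hr, ← sq_abs (K u)]; field_simp; ring
    nlinarith
  have hI0 : 0 ≤ I := integral_nonneg fun u => by positivity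
  refine ⟨4 * l * I, by positivity, fun u => ?_⟩
  rcases le_total 0 u with h | h
  · exact key u h
  · have := key (-u) (by linarith)
    rwa [hK.symmetric, neg_sq] at this

end Kernel

/-! ### Second-order Taylor expansion and kernel smoothing -/

section Taylor

/-- Second-order Taylor quotient of `f` at `a` with increment `h`, extended by half the second
derivative at `h = 0`. -/
def taylorQuotient (f : ℝ → ℝ) (f₁ f₂ a h : ℝ) : ℝ :=
  if h = 0 then f₂ / 2 else (f (a + h) - f a - h * f₁) / h ^ 2

lemma sq_mul_taylorQuotient (f : ℝ → ℝ) (f₁ f₂ a h : ℝ) :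
    h ^ 2 * taylorQuotient f f₁ f₂ a h = f (a + h) - f a - h * f₁ := by
  unfold taylorQuotient
  split_ifs with h0
  · simp [h0]
  · field_simp

/-- Mean value inequality for s ↦ f(s) - s f'(a) - (s - a)² c/2 on the closed ball of radius |h|.
The choice c = 0 gives the domination of the Taylor quotient; c equal to the second derivative at a,
with M arbitrarily small, gives its continuity at zero. -/
lemma abs_sub_taylor_le {f f' : ℝ → ℝ} {a c M δ : ℝ}
    (hf : ∀ s ∈ Metric.ball a δ, HasDerivAt f (f' s) s)
    (hb : ∀ s ∈ Metric.ball a δ, |f' s - f' a - (s - a) * c| ≤ M * |s - a|) {h : ℝ}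
    (hM : 0 ≤ M) (hh : |h| < δ) :
    |f (a + h) - f a - h * f' a - h ^ 2 * (c / 2)| ≤ M * h ^ 2 := by
  have hsub : Metric.closedBall a |h| ⊆ Metric.ball a δ := Metric.closedBall_subset_ball hh
  have hg : ∀ s ∈ Metric.closedBall a |h|,
      HasDerivWithinAt (fun s => f s - s * f' a - (s - a) ^ 2 * (c / 2))
        (f' s - f' a - (s - a) * c) (Metric.closedBall a |h|) s := by
    intro s hs
    have h1 := hf s (hsub hs)
    have h2 : HasDerivAt (fun s => (s - a) ^ 2 * (c / 2)) ((s - a) * c) s := by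
      have := (((hasDerivAt_id s).sub_const a).pow 2).mul_const (c / 2)
      convert! this using 1
      simp; ring
    have h3 := ((h1.sub ((hasDerivAt_id s).mul_const (f' a))).sub h2).hasDerivWithinAt
      (s := Metric.closedBall a |h|)
    refine (h3.congr_deriv (by simp)).congr (fun y _ => ?_) ?_ <;> simp
  have := (convex_closedBall a |h|).norm_image_sub_le_of_norm_hasDerivWithin_le hg
    (C := M * |h|) (fun s hs => ?_) (x := a) (y := a + h) (by simp) (by simp)
  · simp only [Real.norm_eq_abs] at this
    calc _ = |f (a + h) - (a + h) * f' a - (a + h - a) ^ 2 * (c / 2) -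
          (f a - a * f' a - (a - a) ^ 2 * (c / 2))| := by congr 1; ring
      _ ≤ _ := this
      _ = M * (|h| * |h|) := by rw [add_sub_cancel_left]; ring
      _ = M * h ^ 2 := by rw [abs_mul_abs_self]; ring
  · refine (hb s (hsub hs)).trans ?_
    have : |s - a| ≤ |h| := by simpa [Real.dist_eq] using hs
    gcongr

lemma abs_taylorQuotient_le {f f' f'' : ℝ → ℝ} {a M δ : ℝ}
    (hf : ∀ s ∈ Metric.ball a δ, HasDerivAt f (f' s) s)
    (hf' : ∀ s ∈ Metric.ball a δ, HasDerivAt f' (f'' s) s)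
    (hM : ∀ s ∈ Metric.ball a δ, |f'' s| ≤ M) {h : ℝ} (hh : |h| < δ) :
    |taylorQuotient f (f' a) (f'' a) a h| ≤ M := by
  have hδ : 0 < δ := (abs_nonneg h).trans_lt hh
  have hM0 : 0 ≤ M := (abs_nonneg _).trans (hM a (Metric.mem_ball_self hδ))
  rcases eq_or_ne h 0 with rfl | h0
  · have := hM a (Metric.mem_ball_self hδ)
    simp only [taylorQuotient, if_true, abs_div, abs_two]
    linarith
  · have h1 := abs_sub_taylor_le (c := 0) hf (M := M) (fun s hs => ?_) hM0 hh
    · simp only [taylorQuotient, if_neg h0, abs_div, abs_of_nonneg (sq_nonneg h)]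
      rw [div_le_iff₀ (by positivity)]
      simpa using h1
    · have h2 := (convex_ball a δ).norm_image_sub_le_of_norm_hasDerivWithin_le
        (fun x hx => (hf' x hx).hasDerivWithinAt) (fun x hx => by simpa using hM x hx)
        (Metric.mem_ball_self hδ) hs
      simpa using h2

lemma continuousAt_taylorQuotient {f f' : ℝ → ℝ} {f₂ a δ : ℝ} (hδ : 0 < δ)
    (hf : ∀ s ∈ Metric.ball a δ, HasDerivAt f (f' s) s) (hf' : HasDerivAt f' f₂ a) :
    ContinuousAt (taylorQuotient f (f' a) f₂ a) 0 := by
  rw [Metric.continuousAt_iff]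
  intro ε hε
  have h1 := (hasDerivAt_iff_isLittleO.1 hf').bound (half_pos hε)
  obtain ⟨r, hr, hr'⟩ := Metric.eventually_nhds_iff_ball.1 h1
  refine ⟨min r δ, lt_min hr hδ, fun {h} hh => ?_⟩
  have hh' : |h| < min r δ := by simpa using hh
  rcases eq_or_ne h 0 with rfl | h0
  · simpa using hε
  have h2 := abs_sub_taylor_le (f := f) (f' := f') (a := a) (c := f₂) (M := ε / 2) (δ := min r δ)
    (fun s hs => hf s (Metric.ball_subset_ball (min_le_right _ _) hs))
    (fun s hs => by
      simpa using hr' s (Metric.ball_subset_ball (min_le_left _ _) hs)) (by positivity) hh'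
  have h3 : h ^ 2 * (taylorQuotient f (f' a) f₂ a h - taylorQuotient f (f' a) f₂ a 0) =
      f (a + h) - f a - h * f' a - h ^ 2 * (f₂ / 2) := by
    rw [mul_sub, sq_mul_taylorQuotient]
    simp [taylorQuotient]
  rw [← h3, abs_mul, abs_of_nonneg (sq_nonneg h), mul_comm] at h2
  have h4 := le_of_mul_le_mul_right h2 (by positivity : 0 < h ^ 2)
  rw [Real.dist_eq]
  linarith

variable {E : Type*} [MeasurableSpace E] {m : Measure E} [SFinite m] {K : ℝ → ℝ}
  {F F₁ F₂ : ℝ → E → ℝ} {N : E → ℝ} {a δ : ℝ}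

/-- The cutoff is even, so symmetry kills the first moment exactly even after truncation. A
vanishing full first moment would leave a tail term. -/
lemma IsSecondOrderKernel.integral_mul_cutoff_mul_self (hK : IsSecondOrderKernel K) (b : ℝ) :
    ∫ u, u * K u * cutoff δ b u = 0 := by
  have h := integral_neg_eq_self (fun u => u * K u * cutoff δ b u) volume
  have h2 : ∀ u, -u * K (-u) * cutoff δ b (-u) = -(u * K u * cutoff δ b u) := fun u => by
    rw [hK.symmetric, cutoff_neg]; ring
  simp only [h2, integral_neg] at h
  linarith

lemma IsSecondOrderKernel.integrable_id_mul (hK : IsSecondOrderKernel K) :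
    Integrable fun u => u * K u := by
  refine (hK.integrable.abs.add hK.integrable_sq_mul_abs).mono
    (measurable_id.aestronglyMeasurable.mul hK.integrable.1) (ae_of_all _ fun u => ?_)
  simp only [Real.norm_eq_abs, Pi.add_apply, abs_mul]
  rw [abs_of_nonneg (by positivity : 0 ≤ |K u| + u ^ 2 * |K u|)]
  have : |u| ≤ 1 + u ^ 2 := by
    rw [← sq_abs u]; nlinarith [sq_nonneg (|u| - 1)]
  nlinarith [abs_nonneg (K u)]

/-- Kernel smoothing of a twice differentiable family, with an error that is uniform in bounded
weights. -/
lemma IsSecondOrderKernel.exists_smoothing_expansion (hK : IsSecondOrderKernel K) (hδ : 0 < δ)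
    (hF : Measurable (Function.uncurry F)) (hF₁ : Measurable (F₁ a)) (hF₂ : Measurable (F₂ a))
    (hN : Integrable N m)
    (hd : ∀ e, ∀ s ∈ Metric.ball a δ, HasDerivAt (fun s => F s e) (F₁ s e) s)
    (hd₁ : ∀ e, ∀ s ∈ Metric.ball a δ, HasDerivAt (fun s => F₁ s e) (F₂ s e) s)
    (hb₀ : ∀ e, |F a e| ≤ N e) (hb₁ : ∀ e, |F₁ a e| ≤ N e)
    (hb₂ : ∀ e, ∀ s ∈ Metric.ball a δ, |F₂ s e| ≤ N e) :
    ∃ r : ℝ → ℝ, Tendsto r (𝓝 0) (𝓝 0) ∧ ∀ b (C : ℝ) (G : E → ℝ), Measurable G →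
      (∀ e, |G e| ≤ C) →
      Integrable (fun x : ℝ × E => K x.1 * (cutoff δ b x.1 * F (a + b * x.1) x.2) * G x.2)
        (volume.prod m) ∧
      |(∫ x : ℝ × E, K x.1 * (cutoff δ b x.1 * F (a + b * x.1) x.2) * G x.2 ∂(volume.prod m))
        - ∫ e, F a e * G e ∂m - b ^ 2 / 2 * kappaTwo K * ∫ e, F₂ a e * G e ∂m|
        ≤ C * (b ^ 2 * r b) := by
  have ha : a ∈ Metric.ball a δ := Metric.mem_ball_self hδ
  have hN0 : ∀ e, 0 ≤ N e := fun e => (abs_nonneg _).trans (hb₀ e)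
  set Φ : ℝ → E → ℝ := fun h e => taylorQuotient (fun s => F s e) (F₁ a e) (F₂ a e) a h with hΦdef
  have hFa : Measurable (F a) := hF.comp (measurable_const.prodMk measurable_id)
  have hΦ : Measurable (Function.uncurry Φ) := by
    have h1 : Measurable fun x : ℝ × E => (a + x.1, x.2) := by fun_prop
    have h2 : Measurable fun x : ℝ × E => F (a + x.1) x.2 := hF.comp h1
    have h3 : Measurable fun x : ℝ × E => F a x.2 := hFa.comp measurable_snd
    have h4 : Measurable fun x : ℝ × E => F₁ a x.2 := hF₁.comp measurable_snd
    have h5 : Measurable fun x : ℝ × E => F₂ a x.2 := hF₂.comp measurable_snd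
    refine Measurable.ite (measurable_fst (measurableSet_singleton (0 : ℝ))) (h5.div_const 2) ?_
    exact ((h2.sub h3).sub (measurable_fst.mul h4)).div (measurable_fst.pow_const 2)
  have hΦN : ∀ h, |h| < δ → ∀ e, |Φ h e| ≤ N e := fun h hh e =>
    abs_taylorQuotient_le (hd e) (hd₁ e) (hb₂ e) hh
  have hΦ0 : ∀ e, ContinuousAt (fun h => Φ h e) 0 := fun e =>
    continuousAt_taylorQuotient hδ (hd e) (hd₁ e a ha)
  have hΦz : ∀ e, Φ 0 e = F₂ a e / 2 := fun e => by simp [hΦdef, taylorQuotient]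
  have hk := hK.integrable_second_moment
  set r₁ : ℝ → ℝ := fun b => ∫ x : ℝ × E,
    |x.1 ^ 2 * K x.1 * (cutoff δ b x.1 * Φ (b * x.1) x.2 - Φ 0 x.2)| ∂(volume.prod m) with hr₁
  have hr₁0 : Tendsto r₁ (𝓝 0) (𝓝 0) := tendsto_integral_approx hδ hk hΦ hN hN0 hΦN hΦ0
  set J := ∫ e, N e ∂m with hJ
  -- `r₁` is the error of the Taylor quotient; the second summand accounts for the truncated kernel
  -- having mass only 1 + o(b²), which multiplies the zeroth-order term.
  refine ⟨fun b => r₁ b + tailMoment K δ b / δ ^ 2 * J, ?_, fun b C G hG hGC => ?_⟩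
  · simpa using hr₁0.add (((hK.tendsto_tailMoment hδ).div_const (δ ^ 2)).mul_const J)
  obtain ⟨hi, hle⟩ := abs_integral_approx_le hδ hk hΦ hN hN0 hΦN b hG hGC
  have hint : ∀ f : E → ℝ, Measurable f → (∀ e, |f e| ≤ N e) →
      Integrable (fun e => f e * G e) m := fun f hf hfN =>
    (hN.mono hf.aestronglyMeasurable (ae_of_all _ fun e => by
      simpa [abs_of_nonneg (hN0 e)] using hfN e)).mul_bdd (c := C) hG.aestronglyMeasurable
      (ae_of_all _ fun e => by simpa using hGC e)
  have hi0 := hint _ hFa hb₀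
  have hi1 := hint _ hF₁ hb₁
  have hj0 : Integrable (fun x : ℝ × E => (K x.1 * cutoff δ b x.1) * (F a x.2 * G x.2))
      (volume.prod m) := (integrable_mul_cutoff hK.integrable δ b).mul_prod hi0
  have hj1 : Integrable (fun x : ℝ × E => (x.1 * K x.1 * cutoff δ b x.1) * (F₁ a x.2 * G x.2))
      (volume.prod m) := (integrable_mul_cutoff hK.integrable_id_mul δ b).mul_prod hi1
  -- Taylor's formula with the quotient as exact remainder; the middle term integrates to zero by
  -- symmetry.
  have hdec : ∀ x : ℝ × E, K x.1 * (cutoff δ b x.1 * F (a + b * x.1) x.2) * G x.2 =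
      (K x.1 * cutoff δ b x.1) * (F a x.2 * G x.2) +
      b * ((x.1 * K x.1 * cutoff δ b x.1) * (F₁ a x.2 * G x.2)) +
      b ^ 2 * (x.1 ^ 2 * K x.1 * (cutoff δ b x.1 * Φ (b * x.1) x.2) * G x.2) := by
    intro x
    have := sq_mul_taylorQuotient (fun s => F s x.2) (F₁ a x.2) (F₂ a x.2) a (b * x.1)
    have h2 : F (a + b * x.1) x.2 = F a x.2 + b * x.1 * F₁ a x.2 +
        (b * x.1) ^ 2 * Φ (b * x.1) x.2 := by rw [hΦdef]; linarith
    rw [h2]; ring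
  simp only [hdec]
  have hj2 : Integrable (fun x : ℝ × E => (K x.1 * cutoff δ b x.1) * (F a x.2 * G x.2) +
      b * ((x.1 * K x.1 * cutoff δ b x.1) * (F₁ a x.2 * G x.2))) (volume.prod m) :=
    hj0.add (hj1.const_mul b)
  refine ⟨hj2.add (hi.const_mul (b ^ 2)), ?_⟩
  rw [integral_add hj2 (hi.const_mul (b ^ 2)),
    integral_add hj0 (hj1.const_mul b), integral_const_mul, integral_const_mul,
    integral_prod_mul (fun u => K u * cutoff δ b u) (fun e => F a e * G e),
    integral_prod_mul (fun u => u * K u * cutoff δ b u) (fun e => F₁ a e * G e),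
    hK.integral_mul_cutoff_mul_self b]
  have hz : ∫ e, Φ 0 e * G e ∂m = (∫ e, F₂ a e * G e ∂m) / 2 := by
    rw [← integral_div]; congr 1; ext e; rw [hΦz]; ring
  rw [hz] at hle
  set c₀ := ∫ u, K u * cutoff δ b u with hc₀
  set I₀ := ∫ e, F a e * G e ∂m with hI₀
  set I₂ := ∫ e, F₂ a e * G e ∂m with hI₂
  set R := ∫ x : ℝ × E, x.1 ^ 2 * K x.1 * (cutoff δ b x.1 * Φ (b * x.1) x.2) * G x.2
    ∂(volume.prod m) with hR
  have hC0 : |I₀| ≤ C * J := by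
    rw [hJ, ← integral_const_mul]
    refine abs_integral_le_integral_abs.trans (integral_mono hi0.abs (hN.const_mul C) fun e => ?_)
    simp only [abs_mul]
    rw [mul_comm]
    exact mul_le_mul (hGC e) (hb₀ e) (abs_nonneg _) ((abs_nonneg _).trans (hGC e))
  have hc1 : |c₀ - 1| ≤ b ^ 2 / δ ^ 2 * tailMoment K δ b := by
    refine le_trans ?_ (hK.integral_tail_le hδ b)
    have h1 : |c₀ - 1| = |c₀ - ∫ u, K u| := by rw [hK.integral_eq_one]
    rw [h1, hc₀, ← integral_sub (integrable_mul_cutoff hK.integrable δ b)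
      hK.integrable]
    refine abs_integral_le_integral_abs.trans (le_of_eq ?_)
    congr 1; ext u
    rw [show K u * cutoff δ b u - K u = -(K u * (1 - cutoff δ b u)) by ring, abs_neg, abs_mul,
      abs_of_nonneg (one_sub_cutoff_nonneg δ b u)]
  have hk2 : ∫ u, u ^ 2 * K u = kappaTwo K := rfl
  rw [hk2] at hle
  have e1 : c₀ * I₀ + b * (0 * ∫ e, F₁ a e * G e ∂m) + b ^ 2 * R - I₀ -
      b ^ 2 / 2 * kappaTwo K * I₂ = (c₀ - 1) * I₀ + b ^ 2 * (R - kappaTwo K * (I₂ / 2)) := by ring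
  rw [e1]
  calc _ ≤ |(c₀ - 1) * I₀| + |b ^ 2 * (R - kappaTwo K * (I₂ / 2))| := abs_add_le _ _
    _ = |c₀ - 1| * |I₀| + b ^ 2 * |R - kappaTwo K * (I₂ / 2)| := by
        rw [abs_mul, abs_mul, abs_of_nonneg (sq_nonneg b)]
    _ ≤ (b ^ 2 / δ ^ 2 * tailMoment K δ b) * (C * J) + b ^ 2 * (C * r₁ b) := by
        have := tailMoment_nonneg K δ b
        gcongr
    _ = _ := by ring

end Taylor

/-! ### Conditional densities and conditional independence -/

section CondDensity

variable {Ω τ γ Γ : Type*} [mΩ : MeasurableSpace Ω] [MeasurableSpace τ] [MeasurableSpace γ]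
  [MeasurableSpace Γ] {P : Measure Ω} [IsProbabilityMeasure P] {ν : Measure τ} [SigmaFinite ν]
  {T : Ω → τ} {C : Ω → γ} {G : Ω → Γ} {p : τ → γ → ℝ}

lemma IsCondDensity.setLIntegral_eq (hp : IsCondDensity P ν T C p) (hT : Measurable T)
    (hC : Measurable C) {s : Set τ} {u : Set γ} (hs : MeasurableSet s) (hu : MeasurableSet u) :
    ∫⁻ ω in C ⁻¹' u, (∫⁻ t in s, ENNReal.ofReal (p t (C ω)) ∂ν) ∂P = P (T ⁻¹' s ∩ C ⁻¹' u) := by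
  have hm := hp.measurable
  have hm2 : Measurable fun x : τ × γ => ENNReal.ofReal (p x.1 x.2) :=
    ENNReal.measurable_ofReal.comp hm
  have h1 : P (T ⁻¹' s ∩ C ⁻¹' u) = P.map (fun ω => (T ω, C ω)) (s ×ˢ u) := by
    rw [Measure.map_apply (hT.prodMk hC) (hs.prod hu)]; rfl
  rw [h1, hp.map_eq, withDensity_apply _ (hs.prod hu), ← Measure.prod_restrict,
    lintegral_prod_symm' _ hm2, Measure.restrict_map hC hu, lintegral_map _ hC]
  exact Measurable.lintegral_prod_left' hm2

/-- A conditional density of `T` given `C` is also one given `(G, C)`, if `G` and `T` are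
conditionally independent given `C`. -/
lemma IsCondDensity.of_condIndep [StandardBorelSpace Ω] (hp : IsCondDensity P ν T C p)
    (hT : Measurable T) (hC : Measurable C) (hG : Measurable G)
    (hind : CondIndep (MeasurableSpace.comap C inferInstance)
      (MeasurableSpace.comap G inferInstance) (MeasurableSpace.comap T inferInstance)
      hC.comap_le P) :
    IsCondDensity P ν T (fun ω => (G ω, C ω)) (fun t c => p t c.2) := by
  have hm := hp.measurable
  have hm2 : Measurable fun x : τ × γ => ENNReal.ofReal (p x.1 x.2) :=
    ENNReal.measurable_ofReal.comp hm
  have h3 : Measurable fun x : τ × Γ × γ => (x.1, x.2.2) := by fun_prop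
  have h4 : Measurable fun x : τ × Γ × γ => ENNReal.ofReal (p x.1 x.2.2) := hm2.comp h3
  refine ⟨hm.comp h3, fun t c => hp.nonneg t c.2, ?_⟩
  -- On a rectangle the claim reads E[1(G ∈ t) 1(C ∈ u) P(T ∈ s | C)] = P(G ∈ t, C ∈ u, T ∈ s),
  -- which is the factorisation of conditional probabilities integrated over the event C ∈ u.
  rw [Measure.ext_prod₃_iff]
  intro s t u hs ht hu
  rw [Measure.map_apply (by fun_prop) (hs.prod (ht.prod hu)),
    withDensity_apply _ (hs.prod (ht.prod hu)), ← Measure.prod_restrict,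
    lintegral_prod_symm' _ h4,
    Measure.restrict_map (hG.prodMk hC) (ht.prod hu), lintegral_map _ (hG.prodMk hC)]
  swap
  · exact Measurable.lintegral_prod_left' h4
  have hpre : (fun ω => (G ω, C ω)) ⁻¹' t ×ˢ u = G ⁻¹' t ∩ C ⁻¹' u := rfl
  have hpre2 : (fun ω => (T ω, G ω, C ω)) ⁻¹' s ×ˢ t ×ˢ u =
    C ⁻¹' u ∩ (G ⁻¹' t ∩ T ⁻¹' s) := by ext ω; simp; tauto
  rw [hpre, hpre2]
  set L : γ → ENNReal := fun c => ∫⁻ x in s, ENNReal.ofReal (p x c) ∂ν with hL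
  have hLm : Measurable L := Measurable.lintegral_prod_left' hm2
  have hLset : ∀ u, MeasurableSet u → ∫⁻ ω in C ⁻¹' u, L (C ω) ∂P = P (T ⁻¹' s ∩ C ⁻¹' u) :=
    fun u hu => hp.setLIntegral_eq hT hC hs hu
  have hLfin : ∫⁻ ω, L (C ω) ∂P ≠ ⊤ := by
    have := hLset Set.univ MeasurableSet.univ
    simp only [Set.preimage_univ, Measure.restrict_univ, Set.inter_univ] at this
    rw [this]; exact measure_ne_top _ _
  have hLae : ∀ᵐ ω ∂P, L (C ω) < ⊤ := ae_lt_top (hLm.comp hC) hLfin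
  set l : Ω → ℝ := fun ω => (L (C ω)).toReal with hl
  have hlm : StronglyMeasurable[MeasurableSpace.comap C inferInstance] l := by
    have : Measurable[MeasurableSpace.comap C inferInstance] l :=
      hLm.ennreal_toReal.comp (comap_measurable C)
    exact this.stronglyMeasurable
  have hli : Integrable l P := integrable_toReal_of_lintegral_ne_top (hLm.comp hC).aemeasurable hLfin
  have hsT := hT hs
  have htG := hG ht
  -- The integral of the density over s is a version of P(T ∈ s | C).
  have hlE : l =ᵐ[P] P⟦T ⁻¹' s | MeasurableSpace.comap C inferInstance⟧ := by
    refine ae_eq_condExp_of_forall_setIntegral_eq hC.comap_le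
      ((integrable_const _).indicator hsT) (fun _ _ _ => hli.integrableOn) ?_
      hlm.aestronglyMeasurable
    rintro _ ⟨u, hu, rfl⟩ -
    have h5 := integral_toReal (μ := P.restrict (C ⁻¹' u)) (f := fun ω => L (C ω))
      (hLm.comp hC).aemeasurable (ae_restrict_of_ae hLae)
    rw [h5, hLset u hu,
      integral_indicator hsT, Measure.restrict_restrict hsT]
    simp [Measure.real]
  have hci := (condIndep_iff _ _ _ hC.comap_le hG.comap_le hT.comap_le P).1 hind (G ⁻¹' t)
    (T ⁻¹' s) ⟨t, ht, rfl⟩ ⟨s, hs, rfl⟩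
  have hind1 : Integrable ((G ⁻¹' t).indicator fun _ => (1 : ℝ)) P :=
    (integrable_const _).indicator htG
  have hmulI : Integrable (((G ⁻¹' t).indicator fun _ => (1 : ℝ)) * l) P := by
    have := hli.indicator htG
    refine this.congr (ae_of_all _ fun ω => ?_)
    by_cases h : ω ∈ G ⁻¹' t <;> simp [h]
  have hpull := condExp_mul_of_stronglyMeasurable_right hlm hmulI hind1
  have huC : MeasurableSet[MeasurableSpace.comap C inferInstance] (C ⁻¹' u) := ⟨u, hu, rfl⟩
  have key : ∫ ω in C ⁻¹' u, ((G ⁻¹' t).indicator (fun _ => (1 : ℝ)) * l) ω ∂P =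
      P.real (C ⁻¹' u ∩ (G ⁻¹' t ∩ T ⁻¹' s)) := by
    rw [← setIntegral_condExp hC.comap_le hmulI huC]
    have h4 : P[((G ⁻¹' t).indicator fun _ => (1 : ℝ)) * l|MeasurableSpace.comap C inferInstance]
        =ᵐ[P] P⟦G ⁻¹' t ∩ T ⁻¹' s|MeasurableSpace.comap C inferInstance⟧ := by
      filter_upwards [hpull, hlE, hci] with ω h1 h2 h3
      rw [h1, h3, Pi.mul_apply, Pi.mul_apply, h2]
    rw [setIntegral_congr_ae (g := P⟦G ⁻¹' t ∩ T ⁻¹' s|MeasurableSpace.comap C inferInstance⟧)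
      (hC hu) (h4.mono fun ω h _ => h),
      setIntegral_condExp hC.comap_le ((integrable_const _).indicator (htG.inter hsT)) huC,
      integral_indicator (htG.inter hsT), Measure.restrict_restrict (htG.inter hsT)]
    simp [Set.inter_comm]
  have h5 : ∫⁻ ω in G ⁻¹' t ∩ C ⁻¹' u, L (C ω) ∂P =
      ENNReal.ofReal (∫ ω in G ⁻¹' t ∩ C ⁻¹' u, l ω ∂P) := by
    rw [ofReal_integral_eq_lintegral_ofReal hli.integrableOn (ae_of_all _ fun ω => by simp [hl])]
    refine lintegral_congr_ae (ae_restrict_of_ae (hLae.mono fun ω h => ?_))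
    simp [hl, ENNReal.ofReal_toReal h.ne]
  have h6 : ∫ ω in G ⁻¹' t ∩ C ⁻¹' u, l ω ∂P =
      ∫ ω in C ⁻¹' u, ((G ⁻¹' t).indicator (fun _ => (1 : ℝ)) * l) ω ∂P := by
    rw [← Measure.restrict_restrict htG, ← integral_indicator htG]
    congr 1; ext ω
    by_cases h : ω ∈ G ⁻¹' t <;> simp [h]
  rw [h5, h6, key]
  simp [Measure.real]

lemma IsCondDensity.integral_eq (hp : IsCondDensity P ν T C p) (hT : Measurable T)
    (hC : Measurable C) {g : τ × γ → ℝ} (hg : Measurable g)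
    (hi : Integrable (fun ω => g (T ω, C ω)) P) :
    Integrable (fun t => ∫ ω, p t (C ω) * g (t, C ω) ∂P) ν ∧
    (∀ᵐ t ∂ν, Integrable (fun ω => p t (C ω) * g (t, C ω)) P) ∧
    ∫ ω, g (T ω, C ω) ∂P = ∫ t, ∫ ω, p t (C ω) * g (t, C ω) ∂P ∂ν := by
  have hm := hp.measurable
  have h1 := (integrable_comp_iff_of_map_eq_withDensity (hT.prodMk hC) hm
    (fun x => hp.nonneg x.1 x.2) hp.map_eq hg).1 hi
  have h2 := integral_comp_of_map_eq_withDensity (hT.prodMk hC) hm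
    (fun x => hp.nonneg x.1 x.2) hp.map_eq hg
  have h0 : ∀ t, Measurable fun c => p t c * g (t, c) := fun t =>
    (hm.comp (measurable_const.prodMk measurable_id)).mul
      (hg.comp (measurable_const.prodMk measurable_id))
  have h3 : ∀ t, ∫ c, p t c * g (t, c) ∂(P.map C) = ∫ ω, p t (C ω) * g (t, C ω) ∂P := fun t =>
    integral_map hC.aemeasurable (h0 t).aestronglyMeasurable
  refine ⟨?_, ?_, ?_⟩
  · simpa only [Function.uncurry, h3] using h1.integral_prod_left
  · filter_upwards [h1.prod_right_ae] with t ht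
    exact (integrable_map_measure (h0 t).aestronglyMeasurable hC.aemeasurable).1 ht
  · rw [h2, integral_prod _ h1]
    simpa only [Function.uncurry] using integral_congr_ae (ae_of_all _ h3)

/-- Under conditional independence the conditional law of `G` given `(C, T)` depends on `C` only, so
`G` is integrated out with respect to its law given `C`, while `C` and `T` stay fixed in the
integrand. -/
lemma condExp_of_condIndepFun [StandardBorelSpace Ω] [StandardBorelSpace τ] [StandardBorelSpace Γ]
    (hT : Measurable T) (hC : Measurable C) (hG : Measurable G)
    (hind : CondIndepFun (MeasurableSpace.comap C inferInstance) hC.comap_le T G P)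
    [Nonempty Γ] {f : (γ × τ) × Γ → ℝ} (hf : Measurable f)
    (hi : Integrable (fun ω => f ((C ω, T ω), G ω)) P) :
    P[fun ω => f ((C ω, T ω), G ω) |
        MeasurableSpace.comap (fun ω => (C ω, T ω)) inferInstance]
      =ᵐ[P] fun ω => ∫ g, f ((C ω, T ω), g) ∂(condDistrib G C P (C ω)) := by
  obtain ⟨ω₀⟩ : Nonempty Ω := nonempty_of_isProbabilityMeasure P
  have : Nonempty τ := ⟨T ω₀⟩
  have h1 := (condIndepFun_iff_condDistrib_prod_ae_eq_prodMkRight hG hT hC).1 hind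
  have h2 := condExp_prod_ae_eq_integral_condDistrib (hC.prodMk hT) hG.aemeasurable
    hf.stronglyMeasurable hi
  have h3 := ae_of_ae_map (hC.prodMk hT).aemeasurable h1
  filter_upwards [h2, h3] with ω h4 h5
  rw [h4, h5, Kernel.prodMkRight_apply]

/-- Pulling out the measurable factor. In this form, orthogonality to test functions, the bridge
equations are used. -/
lemma integral_mul_eq_zero_of_condExp_eq_zero {m : MeasurableSpace Ω} (hm : m ≤ mΩ)
    {R ψ : Ω → ℝ} (hR : Integrable R P) (h0 : P[R|m] =ᵐ[P] fun _ => (0 : ℝ))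
    (hψ : StronglyMeasurable[m] ψ) (hi : Integrable (R * ψ) P) : ∫ ω, R ω * ψ ω ∂P = 0 := by
  have h1 := condExp_mul_of_stronglyMeasurable_right hψ hi hR
  have h2 : ∫ ω, (R * ψ) ω ∂P = 0 := by
    rw [← integral_condExp hm]
    refine integral_eq_zero_of_ae ?_
    filter_upwards [h1, h0] with ω h3 h4
    rw [h3, Pi.mul_apply, h4]; simp
  exact h2

omit mΩ in
lemma comap_eq_comap_of_comp {α β : Type*} [MeasurableSpace α] [MeasurableSpace β] {f : Ω → α}
    {g : Ω → β} {φ : β → α} {ψ : α → β} (hφ : Measurable φ) (hψ : Measurable ψ)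
    (hf : f = φ ∘ g) (hg : g = ψ ∘ f) :
    MeasurableSpace.comap f inferInstance = MeasurableSpace.comap g inferInstance := by
  apply le_antisymm
  · rw [hf]; exact (hφ.comp (comap_measurable g)).comap_le
  · rw [hg]; exact (hψ.comp (comap_measurable f)).comap_le

end CondDensity

/-! ### The outcome residual given the latent variables -/

section Identification

/-- The σ-algebra generated by treatment, confounder, covariates and treatment proxy. -/
abbrev Variables.latentAlgebra {Ω 𝒰 𝒳 𝒵 𝒲 : Type*} [MeasurableSpace Ω] [MeasurableSpace 𝒰]
    [MeasurableSpace 𝒳] [MeasurableSpace 𝒵] [MeasurableSpace 𝒲] (v : Variables Ω 𝒰 𝒳 𝒵 𝒲) :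
    MeasurableSpace Ω :=
  MeasurableSpace.comap (fun ω => ((v.A ω, v.U ω, v.X ω), v.Z ω)) inferInstance

variable {Ω 𝒰 𝒳 𝒵 𝒲 : Type*}
    [mΩ : MeasurableSpace Ω] [StandardBorelSpace Ω] [MeasurableSpace 𝒰]
    [MeasurableSpace 𝒳] [MeasurableSpace 𝒵] [StandardBorelSpace 𝒵]
    [MeasurableSpace 𝒲] [StandardBorelSpace 𝒲]
    {P : Measure Ω} [IsProbabilityMeasure P] {v : Variables Ω 𝒰 𝒳 𝒵 𝒲} {S : Set ℝ}
    {h₀ : ℝ → 𝒲 → 𝒳 → ℝ} {q₀ : ℝ → 𝒵 → 𝒳 → ℝ}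

omit [StandardBorelSpace Ω] [StandardBorelSpace 𝒵] [StandardBorelSpace 𝒲]
  [IsProbabilityMeasure P] in
lemma ae_bounded_of_uniformlyBounded {τ γ : Type*} {f : ℝ → τ → γ → ℝ}
    (hb : UniformlyBounded S f) (hAS : ∀ᵐ ω ∂P, v.A ω ∈ S) (T : Ω → τ) (C : Ω → γ) :
    ∃ c, ∀ᵐ ω ∂P, ‖f (v.A ω) (T ω) (C ω)‖ ≤ c := by
  obtain ⟨c, hc⟩ := hb
  exact ⟨c, hAS.mono fun ω h => hc _ h _ _⟩

omit [StandardBorelSpace Ω] [StandardBorelSpace 𝒵] [StandardBorelSpace 𝒲] in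
lemma Variables.IsOutcomeBridge.memLp (hh₀ : v.IsOutcomeBridge P h₀)
    (hAS : ∀ᵐ ω ∂P, v.A ω ∈ S) (hb : UniformlyBounded S h₀) :
    MemLp (fun ω => h₀ (v.A ω) (v.W ω) (v.X ω)) 2 P := by
  obtain ⟨c, hc⟩ := ae_bounded_of_uniformlyBounded hb hAS v.W v.X
  have hm : Measurable fun ω => h₀ (v.A ω) (v.W ω) (v.X ω) :=
    hh₀.measurable.comp (v.measurable_A.prodMk (v.measurable_W.prodMk v.measurable_X))
  exact MemLp.of_bound hm.aestronglyMeasurable c hc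

/-- The residual of the outcome bridge has mean zero given the treatment, the confounder and the
covariates. -/
lemma Variables.IsOutcomeBridge.latent (hh₀ : v.IsOutcomeBridge P h₀)
    (hAS : ∀ᵐ ω ∂P, v.A ω ∈ S) (hb : UniformlyBounded S h₀) (hY : MemLp v.Y 2 P)
    (hproxy : v.ProxyIndependence P) (hcompl : v.Completeness P)
    {ψ : ℝ × 𝒰 × 𝒳 → ℝ} (hψ : Measurable ψ) {c : ℝ} (hψc : ∀ x, |ψ x| ≤ c) :
    ∫ ω, (v.Y ω - h₀ (v.A ω) (v.W ω) (v.X ω)) * ψ (v.A ω, v.U ω, v.X ω) ∂P = 0 := by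
  obtain ⟨ω₀⟩ : Nonempty Ω := nonempty_of_isProbabilityMeasure P
  have : Nonempty 𝒲 := ⟨v.W ω₀⟩
  have mA := v.measurable_A
  have mU := v.measurable_U
  have mX := v.measurable_X
  have mZ := v.measurable_Z
  have mW := v.measurable_W
  have mY := v.measurable_Y
  have hhL := hh₀.memLp hAS hb
  have hhI := hhL.integrable one_le_two
  have hYI := hY.integrable one_le_two
  have hRL : MemLp (fun ω => v.Y ω - h₀ (v.A ω) (v.W ω) (v.X ω)) 2 P := hY.sub hhL
  have mAUX : Measurable fun ω => (v.A ω, v.U ω, v.X ω) := mA.prodMk (mU.prodMk mX)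
  have mUX : Measurable fun ω => (v.U ω, v.X ω) := mU.prodMk mX
  have mAZ : Measurable fun ω => (v.A ω, v.Z ω) := mA.prodMk mZ
  have hLle : v.latentAlgebra ≤ mΩ := (mAUX.prodMk mZ).comap_le
  -- Given (A,U,X,Z) the outcome is averaged under its law given (A,U,X), because Y ⊥ Z | A,U,X;
  -- `h2` does the same for W, whose law depends on (U,X) only. Hence the conditional mean of the
  -- residual does not involve Z.
  have h1 := condExp_of_condIndepFun (P := P) mZ mAUX mY hproxy.outcome.symm
    (f := fun x => x.2) measurable_snd hYI
  have mh : Measurable fun x : ((𝒰 × 𝒳) × ℝ × 𝒵) × 𝒲 => h₀ x.1.2.1 x.2 x.1.1.2 := by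
    have : Measurable fun x : ((𝒰 × 𝒳) × ℝ × 𝒵) × 𝒲 => (x.1.2.1, x.2, x.1.1.2) := by fun_prop
    exact hh₀.measurable.comp this
  have h2 := condExp_of_condIndepFun (P := P) mAZ mUX mW hproxy.proxy.symm
    (f := fun x => h₀ x.1.2.1 x.2 x.1.1.2) mh hhI
  have hL' : MeasurableSpace.comap (fun ω => ((v.U ω, v.X ω), v.A ω, v.Z ω)) inferInstance = v.latentAlgebra :=
    comap_eq_comap_of_comp
      (φ := fun x : (ℝ × 𝒰 × 𝒳) × 𝒵 => ((x.1.2.1, x.1.2.2), x.1.1, x.2))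
      (ψ := fun x : (𝒰 × 𝒳) × ℝ × 𝒵 => ((x.2.1, x.1.1, x.1.2), x.2.2))
      (by fun_prop) (by fun_prop) rfl rfl
  rw [hL'] at h2
  set ν₁ : ℝ × 𝒰 × 𝒳 → ℝ := fun x => ∫ y, y ∂(condDistrib v.Y (fun ω => (v.A ω, v.U ω, v.X ω)) P x)
  set ν₂ : ℝ × 𝒰 × 𝒳 → ℝ := fun x =>
    ∫ w, h₀ x.1 w x.2.2 ∂(condDistrib v.W (fun ω => (v.U ω, v.X ω)) P x.2)
  have hν₁ : Measurable ν₁ :=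
    (StronglyMeasurable.integral_condDistrib (μ := P) (Y := v.Y)
      (X := fun ω => (v.A ω, v.U ω, v.X ω)) (f := fun x => x.2)
      measurable_snd.stronglyMeasurable).measurable
  have hν₂ : Measurable ν₂ := by
    have hf : StronglyMeasurable (fun x : (ℝ × 𝒰 × 𝒳) × 𝒲 => h₀ x.1.1 x.2 x.1.2.2) := by
      have : Measurable fun x : (ℝ × 𝒰 × 𝒳) × 𝒲 => (x.1.1, x.2, x.1.2.2) := by fun_prop
      exact (hh₀.measurable.comp this).stronglyMeasurable
    exact (StronglyMeasurable.integral_kernel_prod_right'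
      (κ := (condDistrib v.W (fun ω => (v.U ω, v.X ω)) P).comap
        (Prod.snd : ℝ × 𝒰 × 𝒳 → 𝒰 × 𝒳) measurable_snd) hf).measurable
  have hRlat : P[fun ω => v.Y ω - h₀ (v.A ω) (v.W ω) (v.X ω)|v.latentAlgebra] =ᵐ[P]
      fun ω => ν₁ (v.A ω, v.U ω, v.X ω) - ν₂ (v.A ω, v.U ω, v.X ω) := by
    have h3 := condExp_sub hYI hhI v.latentAlgebra
    filter_upwards [h1, h2, h3] with ω e1 e2 e3
    have e4 : (P[fun ω => v.Y ω - h₀ (v.A ω) (v.W ω) (v.X ω)|v.latentAlgebra]) ω =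
      (P[v.Y|v.latentAlgebra]) ω - (P[fun ω => h₀ (v.A ω) (v.W ω) (v.X ω)|v.latentAlgebra]) ω := e3
    have e5 : (P[v.Y|v.latentAlgebra]) ω = _ := e1
    rw [e4, e2, e5]
  set g : 𝒰 × ℝ × 𝒳 → ℝ := fun x => ν₁ (x.2.1, x.1, x.2.2) - ν₂ (x.2.1, x.1, x.2.2) with hg
  have hgm : Measurable g := by
    have : Measurable fun x : 𝒰 × ℝ × 𝒳 => (x.2.1, x.1, x.2.2) := by fun_prop
    exact (hν₁.comp this).sub (hν₂.comp this)
  -- Completeness is available for square-integrable functions only; here that follows from the L²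
  -- contraction of conditional expectation.
  have hgL : MemLp (fun ω => g (v.U ω, (v.A ω, v.X ω))) 2 P :=
    (memLp_congr_ae hRlat).1 (hRL.condExp (m := v.latentAlgebra) one_le_two)
  have hle : MeasurableSpace.comap (fun ω => (v.Z ω, (v.A ω, v.X ω))) inferInstance ≤ v.latentAlgebra := by
    have h4 : Measurable fun x : (ℝ × 𝒰 × 𝒳) × 𝒵 => (x.2, x.1.1, x.1.2.2) := by fun_prop
    exact (h4.comp (comap_measurable
      (fun ω => ((v.A ω, v.U ω, v.X ω), v.Z ω)))).comap_le
  have heq : MeasurableSpace.comap (fun ω => (v.Z ω, (v.A ω, v.X ω))) inferInstance =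
      MeasurableSpace.comap (fun ω => (v.A ω, v.Z ω, v.X ω)) inferInstance :=
    comap_eq_comap_of_comp (φ := fun x : ℝ × 𝒵 × 𝒳 => (x.2.1, x.1, x.2.2))
      (ψ := fun x : 𝒵 × ℝ × 𝒳 => (x.2.1, x.1, x.2.2)) (by fun_prop) (by fun_prop) rfl rfl
  -- Tower property: projecting from (A,U,X,Z) down to (A,Z,X) gives the outcome bridge equation.
  have hg0 : P[fun ω => g (v.U ω, (v.A ω, v.X ω)) |
      MeasurableSpace.comap (fun ω => (v.Z ω, (v.A ω, v.X ω))) inferInstance]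
        =ᵐ[P] fun _ => (0 : ℝ) := by
    have e1 := condExp_congr_ae (m := MeasurableSpace.comap
      (fun ω => (v.Z ω, (v.A ω, v.X ω))) inferInstance) hRlat
    have e2 := condExp_condExp_of_le (μ := P)
      (f := fun ω => v.Y ω - h₀ (v.A ω) (v.W ω) (v.X ω)) hle hLle
    have e3 := hh₀.bridge
    rw [← heq] at e3
    exact e1.symm.trans (e2.trans e3)
  have hgz := (hcompl.U_of_Z g hgm hgL).1 hg0
  have hR0 : P[fun ω => v.Y ω - h₀ (v.A ω) (v.W ω) (v.X ω)|v.latentAlgebra] =ᵐ[P] fun _ => (0 : ℝ) :=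
    hRlat.trans hgz
  have hψm : StronglyMeasurable[v.latentAlgebra] fun ω => ψ (v.A ω, v.U ω, v.X ω) := by
    have : Measurable[v.latentAlgebra] fun ω => ψ (v.A ω, v.U ω, v.X ω) :=
      (hψ.comp measurable_fst).comp (comap_measurable
        (fun ω => ((v.A ω, v.U ω, v.X ω), v.Z ω)))
    exact this.stronglyMeasurable
  exact integral_mul_eq_zero_of_condExp_eq_zero hLle (hRL.integrable one_le_two) hR0 hψm
    ((hRL.integrable one_le_two).mul_bdd (c := c) (hψ.comp mAUX).aestronglyMeasurable
      (ae_of_all _ fun ω => hψc _))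

end Identification

/-! ### Truncated inverse density weights -/

section Weight

/-- The indicator of `t ∈ S` and `p t c ≥ η`. -/
def densityCutoff {γ : Type*} (S : Set ℝ) (p : ℝ → γ → ℝ) (η : ℝ) (x : ℝ × γ) : ℝ :=
  (S ×ˢ Set.univ ∩ {x : ℝ × γ | η ≤ p x.1 x.2}).indicator (fun _ => 1) x

variable {Ω γ : Type*} [MeasurableSpace Ω] [MeasurableSpace γ] {P : Measure Ω}
  [IsProbabilityMeasure P] {S : Set ℝ} {A : Ω → ℝ} {C : Ω → γ} {p : ℝ → γ → ℝ} {η : ℝ}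

lemma measurable_densityCutoff (hS : MeasurableSet S) (hp : Measurable (Function.uncurry p)) :
    Measurable (densityCutoff S p η) :=
  measurable_const.indicator ((hS.prod MeasurableSet.univ).inter
    (measurableSet_le measurable_const hp))

omit [MeasurableSpace γ] in
lemma densityCutoff_mem (x : ℝ × γ) : |densityCutoff S p η x| ≤ 1 := by
  unfold densityCutoff
  by_cases h : x ∈ S ×ˢ Set.univ ∩ {x : ℝ × γ | η ≤ p x.1 x.2} <;> simp [h]

omit [MeasurableSpace γ] in
lemma abs_densityCutoff_div_le (hη : 0 < η) (x : ℝ × γ) :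
    |densityCutoff S p η x / p x.1 x.2| ≤ 1 / η := by
  unfold densityCutoff
  by_cases h : x ∈ S ×ˢ Set.univ ∩ {x : ℝ × γ | η ≤ p x.1 x.2}
  · have h1 : η ≤ p x.1 x.2 := h.2
    rw [Set.indicator_of_mem h, abs_of_nonneg (div_nonneg zero_le_one (hη.le.trans h1))]
    exact one_div_le_one_div_of_le hη h1
  · rw [Set.indicator_of_notMem h]; simp [hη.le]

omit [MeasurableSpace γ] in
lemma mul_densityCutoff_div (hη : 0 < η) (x : ℝ × γ) :
    p x.1 x.2 * (densityCutoff S p η x / p x.1 x.2) = densityCutoff S p η x := by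
  unfold densityCutoff
  by_cases h : x ∈ S ×ˢ Set.univ ∩ {x : ℝ × γ | η ≤ p x.1 x.2}
  · have h1 : η ≤ p x.1 x.2 := h.2
    have : p x.1 x.2 ≠ 0 := (hη.trans_le h1).ne'
    field_simp
  · rw [Set.indicator_of_notMem h]; simp

/-- Under the law p(s|c) ds P_C(dc) the density cancels the weight 1/p and only the cutoff survives,
so a weighted expectation at the random level A becomes an integral over deterministic levels s. The
cutoff keeps the weight bounded by 1/η. -/
lemma IsCondDensity.integral_densityCutoff (hS : MeasurableSet S)
    (hp : IsCondDensity P volume A C p)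
    (hA : Measurable A) (hC : Measurable C) (hη : 0 < η) {g : ℝ × γ → ℝ} (hg : Measurable g)
    (hi : Integrable (fun ω => g (A ω, C ω)) P) :
    Integrable (fun s => ∫ ω, densityCutoff S p η (s, C ω) * g (s, C ω) ∂P) ∧
    ∀ T, MeasurableSet T → ∫ s in T, ∫ ω, densityCutoff S p η (s, C ω) * g (s, C ω) ∂P =
      ∫ ω, g (A ω, C ω) * (densityCutoff S p η (A ω, C ω) / p (A ω) (C ω) *
        T.indicator (fun _ => 1) (A ω)) ∂P := by
  have hw := measurable_densityCutoff (η := η) hS hp.measurable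
  have key : ∀ T, MeasurableSet T →
      Integrable (fun s => ∫ ω, T.indicator (fun _ => (1 : ℝ)) s *
        (densityCutoff S p η (s, C ω) * g (s, C ω)) ∂P) ∧
      ∫ ω, g (A ω, C ω) * (densityCutoff S p η (A ω, C ω) / p (A ω) (C ω) *
        T.indicator (fun _ => 1) (A ω)) ∂P = ∫ s, ∫ ω, T.indicator (fun _ => (1 : ℝ)) s *
        (densityCutoff S p η (s, C ω) * g (s, C ω)) ∂P := by
    intro T hT
    have hind : Measurable (T.indicator fun _ => (1 : ℝ)) := measurable_const.indicator hT
    have hm : Measurable fun x : ℝ × γ => densityCutoff S p η x / p x.1 x.2 *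
        T.indicator (fun _ => 1) x.1 :=
      (hw.div hp.measurable).mul (hind.comp measurable_fst)
    have hb : ∀ x : ℝ × γ, ‖densityCutoff S p η x / p x.1 x.2 *
        T.indicator (fun _ => 1) x.1‖ ≤ 1 / η := by
      intro x
      rw [norm_mul, Real.norm_eq_abs]
      have h1 := abs_densityCutoff_div_le (S := S) (p := p) hη x
      have h2 : ‖T.indicator (fun _ => (1 : ℝ)) x.1‖ ≤ 1 := by
        by_cases h : x.1 ∈ T <;> simp [h]
      calc _ ≤ 1 / η * 1 := mul_le_mul h1 h2 (norm_nonneg _) (by positivity)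
        _ = 1 / η := mul_one _
    have h1 := hp.integral_eq hA hC (g := fun x => g x * (densityCutoff S p η x / p x.1 x.2 *
        T.indicator (fun _ => 1) x.1)) (hg.mul hm)
      (hi.mul_bdd (c := 1 / η) (hm.comp (hA.prodMk hC)).aestronglyMeasurable
        (ae_of_all _ fun ω => hb _))
    have h2 : ∀ s ω, p s (C ω) * (g (s, C ω) * (densityCutoff S p η (s, C ω) / p s (C ω) *
        T.indicator (fun _ => 1) s)) = T.indicator (fun _ => (1 : ℝ)) s *
        (densityCutoff S p η (s, C ω) * g (s, C ω)) := by
      intro s ω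
      have := mul_densityCutoff_div (S := S) (p := p) hη (s, C ω)
      simp only at this
      nth_rewrite 2 [← this]; ring
    simp only [h2] at h1
    exact ⟨h1.1, h1.2.2⟩
  refine ⟨by simpa using (key Set.univ MeasurableSet.univ).1, fun T hT => ?_⟩
  rw [(key T hT).2, ← integral_indicator hT]
  congr 1; ext s
  by_cases h : s ∈ T <;> simp [h]

-- Removal of the cutoff: where p(s|C) is positive, the cutoff is eventually 1.
omit [IsProbabilityMeasure P] in
lemma tendsto_integral_densityCutoff (hp : Measurable (Function.uncurry p)) (hC : Measurable C)
    (hS : MeasurableSet S) {s : ℝ} (hs : s ∈ S) (hpos : ∀ᵐ ω ∂P, 0 < p s (C ω)) {f : Ω → ℝ}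
    (hf : Integrable f P) :
    Tendsto (fun k : ℕ => ∫ ω, densityCutoff S p (1 / ((k : ℝ) + 1)) (s, C ω) * f ω ∂P) atTop
      (𝓝 (∫ ω, f ω ∂P)) := by
  refine tendsto_integral_of_dominated_convergence (fun ω => |f ω|) (fun k => ?_) hf.abs
    (fun k => ae_of_all _ fun ω => ?_) ?_
  · exact (((measurable_densityCutoff hS hp).comp
      (measurable_const.prodMk hC)).aestronglyMeasurable).mul hf.1
  · rw [norm_mul, Real.norm_eq_abs, Real.norm_eq_abs]
    exact mul_le_of_le_one_left (abs_nonneg _) (densityCutoff_mem _)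
  · filter_upwards [hpos] with ω hω
    refine tendsto_const_nhds.congr' ?_
    filter_upwards [tendsto_one_div_add_atTop_nhds_zero_nat.eventually (gt_mem_nhds hω)] with k hk
    have : (s, C ω) ∈ S ×ˢ Set.univ ∩ {x : ℝ × γ | 1 / ((k : ℝ) + 1) ≤ p x.1 x.2} :=
      ⟨⟨hs, trivial⟩, hk.le⟩
    rw [densityCutoff, Set.indicator_of_mem this, one_mul]

end Weight

/-! ### Identification of the causal effect by the outcome bridge -/

section Identification

variable {Ω 𝒰 𝒳 𝒵 𝒲 : Type*}
    [mΩ : MeasurableSpace Ω] [StandardBorelSpace Ω] [MeasurableSpace 𝒰]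
    [MeasurableSpace 𝒳] [MeasurableSpace 𝒵] [StandardBorelSpace 𝒵]
    [MeasurableSpace 𝒲] [StandardBorelSpace 𝒲]
    {P : Measure Ω} [IsProbabilityMeasure P] {v : Variables Ω 𝒰 𝒳 𝒵 𝒲} {S : Set ℝ}
    {h₀ : ℝ → 𝒲 → 𝒳 → ℝ} {q₀ : ℝ → 𝒵 → 𝒳 → ℝ}

omit [StandardBorelSpace 𝒵] [StandardBorelSpace 𝒲] in
/-- The outcome proxy is independent of the treatment given confounder and covariates. -/
lemma Variables.ProxyIndependence.proxy_treatment (hproxy : v.ProxyIndependence P) :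
    CondIndep (MeasurableSpace.comap (fun ω => (v.U ω, v.X ω)) inferInstance)
      (MeasurableSpace.comap v.W inferInstance) (MeasurableSpace.comap v.A inferInstance)
      (v.measurable_U.prodMk v.measurable_X).comap_le P :=
  hproxy.proxy.comp measurable_id (measurable_fst (α := ℝ) (β := 𝒵))

/-- Both Y(s) and h₀(s,W,X) are observed through elements, `G` and W, that are conditionally
independent of A given (U,X); so p(·|U,X) is the density of A given either of them together with
(U,X). Orthogonality of the residual to inverse density weights then equates the two means level by
level. Factoring through `G` allows the σ-algebra of latent ignorability to be treated as an
ordinary random element. -/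
lemma ae_eq_integral_of_factor {Γ : Type*} [MeasurableSpace Γ] {G : Ω → Γ} (hG : Measurable G)
    {Y' : ℝ → Γ → ℝ} (hY' : Measurable (Function.uncurry Y')) (hYG : ∀ s ω, v.Ypot s ω = Y' s (G ω))
    (hind : CondIndep (MeasurableSpace.comap (fun ω => (v.U ω, v.X ω)) inferInstance)
      (MeasurableSpace.comap G inferInstance) (MeasurableSpace.comap v.A inferInstance)
      (v.measurable_U.prodMk v.measurable_X).comap_le P)
    (hS : IsOpen S) (hAS : ∀ᵐ ω ∂P, v.A ω ∈ S)
    (hcons : v.Consistency P) (hpos : v.Positivity P S)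
    (hproxy : v.ProxyIndependence P) (hcompl : v.Completeness P)
    (hY : MemLp v.Y 2 P) (hYpot : ∀ a ∈ S, Integrable (v.Ypot a) P)
    (hh₀ : v.IsOutcomeBridge P h₀) (hb : UniformlyBounded S h₀) :
    ∀ᵐ s, s ∈ S → v.beta P s = ∫ ω, h₀ s (v.W ω) (v.X ω) ∂P := by
  obtain ⟨p, hp, hppos⟩ := hpos
  have mA := v.measurable_A
  have mW := v.measurable_W
  have mX := v.measurable_X
  have mUX : Measurable fun ω => (v.U ω, v.X ω) := v.measurable_U.prodMk mX
  have hpY := hp.of_condIndep mA mUX hG hind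
  have hpW := hp.of_condIndep mA mUX mW hproxy.proxy_treatment
  have hgY : Measurable fun x : ℝ × Γ × 𝒰 × 𝒳 => Y' x.1 x.2.1 := by
    have : Measurable fun x : ℝ × Γ × 𝒰 × 𝒳 => (x.1, x.2.1) := by fun_prop
    exact hY'.comp this
  have hgW : Measurable fun x : ℝ × 𝒲 × 𝒰 × 𝒳 => h₀ x.1 x.2.1 x.2.2.2 := by
    have : Measurable fun x : ℝ × 𝒲 × 𝒰 × 𝒳 => (x.1, x.2.1, x.2.2.2) := by fun_prop
    exact hh₀.measurable.comp this
  have hYe : (fun ω => Y' (v.A ω) (G ω)) =ᵐ[P] v.Y := by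
    filter_upwards [hcons] with ω h; rw [← hYG, h]
  have hiY : Integrable (fun ω => Y' (v.A ω) (G ω)) P :=
    (hY.integrable one_le_two).congr hYe.symm
  have hiW : Integrable (fun ω => h₀ (v.A ω) (v.W ω) (v.X ω)) P :=
    (hh₀.memLp hAS hb).integrable one_le_two
  have step : ∀ k : ℕ, ∀ᵐ s, ∫ ω, densityCutoff S p (1 / ((k : ℝ) + 1)) (s, v.U ω, v.X ω) *
      v.Ypot s ω ∂P = ∫ ω, densityCutoff S p (1 / ((k : ℝ) + 1)) (s, v.U ω, v.X ω) *
      h₀ s (v.W ω) (v.X ω) ∂P := by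
    intro k
    have hη : 0 < 1 / ((k : ℝ) + 1) := by positivity
    obtain ⟨i1, e1⟩ := hpY.integral_densityCutoff hS.measurableSet mA (hG.prodMk mUX) hη hgY hiY
    obtain ⟨i2, e2⟩ := hpW.integral_densityCutoff hS.measurableSet mA (mW.prodMk mUX) hη hgW hiW
    have i1' : Integrable fun s => ∫ ω, densityCutoff S p (1 / ((k : ℝ) + 1)) (s, v.U ω, v.X ω) *
      v.Ypot s ω ∂P := by simp only [hYG]; exact i1
    have i2' : Integrable fun s => ∫ ω, densityCutoff S p (1 / ((k : ℝ) + 1)) (s, v.U ω, v.X ω) *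
      h₀ s (v.W ω) (v.X ω) ∂P := i2
    -- The integrals over T of the two sides are E[Y ψ] and E[h₀(A,W,X) ψ] for the same bounded
    -- function ψ of (A,U,X), namely the truncated inverse density times the indicator of T at A.
    refine i1'.ae_eq_of_forall_setIntegral_eq _ _ i2' fun T hT _ => ?_
    simp only [hYG]
    refine (e1 T hT).trans (Eq.trans ?_ (e2 T hT).symm)
    have hψ : Measurable fun x : ℝ × 𝒰 × 𝒳 => densityCutoff S p (1 / ((k : ℝ) + 1)) x /
        p x.1 x.2 * T.indicator (fun _ => (1 : ℝ)) x.1 :=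
      ((measurable_densityCutoff hS.measurableSet hp.measurable).div hp.measurable).mul
        ((measurable_const.indicator hT).comp measurable_fst)
    have hψb : ∀ x : ℝ × 𝒰 × 𝒳, |densityCutoff S p (1 / ((k : ℝ) + 1)) x /
        p x.1 x.2 * T.indicator (fun _ => (1 : ℝ)) x.1| ≤ 1 / (1 / ((k : ℝ) + 1)) := by
      intro x
      rw [abs_mul]
      have h1 := abs_densityCutoff_div_le (S := S) (p := p) hη x
      have h2 : |T.indicator (fun _ => (1 : ℝ)) x.1| ≤ 1 := by
        by_cases h : x.1 ∈ T <;> simp [h]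
      calc _ ≤ 1 / (1 / ((k : ℝ) + 1)) * 1 := mul_le_mul h1 h2 (abs_nonneg _) (by positivity)
        _ = _ := mul_one _
    have hz := hh₀.latent hAS hb hY hproxy hcompl hψ hψb
    have hψm := (hψ.comp (mA.prodMk mUX)).aestronglyMeasurable (μ := P)
    have j1 := (hY.integrable one_le_two).mul_bdd (c := 1 / (1 / ((k : ℝ) + 1))) hψm
      (ae_of_all _ fun ω => hψb _)
    have j2 := hiW.mul_bdd (c := 1 / (1 / ((k : ℝ) + 1))) hψm (ae_of_all _ fun ω => hψb _)
    simp only [sub_mul] at hz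
    have hz' := (integral_sub j1 j2).symm.trans hz
    have e3 := sub_eq_zero.1 hz'
    refine Eq.trans ?_ e3
    refine integral_congr_ae ?_
    filter_upwards [hYe] with ω h
    have h' : Y' (v.A ω) (G ω) = v.Y ω := h
    rw [h']; rfl
  -- Countably many cutoff levels leave one common null set of s, on whose complement the cutoff may
  -- tend to zero.
  filter_upwards [ae_all_iff.2 step] with s hs hsS
  have t1 := tendsto_integral_densityCutoff hp.measurable mUX hS.measurableSet hsS (hppos s hsS)
    (hYpot s hsS)
  have mh : Measurable fun ω => h₀ s (v.W ω) (v.X ω) :=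
    hh₀.measurable.comp (measurable_const.prodMk (mW.prodMk mX))
  obtain ⟨c, hc⟩ := hb
  have t2 := tendsto_integral_densityCutoff hp.measurable mUX hS.measurableSet hsS (hppos s hsS)
    (f := fun ω => h₀ s (v.W ω) (v.X ω))
    (Integrable.of_bound mh.aestronglyMeasurable c (ae_of_all _ fun ω => hc s hsS _ _))
  exact tendsto_nhds_unique (t1.congr hs) t2

omit [StandardBorelSpace Ω] [StandardBorelSpace 𝒵] [StandardBorelSpace 𝒲] in
lemma Variables.IsOutcomeBridge.continuousOn_integral (hh₀ : v.IsOutcomeBridge P h₀)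
    (hb : UniformlyBounded S h₀) (hsm : SmoothBounded S h₀) :
    ContinuousOn (fun s => ∫ ω, h₀ s (v.W ω) (v.X ω) ∂P) S := by
  obtain ⟨c, hc⟩ := hb
  refine continuousOn_of_dominated (bound := fun _ => c) (fun s _ => ?_)
    (fun s hs => ae_of_all _ fun ω => hc s hs _ _) (integrable_const _)
    (ae_of_all _ fun ω => (hsm.1 _ _).continuousOn)
  exact (hh₀.measurable.comp (measurable_const.prodMk
    (v.measurable_W.prodMk v.measurable_X))).aestronglyMeasurable

/-- The outcome bridge function identifies the causal effect: `β(a) = E[h(a, W, X)]`. -/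
theorem Variables.IsOutcomeBridge.beta_eq
    (hS : IsOpen S) (hAS : ∀ᵐ ω ∂P, v.A ω ∈ S)
    (hcons : v.Consistency P) (hpos : v.Positivity P S) (hign : v.LatentIgnorability P)
    (hproxy : v.ProxyIndependence P) (hcompl : v.Completeness P)
    (hY : MemLp v.Y 2 P) (hYpot : ∀ a ∈ S, Integrable (v.Ypot a) P)
    (hbeta : ContinuousOn (v.beta P) S)
    (hh₀ : v.IsOutcomeBridge P h₀) (hb : UniformlyBounded S h₀) (hsm : SmoothBounded S h₀)
    {a : ℝ} (ha : a ∈ S) : v.beta P a = ∫ ω, h₀ a (v.W ω) (v.X ω) ∂P := by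
  have hae : ∀ᵐ s, s ∈ S → v.beta P s = ∫ ω, h₀ s (v.W ω) (v.X ω) ∂P := by
    obtain ⟨𝒢, hm, hci⟩ := hign
    -- The random element is the identity of Ω, seen as a map into Ω with the smaller σ-algebra;
    -- instances are explicit because Ω carries two σ-algebras here.
    exact @ae_eq_integral_of_factor Ω 𝒰 𝒳 𝒵 𝒲 mΩ _ _ _ _ _ _ _ P _ v S h₀ Ω 𝒢.1 id
      (measurable_id'' 𝒢.2) v.Ypot hm (fun _ _ => rfl)
      (by rw [MeasurableSpace.comap_id]; exact hci) hS hAS hcons ⟨hpos.choose, hpos.choose_spec⟩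
      hproxy hcompl hY hYpot hh₀ hb
  -- Two functions continuous on an open set that agree almost everywhere there agree everywhere
  -- there.
  exact Measure.eqOn_open_of_ae_eq (μ := volume) ((ae_restrict_iff' hS.measurableSet).2 hae) hS hbeta
    (hh₀.continuousOn_integral hb hsm) ha

end Identification

/-! ### The treatment bridge as a reweighting identity -/

section TreatmentBridge

variable {Ω 𝒰 𝒳 𝒵 𝒲 : Type*}
    [mΩ : MeasurableSpace Ω] [StandardBorelSpace Ω] [MeasurableSpace 𝒰]
    [MeasurableSpace 𝒳] [MeasurableSpace 𝒵] [MeasurableSpace 𝒲]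
    {P : Measure Ω} [IsProbabilityMeasure P] {v : Variables Ω 𝒰 𝒳 𝒵 𝒲} {S : Set ℝ}
    {q₀ : ℝ → 𝒵 → 𝒳 → ℝ} {μZ : Measure 𝒵} [SigmaFinite μZ]

/-- Positivity of `p(a | u, x)` implies positivity of `p(a | w, x)`. -/
lemma Variables.Positivity.proxy (hpos : v.Positivity P S) (hS : MeasurableSet S)
    (hproxy : v.ProxyIndependence P) {pA : ℝ → 𝒲 × 𝒳 → ℝ}
    (hpA : IsCondDensity P volume v.A (fun ω => (v.W ω, v.X ω)) pA) :
    ∀ᵐ x ∂(volume : Measure ℝ).prod (P.map fun ω => (v.W ω, v.X ω)), x.1 ∈ S → 0 < pA x.1 x.2 := by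
  obtain ⟨p, hp, hppos⟩ := hpos
  have mA := v.measurable_A
  have mW := v.measurable_W
  have mX := v.measurable_X
  have mUX : Measurable fun ω => (v.U ω, v.X ω) := v.measurable_U.prodMk mX
  have mWX : Measurable fun ω => (v.W ω, v.X ω) := mW.prodMk mX
  have hpW := hp.of_condIndep mA mUX mW hproxy.proxy_treatment
  have hs : MeasurableSet {x : ℝ × 𝒲 × 𝒳 | 0 < pA x.1 x.2} :=
    measurableSet_lt measurable_const hpA.measurable
  -- A random element lies almost surely where its own density is positive. Reading this event in
  -- the law of (A,W,U,X), whose density p(a|u,x) is positive on the treatment space, forces it to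
  -- hold for almost every level a.
  have h1 : ∀ᵐ ω ∂P, (v.A ω, v.W ω, v.X ω) ∈ {x : ℝ × 𝒲 × 𝒳 | 0 < pA x.1 x.2} :=
    (ae_comp_iff_of_map_eq_withDensity (mA.prodMk mWX) hpA.measurable hpA.map_eq hs).2
      (ae_of_all _ fun x h => h)
  have hφ : Measurable fun x : ℝ × 𝒲 × 𝒰 × 𝒳 => (x.1, x.2.1, x.2.2.2) := by fun_prop
  have h2 := (ae_comp_iff_of_map_eq_withDensity (mA.prodMk (mW.prodMk mUX)) hpW.measurable
    hpW.map_eq (hφ hs)).1 h1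
  have h3 := Measure.ae_ae_of_ae_prod h2
  refine (Measure.ae_prod_iff_ae_ae ?_).2 ?_
  · exact MeasurableSet.imp (measurable_fst hS) hs
  · filter_upwards [h3] with s h4
    refine (ae_map_iff mWX.aemeasurable (MeasurableSet.imp (MeasurableSet.const _)
      (measurableSet_lt measurable_const
        (hpA.measurable.comp (measurable_const.prodMk measurable_id))))).2 ?_
    have h5 := ae_of_ae_map (mW.prodMk mUX).aemeasurable h4
    by_cases hsS : s ∈ S
    · filter_upwards [h5, hppos s hsS] with ω h6 h7 _
      exact h6 h7
    · exact ae_of_all _ fun ω h => (hsS h).elim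

omit [StandardBorelSpace Ω] [IsProbabilityMeasure P] in
lemma measurePreserving_rotate {α β γ : Type*} [MeasurableSpace α] [MeasurableSpace β]
    [MeasurableSpace γ] {μ : Measure α} {ν : Measure β} {ρ : Measure γ} [SFinite μ] [SFinite ν]
    [SFinite ρ] :
    MeasurePreserving (fun x : (α × γ) × β => (x.1.1, x.2, x.1.2)) ((μ.prod ρ).prod ν)
      (μ.prod (ν.prod ρ)) := by
  have h1 := measurePreserving_prodAssoc μ ρ ν
  have h2 := (MeasurePreserving.id μ).prod (Measure.measurePreserving_swap (μ := ρ) (ν := ν))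
  exact h2.comp h1

/-- Bridge equation for `q` in terms of densities. -/
lemma Variables.IsTreatmentBridge.ae_integral_eq_one (hq₀ : v.IsTreatmentBridge P q₀)
    (hS : MeasurableSet S) (hAS : ∀ᵐ ω ∂P, v.A ω ∈ S) (hb : UniformlyBounded S q₀)
    (hpos : v.Positivity P S) (hproxy : v.ProxyIndependence P) {pZ : ℝ × 𝒵 → 𝒲 × 𝒳 → ℝ}
    (hpZ : IsCondDensity P (volume.prod μZ) (fun ω => (v.A ω, v.Z ω)) (fun ω => (v.W ω, v.X ω)) pZ) :
    ∀ᵐ x ∂(volume : Measure ℝ).prod (P.map fun ω => (v.W ω, v.X ω)), x.1 ∈ S →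
      ∫ z, pZ (x.1, z) x.2 * q₀ x.1 z x.2.2 ∂μZ = 1 := by
  obtain ⟨hqm, pA, hpA, hint, hce⟩ := hq₀
  have mA := v.measurable_A
  have mW := v.measurable_W
  have mX := v.measurable_X
  have mZ := v.measurable_Z
  have mWX : Measurable fun ω => (v.W ω, v.X ω) := mW.prodMk mX
  have mAWX : Measurable fun ω => (v.A ω, v.W ω, v.X ω) := mA.prodMk mWX
  set PC := P.map fun ω => (v.W ω, v.X ω) with hPC
  have : IsProbabilityMeasure PC := Measure.isProbabilityMeasure_map mWX.aemeasurable
  obtain ⟨c, hc⟩ := ae_bounded_of_uniformlyBounded hb hAS v.Z v.X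
  have hqI : Integrable (fun ω => q₀ (v.A ω) (v.Z ω) (v.X ω)) P :=
    Integrable.of_bound (hqm.comp (mA.prodMk (mZ.prodMk mX))).aestronglyMeasurable c hc
  -- Boundedness of q makes 1/p(A|W,X) integrable by itself, so the bridge equation can be split
  -- into two integrals.
  have hpI : Integrable (fun ω => 1 / pA (v.A ω) (v.W ω, v.X ω)) P := by
    refine (hqI.sub hint).congr (ae_of_all _ fun ω => ?_)
    simp
  have hind : ∀ E : Set (ℝ × 𝒲 × 𝒳), MeasurableSet E →
      Measurable (E.indicator fun _ => (1 : ℝ)) := fun E hE => measurable_const.indicator hE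
  have hindb : ∀ (E : Set (ℝ × 𝒲 × 𝒳)) x, ‖E.indicator (fun _ => (1 : ℝ)) x‖ ≤ 1 := fun E x => by
    by_cases h : x ∈ E <;> simp [h]
  have heq : ∀ E : Set (ℝ × 𝒲 × 𝒳), MeasurableSet E →
      ∫ ω, q₀ (v.A ω) (v.Z ω) (v.X ω) * E.indicator (fun _ => 1) (v.A ω, v.W ω, v.X ω) ∂P =
      ∫ ω, 1 / pA (v.A ω) (v.W ω, v.X ω) *
        E.indicator (fun _ => 1) (v.A ω, v.W ω, v.X ω) ∂P := by
    intro E hE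
    have hψ : StronglyMeasurable[MeasurableSpace.comap (fun ω => (v.A ω, v.W ω, v.X ω))
        inferInstance] fun ω => E.indicator (fun _ => (1 : ℝ)) (v.A ω, v.W ω, v.X ω) := by
      have : Measurable[MeasurableSpace.comap (fun ω => (v.A ω, v.W ω, v.X ω))
        inferInstance] fun ω => E.indicator (fun _ => (1 : ℝ)) (v.A ω, v.W ω, v.X ω) :=
        (hind E hE).comp (comap_measurable (fun ω => (v.A ω, v.W ω, v.X ω)))
      exact this.stronglyMeasurable
    have hmE := ((hind E hE).comp mAWX).aestronglyMeasurable (μ := P)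
    have h1 := integral_mul_eq_zero_of_condExp_eq_zero mAWX.comap_le hint hce hψ
      (hint.mul_bdd (c := 1) hmE (ae_of_all _ fun ω => hindb E _))
    simp only [sub_mul] at h1
    have h2 := (integral_sub (hqI.mul_bdd (c := 1) hmE (ae_of_all _ fun ω => hindb E _))
      (hpI.mul_bdd (c := 1) hmE (ae_of_all _ fun ω => hindb E _))).symm.trans h1
    exact sub_eq_zero.1 h2
  -- both sides as integrals with respect to `da ⊗ P_{(W, X)}`
  have hf₁m : Measurable fun x : ℝ × 𝒵 × 𝒲 × 𝒳 => pZ (x.1, x.2.1) x.2.2 := by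
    have : Measurable fun x : ℝ × 𝒵 × 𝒲 × 𝒳 => ((x.1, x.2.1), x.2.2) := by fun_prop
    exact hpZ.measurable.comp this
  have hZeq := hpZ.map_eq_prod mA mZ mWX
  have hgm : ∀ E : Set (ℝ × 𝒲 × 𝒳), MeasurableSet E →
      Measurable fun x : ℝ × 𝒵 × 𝒲 × 𝒳 => q₀ x.1 x.2.1 x.2.2.2 *
        E.indicator (fun _ => 1) (x.1, x.2.2) := fun E hE => by
    have h1 : Measurable fun x : ℝ × 𝒵 × 𝒲 × 𝒳 => (x.1, x.2.1, x.2.2.2) := by fun_prop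
    have h2 : Measurable fun x : ℝ × 𝒵 × 𝒲 × 𝒳 => (x.1, x.2.2) := by fun_prop
    exact (hqm.comp h1).mul ((hind E hE).comp h2)
  have hrot := measurePreserving_rotate (μ := (volume : Measure ℝ)) (ν := μZ) (ρ := PC)
  set f₁ : ℝ × 𝒲 × 𝒳 → ℝ := fun x => ∫ z, pZ (x.1, z) x.2 * q₀ x.1 z x.2.2 ∂μZ with hf₁
  -- Not simplified to 1: where the density vanishes this product is 0, and positivity is brought in
  -- only at the end.
  set f₂ : ℝ × 𝒲 × 𝒳 → ℝ := fun x => pA x.1 x.2 * (1 / pA x.1 x.2) with hf₂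
  have hL : ∀ E : Set (ℝ × 𝒲 × 𝒳), MeasurableSet E →
      Integrable (fun x => E.indicator (fun _ => (1 : ℝ)) x * f₁ x) (volume.prod PC) ∧
      ∫ ω, q₀ (v.A ω) (v.Z ω) (v.X ω) * E.indicator (fun _ => 1) (v.A ω, v.W ω, v.X ω) ∂P =
      ∫ x, E.indicator (fun _ => (1 : ℝ)) x * f₁ x ∂(volume.prod PC) := by
    intro E hE
    have hmE := ((hind E hE).comp mAWX).aestronglyMeasurable (μ := P)
    have h1 := (integrable_comp_iff_of_map_eq_withDensity (mA.prodMk (mZ.prodMk mWX)) hf₁m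
      (fun x => hpZ.nonneg _ _) hZeq (hgm E hE)).1
      (hqI.mul_bdd (c := 1) hmE (ae_of_all _ fun ω => hindb E _))
    have h2 := integral_comp_of_map_eq_withDensity (mA.prodMk (mZ.prodMk mWX)) hf₁m
      (fun x => hpZ.nonneg _ _) hZeq (hgm E hE)
    have h3 := hrot.integrable_comp_of_integrable h1
    have h4 : ∀ x : ℝ × 𝒲 × 𝒳, ∫ z, pZ (x.1, z) x.2 * (q₀ x.1 z x.2.2 *
        E.indicator (fun _ => 1) (x.1, x.2)) ∂μZ = E.indicator (fun _ => (1 : ℝ)) x * f₁ x := by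
      intro x
      rw [hf₁, ← integral_const_mul]
      congr 1; ext z; ring
    have h5 := h3.integral_prod_left
    simp only [Function.comp_def] at h5 h3
    refine ⟨by simpa only [h4] using h5, ?_⟩
    have h6 := (hrot.map_eq ▸ integral_map hrot.measurable.aemeasurable
      (hrot.map_eq.symm ▸ h1.1))
    refine h2.trans (h6.trans ?_)
    rw [integral_prod _ h3]
    simp only [h4]
  have hR : ∀ E : Set (ℝ × 𝒲 × 𝒳), MeasurableSet E →
      Integrable (fun x => E.indicator (fun _ => (1 : ℝ)) x * f₂ x) (volume.prod PC) ∧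
      ∫ ω, 1 / pA (v.A ω) (v.W ω, v.X ω) *
        E.indicator (fun _ => 1) (v.A ω, v.W ω, v.X ω) ∂P =
      ∫ x, E.indicator (fun _ => (1 : ℝ)) x * f₂ x ∂(volume.prod PC) := by
    intro E hE
    have hmE := ((hind E hE).comp mAWX).aestronglyMeasurable (μ := P)
    have hgm : Measurable fun x : ℝ × 𝒲 × 𝒳 => 1 / pA x.1 x.2 * E.indicator (fun _ => 1) x :=
      (measurable_const.div hpA.measurable).mul (hind E hE)
    have h1 := (integrable_comp_iff_of_map_eq_withDensity mAWX hpA.measurable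
      (fun x => hpA.nonneg _ _) hpA.map_eq hgm).1
      (hpI.mul_bdd (c := 1) hmE (ae_of_all _ fun ω => hindb E _))
    have h2 := integral_comp_of_map_eq_withDensity mAWX hpA.measurable
      (fun x => hpA.nonneg _ _) hpA.map_eq hgm
    have h4 : ∀ x : ℝ × 𝒲 × 𝒳, Function.uncurry pA x * (1 / pA x.1 x.2 *
        E.indicator (fun _ => 1) x) = E.indicator (fun _ => (1 : ℝ)) x * f₂ x := by
      intro x; rw [hf₂, Function.uncurry]; ring
    simp only [h4] at h1 h2
    exact ⟨h1, h2⟩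
  have hfe : f₁ =ᵐ[volume.prod PC] f₂ := by
    have i1 : Integrable f₁ (volume.prod PC) := by simpa using (hL _ MeasurableSet.univ).1
    have i2 : Integrable f₂ (volume.prod PC) := by simpa using (hR _ MeasurableSet.univ).1
    refine i1.ae_eq_of_forall_setIntegral_eq _ _ i2 fun E hE _ => ?_
    have h1 : ∀ f : ℝ × 𝒲 × 𝒳 → ℝ, ∫ x in E, f x ∂(volume.prod PC) =
        ∫ x, E.indicator (fun _ => (1 : ℝ)) x * f x ∂(volume.prod PC) := fun f => by
      rw [← integral_indicator hE]
      congr 1; ext x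
      by_cases h : x ∈ E <;> simp [h]
    rw [h1, h1, ← (hL E hE).2, ← (hR E hE).2, heq E hE]
  filter_upwards [hfe, hpos.proxy hS hproxy hpA] with x h1 h2 hx
  have h3 := (h2 hx).ne'
  change f₁ x = 1
  rw [h1]
  exact mul_one_div_cancel h3

/-- At a fixed treatment level `a`, the bridge function `q` reweights `p(a, z | w, x)` to one. -/
theorem Variables.IsTreatmentBridge.integral_eq_one (hq₀ : v.IsTreatmentBridge P q₀)
    (hS : IsOpen S) (hAS : ∀ᵐ ω ∂P, v.A ω ∈ S) (hb : UniformlyBounded S q₀)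
    (hqc : ∀ z x, ContinuousOn (fun a => q₀ a z x) S)
    (hpos : v.Positivity P S) (hproxy : v.ProxyIndependence P) {pZ : ℝ × 𝒵 → 𝒲 × 𝒳 → ℝ}
    (hpZ : IsCondDensity P (volume.prod μZ) (fun ω => (v.A ω, v.Z ω)) (fun ω => (v.W ω, v.X ω)) pZ)
    (hsm : SmoothDominated S 2 (μZ.prod (P.map fun ω => (v.W ω, v.X ω))) pZ)
    {a : ℝ} (ha : a ∈ S) :
    ∀ᵐ c ∂(P.map fun ω => (v.W ω, v.X ω)), ∫ z, pZ (a, z) c * q₀ a z c.2 ∂μZ = 1 := by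
  have mWX : Measurable fun ω => (v.W ω, v.X ω) := v.measurable_W.prodMk v.measurable_X
  have hae := hq₀.ae_integral_eq_one hS.measurableSet hAS hb hpos hproxy hpZ
  set PC := P.map fun ω => (v.W ω, v.X ω) with hPC
  have : IsProbabilityMeasure PC := Measure.isProbabilityMeasure_map mWX.aemeasurable
  have hmeas : ∀ s, Measurable fun x : (𝒲 × 𝒳) × 𝒵 => pZ (s, x.2) x.1 * q₀ s x.2 x.1.2 := by
    intro s
    have h1 : Measurable fun x : (𝒲 × 𝒳) × 𝒵 => ((s, x.2), x.1) := by fun_prop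
    have h2 : Measurable fun x : (𝒲 × 𝒳) × 𝒵 => (s, x.2, x.1.2) := by fun_prop
    exact (hpZ.measurable.comp h1).mul (hq₀.measurable.comp h2)
  have hf : Measurable fun x : ℝ × 𝒲 × 𝒳 => ∫ z, pZ (x.1, z) x.2 * q₀ x.1 z x.2.2 ∂μZ := by
    have h1 : Measurable fun x : (ℝ × 𝒲 × 𝒳) × 𝒵 => ((x.1.1, x.2), x.1.2) := by fun_prop
    have h2 : Measurable fun x : (ℝ × 𝒲 × 𝒳) × 𝒵 => (x.1.1, x.2, x.1.2.2) := by fun_prop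
    exact (StronglyMeasurable.integral_prod_right'
      ((hpZ.measurable.comp h1).mul (hq₀.measurable.comp h2)).stronglyMeasurable).measurable
  -- The null sets are exchanged: for almost every fixed c the identity holds for almost every
  -- level, and continuity in the level can act.
  have hae2 : ∀ᵐ c ∂PC, ∀ᵐ s, s ∈ S → ∫ z, pZ (s, z) c * q₀ s z c.2 ∂μZ = 1 := by
    refine (Measure.ae_ae_comm (p := fun (s : ℝ) (c : 𝒲 × 𝒳) =>
      s ∈ S → ∫ z, pZ (s, z) c * q₀ s z c.2 ∂μZ = 1) ?_).1 (Measure.ae_ae_of_ae_prod hae)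
    exact MeasurableSet.imp (measurable_fst hS.measurableSet) (hf (measurableSet_singleton 1))
  obtain ⟨δ, hδ, M, hM, hdom⟩ := hsm.2 a ha
  obtain ⟨cq, hcq⟩ := hb
  have hnhds : Metric.ball a δ ∩ S ∈ 𝓝 a :=
    inter_mem (Metric.ball_mem_nhds a hδ) (hS.mem_nhds ha)
  filter_upwards [hae2, hM.prod_left_ae] with c hc hMc
  have hcont : ContinuousAt (fun s => ∫ z, pZ (s, z) c * q₀ s z c.2 ∂μZ) a := by
    refine continuousAt_of_dominated (bound := fun z => M (z, c) * cq) ?_ ?_ (hMc.mul_const cq) ?_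
    · exact Eventually.of_forall fun s => ((hmeas s).comp
        (measurable_const.prodMk measurable_id)).aestronglyMeasurable
    · filter_upwards [hnhds] with s hs
      refine ae_of_all _ fun z => ?_
      have h1 := hdom s hs 0 (by norm_num) z c
      rw [norm_mul]
      exact mul_le_mul (by simpa using h1) (hcq s hs.2 _ _) (norm_nonneg _)
        ((abs_nonneg _).trans h1)
    · refine ae_of_all _ fun z => ?_
      exact ((hsm.1 z c).continuousOn.continuousAt (hS.mem_nhds ha)).mul
        ((hqc z c.2).continuousAt (hS.mem_nhds ha))
  -- If the value at a were not 1, it would differ from 1 on a whole neighbourhood of a, but the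
  -- levels with value 1 are dense.
  by_contra hne
  have hev := (hcont.eventually_ne hne).and (hS.mem_nhds ha)
  have hdense := Measure.dense_of_ae hc
  obtain ⟨s, hs1, hs2⟩ := mem_closure_iff_nhds.1 (hdense a) _ hev
  exact hs1.1 (hs2 hs1.2)

end TreatmentBridge

/-! ### From L² errors to errors against an absolutely continuous density -/

section AbsolutelyContinuous

variable {α : Type*} [MeasurableSpace α] {μ ρ : Measure α} [IsFiniteMeasure μ] [IsFiniteMeasure ρ]

omit [IsFiniteMeasure μ] in
lemma tendsto_integral_truncation {g : α → ℝ} (hgm : Measurable g) (hg : Integrable g μ) :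
    Tendsto (fun k : ℕ => ∫ x, {x | (k : ℝ) < g x}.indicator g x ∂μ) atTop (𝓝 0) := by
  have := tendsto_integral_of_dominated_convergence (μ := μ)
    (F := fun (k : ℕ) x => {x | (k : ℝ) < g x}.indicator g x) (f := fun _ => (0 : ℝ))
    (fun x => |g x|) (fun k => ?_) hg.abs (fun k => ae_of_all _ fun x => ?_)
    (ae_of_all _ fun x => ?_)
  · simpa using this
  · exact (hgm.indicator (measurableSet_lt measurable_const hgm)).aestronglyMeasurable
  · by_cases h : x ∈ {x | (k : ℝ) < g x}
    · rw [Set.indicator_of_mem h]; rfl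
    · rw [Set.indicator_of_notMem h]; simp
  · refine tendsto_const_nhds.congr' ?_
    obtain ⟨K, hK⟩ := exists_nat_ge (g x)
    filter_upwards [eventually_ge_atTop K] with k hk
    have : x ∉ {x | (k : ℝ) < g x} := by
      simp only [Set.mem_ofPred_eq, not_lt]
      exact hK.trans (by exact_mod_cast hk)
    simp only [Set.indicator_of_notMem this]

/-- If `ρ ≪ μ`, then the `L¹(ρ)` norm is small for bounded functions that are small in `L²(μ)`. -/
lemma exists_integral_abs_le_of_absolutelyContinuous (h : ρ ≪ μ) {C ε : ℝ}
    (hε : 0 < ε) : ∃ R, 0 ≤ R ∧ ∀ f : α → ℝ, Measurable f → (∀ x, |f x| ≤ C) →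
      ∫ x, |f x| ∂ρ ≤ ε + R * ∫ x, f x ^ 2 ∂μ := by
  set g : α → ℝ := fun x => (ρ.rnDeriv μ x).toReal with hg
  have hgm : Measurable g := (Measure.measurable_rnDeriv ρ μ).ennreal_toReal
  have hgi : Integrable g μ := Measure.integrable_toReal_rnDeriv
  have hg0 : ∀ x, 0 ≤ g x := fun x => ENNReal.toReal_nonneg
  -- In |f| ≤ η + f²/η the constant then integrates to at most ε/2 under ρ. The added 1 covers ρ =
  -- 0.
  set η : ℝ := ε / (2 * (ρ.real Set.univ + 1)) with hη
  have hη0 : 0 < η := by positivity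
  have htr := (tendsto_integral_truncation hgm hgi).const_mul (C ^ 2 / η)
  rw [mul_zero] at htr
  obtain ⟨k, hk⟩ := (htr.eventually (gt_mem_nhds (half_pos hε))).exists
  refine ⟨k / η, by positivity, fun f hf hfC => ?_⟩
  have hfi : ∀ (κ : Measure α) [IsFiniteMeasure κ], Integrable (fun x => f x ^ 2) κ := fun κ _ =>
    Integrable.of_bound (hf.pow_const 2).aestronglyMeasurable (C ^ 2) (ae_of_all _ fun x => by
      rw [Real.norm_eq_abs, abs_pow]; exact pow_le_pow_left₀ (abs_nonneg _) (hfC x) 2)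
  have hfa : Integrable (fun x => |f x|) ρ :=
    Integrable.of_bound hf.norm.aestronglyMeasurable C (ae_of_all _ fun x => by
      simpa using hfC x)
  have h1 : ∫ x, |f x| ∂ρ ≤ ∫ x, (η + f x ^ 2 / η) ∂ρ := by
    refine integral_mono hfa ((integrable_const _).add ((hfi ρ).div_const _)) fun x => ?_
    have h2 : |f x| * η ≤ η * η + f x ^ 2 := by
      rw [← sq_abs (f x)]; nlinarith [sq_nonneg (|f x| - η), abs_nonneg (f x), hη0]
    have h3 : |f x| ≤ (η * η + f x ^ 2) / η := by rwa [le_div_iff₀ hη0]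
    calc |f x| ≤ (η * η + f x ^ 2) / η := h3
      _ = η + f x ^ 2 / η := by field_simp
  rw [integral_add (integrable_const _) ((hfi ρ).div_const _), integral_const, integral_div,
    smul_eq_mul] at h1
  have h2 : ∫ x, f x ^ 2 ∂ρ = ∫ x, g x * f x ^ 2 ∂μ := by
    have := integral_rnDeriv_smul (μ := ρ) (ν := μ) h (f := fun x => f x ^ 2)
    simpa using this.symm
  have hti : Integrable ({x | (k : ℝ) < g x}.indicator g) μ :=
    hgi.indicator (measurableSet_lt measurable_const hgm)
  -- The density of ρ is cut at level k: below it the L²(μ) norm appears with factor k, above it f²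
  -- ≤ C² and the tail of the density is small.
  have h3 : ∫ x, g x * f x ^ 2 ∂μ ≤
      ∫ x, (k * f x ^ 2 + C ^ 2 * {x | (k : ℝ) < g x}.indicator g x) ∂μ := by
    have hb : ∀ x, f x ^ 2 ≤ C ^ 2 := fun x => by
      rw [← sq_abs (f x)]; exact pow_le_pow_left₀ (abs_nonneg _) (hfC x) 2
    refine integral_mono (hgi.mul_bdd (c := C ^ 2) (hf.pow_const 2).aestronglyMeasurable
      (ae_of_all _ fun x => by
        rw [Real.norm_eq_abs, abs_of_nonneg (sq_nonneg _)]; exact hb x))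
      (((hfi μ).const_mul _).add (hti.const_mul _)) fun x => ?_
    simp only
    by_cases hx : x ∈ {x | (k : ℝ) < g x}
    · rw [Set.indicator_of_mem hx]
      have := mul_le_mul_of_nonneg_left (hb x) (hg0 x)
      have h5 : 0 ≤ (k : ℝ) * f x ^ 2 := by positivity
      linarith
    · rw [Set.indicator_of_notMem hx, mul_zero, add_zero]
      exact mul_le_mul_of_nonneg_right (not_lt.1 hx) (sq_nonneg _)
  rw [integral_add ((hfi μ).const_mul _) (hti.const_mul _), integral_const_mul,
    integral_const_mul] at h3
  have h4 : ρ.real Set.univ * η ≤ ε / 2 := by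
    rw [hη, mul_div_assoc', div_le_iff₀ (by positivity)]
    nlinarith [measureReal_nonneg (μ := ρ) (s := Set.univ)]
  have h5 : (∫ x, f x ^ 2 ∂ρ) / η ≤ k / η * (∫ x, f x ^ 2 ∂μ) +
      C ^ 2 / η * ∫ x, {x | (k : ℝ) < g x}.indicator g x ∂μ := by
    rw [h2]
    calc _ ≤ (k * (∫ x, f x ^ 2 ∂μ) + C ^ 2 * ∫ x, {x | (k : ℝ) < g x}.indicator g x ∂μ) / η := by
          gcongr
      _ = _ := by ring
  linarith

variable {E : Type*} [MeasurableSpace E] {m : Measure E}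

/-- A nuisance error depends on some coordinates only, while the density it is integrated against
depends on all. The previous estimate is applied to the image of that density under the projection
`π`. -/
lemma exists_integral_abs_mul_le {π : E → α} {M : E → ℝ} (hπ : Measurable π) (hM : Integrable M m)
    (hM0 : ∀ e, 0 ≤ M e)
    (hac : (m.withDensity fun e => ENNReal.ofReal (M e)).map π ≪ μ) {C ε : ℝ}
    (hε : 0 < ε) : ∃ R, 0 ≤ R ∧ ∀ f : α → ℝ, Measurable f → (∀ x, |f x| ≤ C) →
      Integrable (fun e => |f (π e)| * M e) m ∧
      ∫ e, |f (π e)| * M e ∂m ≤ ε + R * ∫ x, f x ^ 2 ∂μ := by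
  have hfin : IsFiniteMeasure (m.withDensity fun e => ENNReal.ofReal (M e)) :=
    isFiniteMeasure_withDensity_ofReal hM.2
  have hfin2 := Measure.isFiniteMeasure_map (m.withDensity fun e => ENNReal.ofReal (M e)) π
  obtain ⟨R, hR, hle⟩ := exists_integral_abs_le_of_absolutelyContinuous hac (C := C) hε
  refine ⟨R, hR, fun f hf hfC => ⟨?_, ?_⟩⟩
  · have := hM.mul_bdd (c := C) (hf.comp hπ).norm.aestronglyMeasurable
      (ae_of_all _ fun e => by simpa using hfC (π e))
    refine this.congr (ae_of_all _ fun e => ?_)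
    simp [mul_comm]
  · refine le_trans (le_of_eq ?_) (hle f hf hfC)
    rw [integral_map (f := fun x => |f x|) hπ.aemeasurable hf.norm.aestronglyMeasurable,
      integral_withDensity_eq_integral_toReal_smul₀ hM.1.aemeasurable.ennreal_ofReal (by simp)]
    congr 1; ext e
    rw [ENNReal.toReal_ofReal (hM0 e), smul_eq_mul, mul_comm]

omit [IsFiniteMeasure μ] in
lemma map_withDensity_absolutelyContinuous {π : E → α} (hπ : Measure.QuasiMeasurePreserving π m μ)
    (w : E → ENNReal) : (m.withDensity w).map π ≪ μ := by
  refine Measure.AbsolutelyContinuous.trans ?_ hπ.absolutelyContinuous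
  exact (withDensity_absolutelyContinuous m w).map hπ.measurable

end AbsolutelyContinuous

/-! ### Kernel-localised expectations under a bounded conditional density -/

section BoundedDensity

variable {Ω γ : Type*} [MeasurableSpace Ω] [MeasurableSpace γ] {P : Measure Ω}
  [IsProbabilityMeasure P] {A : Ω → ℝ} {C : Ω → γ} {p : ℝ → γ → ℝ} {c : ℝ}

/-- Up to the factor c, a bounded conditional density lets the treatment be replaced by a
Lebesgue-distributed variable independent of `C`. -/
lemma IsCondDensity.integrable_mul_of_le (hp : IsCondDensity P volume A C p)
    (hpc : ∀ s x, p s x ≤ c) (hA : Measurable A) (hC : Measurable C) {g : ℝ → ℝ}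
    (hgm : Measurable g) (hg0 : ∀ s, 0 ≤ g s) (hgi : Integrable g) {ψ : γ → ℝ} (hψm : Measurable ψ)
    (hψ0 : ∀ x, 0 ≤ ψ x) (hψi : Integrable (fun ω => ψ (C ω)) P) :
    Integrable (fun ω => g (A ω) * ψ (C ω)) P ∧
    ∫ ω, g (A ω) * ψ (C ω) ∂P ≤ c * (∫ s, g s) * ∫ ω, ψ (C ω) ∂P := by
  have hm : Measurable fun x : ℝ × γ => g x.1 * ψ x.2 :=
    (hgm.comp measurable_fst).mul (hψm.comp measurable_snd)
  have hψi' : Integrable ψ (P.map C) :=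
    (integrable_map_measure hψm.aestronglyMeasurable hC.aemeasurable).2 hψi
  have hprod : Integrable (fun x : ℝ × γ => g x.1 * ψ x.2) (volume.prod (P.map C)) :=
    hgi.mul_prod hψi'
  have hpi : Integrable (fun x : ℝ × γ => p x.1 x.2 * (g x.1 * ψ x.2)) (volume.prod (P.map C)) :=
    hprod.bdd_mul (c := c) hp.measurable.aestronglyMeasurable (ae_of_all _ fun x => by
      rw [Real.norm_eq_abs]
      exact (abs_of_nonneg (hp.nonneg x.1 x.2)).trans_le (hpc _ _))
  have h1 := integrable_comp_iff_of_map_eq_withDensity (hA.prodMk hC) hp.measurable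
    (fun x => hp.nonneg x.1 x.2) hp.map_eq hm
  have h2 := integral_comp_of_map_eq_withDensity (hA.prodMk hC) hp.measurable
    (fun x => hp.nonneg x.1 x.2) hp.map_eq hm
  refine ⟨h1.2 hpi, ?_⟩
  have h3 : ∫ ω, g (A ω) * ψ (C ω) ∂P =
    ∫ x : ℝ × γ, p x.1 x.2 * (g x.1 * ψ x.2) ∂(volume.prod (P.map C)) := h2
  rw [h3, mul_assoc, ← integral_map hC.aemeasurable hψm.aestronglyMeasurable,
    ← integral_prod_mul g ψ, ← integral_const_mul]
  exact integral_mono hpi (hprod.const_mul c) fun x =>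
    mul_le_mul_of_nonneg_right (hpc _ _) (mul_nonneg (hg0 _) (hψ0 _))

lemma integral_comp_rescale {g : ℝ → ℝ} {b : ℝ} (hb : 0 < b) (a : ℝ) :
    ∫ s, g ((s - a) / b) = b * ∫ u, g u := by
  have h1 := Measure.integral_comp_div (fun y => g y) b
  have h2 := integral_sub_right_eq_self (fun s => g (s / b)) a (μ := volume)
  rw [h2, h1, abs_of_pos hb, smul_eq_mul]

lemma integrable_comp_rescale {g : ℝ → ℝ} {b : ℝ} (hb : 0 < b) (a : ℝ) (hg : Integrable g) :
    Integrable fun s => g ((s - a) / b) :=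
  (hg.comp_div hb.ne').comp_sub_right a

/-- Kernel moments under a bounded conditional density. -/
lemma IsCondDensity.integral_rescale_mul_le (hp : IsCondDensity P volume A C p)
    (hpc : ∀ s x, p s x ≤ c) (hA : Measurable A) (hC : Measurable C) {b : ℝ} (hb : 0 < b) (a : ℝ)
    {g : ℝ → ℝ} (hgm : Measurable g) (hg0 : ∀ s, 0 ≤ g s) (hgi : Integrable g) {ψ : γ → ℝ}
    (hψm : Measurable ψ) (hψ0 : ∀ x, 0 ≤ ψ x) (hψi : Integrable (fun ω => ψ (C ω)) P) :
    Integrable (fun ω => 1 / b * g ((A ω - a) / b) * ψ (C ω)) P ∧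
    ∫ ω, 1 / b * g ((A ω - a) / b) * ψ (C ω) ∂P ≤ c * (∫ u, g u) * ∫ ω, ψ (C ω) ∂P := by
  have := hp.integrable_mul_of_le hpc hA hC (g := fun s => 1 / b * g ((s - a) / b))
    (by fun_prop) (fun s => mul_nonneg (by positivity) (hg0 _))
    ((integrable_comp_rescale hb a hgi).const_mul _) hψm hψ0 hψi
  rwa [integral_const_mul, integral_comp_rescale hb, ← mul_assoc (1 / b), one_div_mul_cancel hb.ne',
    one_mul] at this

variable {τ : Type*} [MeasurableSpace τ] {γ' : Type*} [MeasurableSpace γ']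

/-- Expansion of a kernel-localised expectation. -/
lemma IsSecondOrderKernel.exists_localized_expansion {K : ℝ → ℝ} (hK : IsSecondOrderKernel K)
    (hp : IsCondDensity P volume A C p) (hpc : ∀ s x, p s x ≤ c) (hA : Measurable A)
    (hC : Measurable C) {T : Ω → τ} {D : Ω → γ'} (hT : Measurable T) (hD : Measurable D)
    {ν : Measure τ} [SigmaFinite ν] {f : ℝ × τ → γ' → ℝ}
    (hf : IsCondDensity P (volume.prod ν) (fun ω => (A ω, T ω)) D f)
    {φ : ℝ → τ × γ' → ℝ} (hφ : Measurable (Function.uncurry φ)) {cφ : ℝ}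
    (hφc : ∀ᵐ ω ∂P, |φ (A ω) (T ω, D ω)| ≤ cφ)
    {F F₁ F₂ : ℝ → τ × γ' → ℝ} {N : τ × γ' → ℝ} {a δ : ℝ} (hδ : 0 < δ)
    (hFf : ∀ s e, F s e = f (s, e.1) e.2 * φ s e)
    (hF₁ : Measurable (F₁ a)) (hF₂ : Measurable (F₂ a)) (hN : Integrable N (ν.prod (P.map D)))
    (hd : ∀ e, ∀ s ∈ Metric.ball a δ, HasDerivAt (fun s => F s e) (F₁ s e) s)
    (hd₁ : ∀ e, ∀ s ∈ Metric.ball a δ, HasDerivAt (fun s => F₁ s e) (F₂ s e) s)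
    (hb₀ : ∀ e, |F a e| ≤ N e) (hb₁ : ∀ e, |F₁ a e| ≤ N e)
    (hb₂ : ∀ e, ∀ s ∈ Metric.ball a δ, |F₂ s e| ≤ N e) :
    ∃ r : ℝ → ℝ, Tendsto r (𝓝 0) (𝓝 0) ∧ ∀ b > 0, ∀ (B : ℝ) (G : τ × γ' → ℝ), Measurable G →
      (∀ e, |G e| ≤ B) →
      |(∫ ω, 1 / b * K ((A ω - a) / b) * φ (A ω) (T ω, D ω) * G (T ω, D ω) ∂P)
        - ∫ e, F a e * G e ∂(ν.prod (P.map D))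
        - b ^ 2 / 2 * kappaTwo K * ∫ e, F₂ a e * G e ∂(ν.prod (P.map D))|
        ≤ B * (b ^ 2 * r b) := by
  have hfm : Measurable fun x : ℝ × τ × γ' => f (x.1, x.2.1) x.2.2 := by
    have : Measurable fun x : ℝ × τ × γ' => ((x.1, x.2.1), x.2.2) := by fun_prop
    exact hf.measurable.comp this
  have hFm : Measurable (Function.uncurry F) := by
    have : Function.uncurry F = fun x : ℝ × τ × γ' => f (x.1, x.2.1) x.2.2 *
      Function.uncurry φ x := by ext x; exact hFf x.1 x.2
    rw [this]; exact hfm.mul hφ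
  obtain ⟨r, hr, hexp⟩ := hK.exists_smoothing_expansion (m := ν.prod (P.map D)) hδ hFm hF₁ hF₂ hN
    hd hd₁ hb₀ hb₁ hb₂
  -- For |A - a| < δ the smoothing expansion applies. For |A - a| ≥ δ nothing is known about the
  -- derivatives of `f`; there the bounded density `p` and the o(b²) kernel tail suffice, which
  -- gives the second summand.
  refine ⟨fun b => r b + cφ * c / δ ^ 2 * tailMoment K δ b, ?_, fun b hb B G hG hGB => ?_⟩
  · simpa using hr.add ((hK.tendsto_tailMoment hδ).const_mul (cφ * c / δ ^ 2))
  obtain ⟨hi, hle⟩ := hexp b B G hG hGB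
  have hB0 : 0 ≤ B := by
    obtain ⟨ω⟩ : Nonempty Ω := nonempty_of_isProbabilityMeasure P
    exact (abs_nonneg _).trans (hGB (T ω, D ω))
  have hcφ : 0 ≤ cφ := by
    obtain ⟨ω, hω⟩ := hφc.exists; exact (abs_nonneg _).trans hω
  have hKm := hK.continuous.measurable
  have hcut := measurable_cutoff δ b
  have hTD : Measurable fun ω => (T ω, D ω) := hT.prodMk hD
  have hgm : Measurable fun x : ℝ × τ × γ' => 1 / b * K x.1 * cutoff δ b x.1 *
      φ (a + b * x.1) x.2 * G x.2 := by
    have h1 : Measurable fun x : ℝ × τ × γ' => (a + b * x.1, x.2) := by fun_prop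
    exact ((((measurable_const.mul (hKm.comp measurable_fst)).mul
      (hcut.comp measurable_fst)).mul (hφ.comp h1)).mul (hG.comp measurable_snd))
  have hmap := hf.map_eq_prod hA hT hD
  have hA' : ∀ ω, a + b * ((A ω - a) / b) = A ω := fun ω => by field_simp; ring
  have hpt : ∀ x : ℝ × τ × γ', f (a + b * x.1, x.2.1) x.2.2 * (1 / b * K x.1 * cutoff δ b x.1 *
      φ (a + b * x.1) x.2 * G x.2) =
      1 / b * (K x.1 * (cutoff δ b x.1 * F (a + b * x.1) x.2) * G x.2) := fun x => by
    rw [hFf]; ring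
  have h1 := (integrable_rescaled_iff hb a hA hTD hfm (fun x => hf.nonneg _ _) hmap hgm).2
    (by simp only [hpt]; exact hi.const_mul _)
  have h2 := integral_rescaled hb a hA hTD hfm (fun x => hf.nonneg _ _) hmap hgm
  simp only [hpt, hA'] at h1 h2
  rw [integral_const_mul, ← mul_assoc, mul_one_div_cancel hb.ne', one_mul] at h2
  have hfar := hp.integral_rescale_mul_le hpc hA hC hb a
    (g := fun u => |K u| * (1 - cutoff δ b u)) (ψ := fun _ => 1)
    (hKm.norm.mul (measurable_one_sub_cutoff δ b))
    (fun u => mul_nonneg (abs_nonneg _) (one_sub_cutoff_nonneg δ b u))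
    (integrable_mul_one_sub_cutoff hK.integrable.abs δ b) measurable_const (fun _ => zero_le_one)
    (integrable_const _)
  simp only [mul_one, integral_const, smul_eq_mul, probReal_univ] at hfar
  have hfm2 : AEStronglyMeasurable (fun ω => 1 / b * K ((A ω - a) / b) *
      (1 - cutoff δ b ((A ω - a) / b)) * φ (A ω) (T ω, D ω) * G (T ω, D ω)) P := by
    have h3 : Measurable fun ω => (A ω - a) / b := by fun_prop
    exact ((((measurable_const.mul (hKm.comp h3)).mul
      ((measurable_one_sub_cutoff δ b).comp h3)).mul (hφ.comp (hA.prodMk hTD))).mul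
        (hG.comp hTD)).aestronglyMeasurable
  have hfb : ∀ᵐ ω ∂P, ‖1 / b * K ((A ω - a) / b) *
      (1 - cutoff δ b ((A ω - a) / b)) * φ (A ω) (T ω, D ω) * G (T ω, D ω)‖ ≤
      1 / b * (|K ((A ω - a) / b)| * (1 - cutoff δ b ((A ω - a) / b))) * (cφ * B) := by
    filter_upwards [hφc] with ω hω
    rw [norm_mul, norm_mul, norm_mul, norm_mul, Real.norm_eq_abs, Real.norm_eq_abs,
      Real.norm_eq_abs, Real.norm_eq_abs, Real.norm_eq_abs,
      abs_of_nonneg (one_sub_cutoff_nonneg δ b _), abs_of_pos (by positivity : 0 < 1 / b)]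
    have h0 := one_sub_cutoff_nonneg δ b ((A ω - a) / b)
    calc _ = 1 / b * (|K ((A ω - a) / b)| * (1 - cutoff δ b ((A ω - a) / b))) *
        (|φ (A ω) (T ω, D ω)| * |G (T ω, D ω)|) := by ring
      _ ≤ _ := by gcongr; exact hGB _
  have hfi : Integrable (fun ω => 1 / b * K ((A ω - a) / b) *
      (1 - cutoff δ b ((A ω - a) / b)) * φ (A ω) (T ω, D ω) * G (T ω, D ω)) P :=
    (hfar.1.mul_const (cφ * B)).mono' hfm2 hfb
  have hfle : |∫ ω, 1 / b * K ((A ω - a) / b) *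
      (1 - cutoff δ b ((A ω - a) / b)) * φ (A ω) (T ω, D ω) * G (T ω, D ω) ∂P| ≤
      c * (b ^ 2 / δ ^ 2 * tailMoment K δ b) * (cφ * B) := by
    rw [← Real.norm_eq_abs]
    refine (norm_integral_le_integral_norm _).trans
      ((integral_mono_ae hfi.norm (hfar.1.mul_const (cφ * B)) hfb).trans ?_)
    rw [integral_mul_const]
    refine mul_le_mul_of_nonneg_right (hfar.2.trans ?_) (by positivity)
    have hc0 : 0 ≤ c := by
      obtain ⟨ω⟩ : Nonempty Ω := nonempty_of_isProbabilityMeasure P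
      exact (hp.nonneg 0 (C ω)).trans (hpc 0 (C ω))
    exact mul_le_mul_of_nonneg_left (hK.integral_tail_le hδ b) hc0
  have hsplit : ∫ ω, 1 / b * K ((A ω - a) / b) * φ (A ω) (T ω, D ω) * G (T ω, D ω) ∂P =
      (∫ ω, 1 / b * K ((A ω - a) / b) * cutoff δ b ((A ω - a) / b) *
        φ (A ω) (T ω, D ω) * G (T ω, D ω) ∂P) +
      ∫ ω, 1 / b * K ((A ω - a) / b) *
      (1 - cutoff δ b ((A ω - a) / b)) * φ (A ω) (T ω, D ω) * G (T ω, D ω) ∂P := by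
    rw [← integral_add h1 hfi]
    congr 1; ext ω; ring
  rw [hsplit, h2]
  set I₁ := ∫ x : ℝ × τ × γ', K x.1 * (cutoff δ b x.1 * F (a + b * x.1) x.2) * G x.2
    ∂(volume.prod (ν.prod (P.map D)))
  set I₂ := ∫ ω, 1 / b * K ((A ω - a) / b) *
      (1 - cutoff δ b ((A ω - a) / b)) * φ (A ω) (T ω, D ω) * G (T ω, D ω) ∂P
  set J₀ := ∫ e, F a e * G e ∂(ν.prod (P.map D))
  set J₂ := ∫ e, F₂ a e * G e ∂(ν.prod (P.map D))
  have e1 : I₁ + I₂ - J₀ - b ^ 2 / 2 * kappaTwo K * J₂ =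
    (I₁ - J₀ - b ^ 2 / 2 * kappaTwo K * J₂) + I₂ := by ring
  rw [e1]
  refine (abs_add_le _ _).trans ((add_le_add hle hfle).trans (le_of_eq ?_))
  ring

end BoundedDensity

/-! ### Derivatives in the treatment level: measurability and local bounds -/

section Calculus

lemma hasDerivAt_of_contDiffOn_two {f : ℝ → ℝ} {S : Set ℝ} (hf : ContDiffOn ℝ 2 f S) (hS : IsOpen S)
    {s : ℝ} (hs : s ∈ S) :
    HasDerivAt f (deriv f s) s ∧ HasDerivAt (deriv f) (iteratedDeriv 2 f s) s := by
  have h1 : ContDiffAt ℝ 2 f s := hf.contDiffAt (hS.mem_nhds hs)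
  refine ⟨(h1.differentiableAt (by norm_num)).hasDerivAt, ?_⟩
  have h2 : ContDiffOn ℝ 1 (deriv f) S := ((contDiffOn_succ_iff_deriv_of_isOpen (n := 1) hS).1
    (by simpa [one_add_one_eq_two] using hf)).2.2
  have h3 := ((h2.contDiffAt (hS.mem_nhds hs)).differentiableAt (by norm_num)).hasDerivAt
  rw [show iteratedDeriv 2 f s = deriv (deriv f) s by rw [iteratedDeriv_succ, iteratedDeriv_one]]
  exact h3

variable {α : Type*} [MeasurableSpace α] {F : ℝ → α → ℝ}

/-- The derivative is the pointwise limit of difference quotients along the sequence s + 1/(n+1),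
each of which is measurable. -/
lemma measurable_of_hasDerivAt {S : Set ℝ} (hS : IsOpen S) (hF : ∀ s ∈ S, Measurable (F s)) {s : ℝ}
    (hs : s ∈ S) {F' : α → ℝ} (hd : ∀ x, HasDerivAt (fun s => F s x) (F' x) s) :
    Measurable F' := by
  have hu : Tendsto (fun n : ℕ => s + 1 / ((n : ℝ) + 1)) atTop (𝓝[≠] s) := by
    refine tendsto_nhdsWithin_iff.2 ⟨?_, Eventually.of_forall fun n => ?_⟩
    · simpa using tendsto_one_div_add_atTop_nhds_zero_nat.const_add s
    · have : (0 : ℝ) < 1 / ((n : ℝ) + 1) := by positivity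
      simp only [Set.mem_compl_iff, Set.mem_singleton_iff]
      linarith
  have hev : ∀ᶠ n : ℕ in atTop, s + 1 / ((n : ℝ) + 1) ∈ S :=
    (hu.mono_right nhdsWithin_le_nhds).eventually (hS.mem_nhds hs)
  obtain ⟨n₀, hn₀⟩ := eventually_atTop.1 hev
  -- The shift by `n₀` keeps every point of the sequence inside the open set, where measurability is
  -- known.
  refine measurable_of_tendsto_metrizable (f := fun (n : ℕ) x =>
    slope (fun s => F s x) s (s + 1 / (((n + n₀ : ℕ) : ℝ) + 1))) (fun n => ?_) ?_
  · simp only [slope, vsub_eq_sub, smul_eq_mul]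
    exact ((hF _ (hn₀ (n + n₀) (by omega))).sub (hF s hs)).const_mul _
  · refine tendsto_pi_nhds.2 fun x => ?_
    exact ((hasDerivAt_iff_tendsto_slope.1 (hd x)).comp hu).comp (tendsto_add_atTop_nat n₀)

lemma measurable_deriv_param {S : Set ℝ} (hS : IsOpen S) (hF : ∀ s ∈ S, Measurable (F s))
    (hc : ∀ x, ContDiffOn ℝ 2 (fun s => F s x) S) {s : ℝ} (hs : s ∈ S) :
    Measurable (fun x => deriv (fun s => F s x) s) :=
  measurable_of_hasDerivAt hS hF hs fun x => (hasDerivAt_of_contDiffOn_two (hc x) hS hs).1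

lemma measurable_iteratedDeriv_two_param {S : Set ℝ} (hS : IsOpen S)
    (hF : ∀ s ∈ S, Measurable (F s))
    (hc : ∀ x, ContDiffOn ℝ 2 (fun s => F s x) S) {s : ℝ} (hs : s ∈ S) :
    Measurable (fun x => iteratedDeriv 2 (fun s => F s x) s) :=
  measurable_of_hasDerivAt (F := fun s x => deriv (fun s => F s x) s) hS
    (fun _ hs => measurable_deriv_param hS hF hc hs) hs
    fun x => (hasDerivAt_of_contDiffOn_two (hc x) hS hs).2

lemma SmoothDominated.exists_ball {τ γ : Type*} [MeasurableSpace τ] [MeasurableSpace γ] {S : Set ℝ}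
    {ρ : Measure (τ × γ)} {p : ℝ × τ → γ → ℝ} (h : SmoothDominated S 2 ρ p) (hS : IsOpen S) {a : ℝ}
    (ha : a ∈ S) : ∃ δ > 0, Metric.ball a δ ⊆ S ∧ ∃ M : τ × γ → ℝ, Integrable M ρ ∧
      (∀ e, 0 ≤ M e) ∧ ∀ s ∈ Metric.ball a δ, ∀ e : τ × γ, |p (s, e.1) e.2| ≤ M e ∧
        |deriv (fun r => p (r, e.1) e.2) s| ≤ M e ∧
        |iteratedDeriv 2 (fun r => p (r, e.1) e.2) s| ≤ M e := by
  obtain ⟨δ, hδ, M, hM, hb⟩ := h.2 a ha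
  obtain ⟨δ', hδ', hsub⟩ := Metric.isOpen_iff.1 hS a ha
  have hb' : ∀ s ∈ Metric.ball a (min δ δ'), ∀ e : τ × γ, |p (s, e.1) e.2| ≤ M e ∧
        |deriv (fun r => p (r, e.1) e.2) s| ≤ M e ∧
        |iteratedDeriv 2 (fun r => p (r, e.1) e.2) s| ≤ M e := by
    intro s hs e
    have hs' : s ∈ Metric.ball a δ ∩ S := ⟨Metric.ball_subset_ball (min_le_left _ _) hs,
      hsub (Metric.ball_subset_ball (min_le_right _ _) hs)⟩
    refine ⟨?_, ?_, hb s hs' 2 le_rfl _ _⟩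
    · simpa using hb s hs' 0 (by norm_num) e.1 e.2
    · simpa using hb s hs' 1 (by norm_num) e.1 e.2
  refine ⟨min δ δ', lt_min hδ hδ', (Metric.ball_subset_ball (min_le_right _ _)).trans hsub, M, hM,
    fun e => ?_, hb'⟩
  exact (abs_nonneg _).trans (hb' a (Metric.mem_ball_self (lt_min hδ hδ')) e).1

lemma SmoothBounded.exists_ball {τ γ : Type*} {S : Set ℝ}
    {p : ℝ → τ → γ → ℝ} (h : SmoothBounded S p) (hS : IsOpen S) {a : ℝ}
    (ha : a ∈ S) : ∃ δ > 0, Metric.ball a δ ⊆ S ∧ ∃ C : ℝ, 0 ≤ C ∧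
      ∀ s ∈ Metric.ball a δ, ∀ t c, |p s t c| ≤ C ∧
        |deriv (fun r => p r t c) s| ≤ C ∧ |iteratedDeriv 2 (fun r => p r t c) s| ≤ C := by
  obtain ⟨δ, hδ, C, hb⟩ := h.2 a ha
  obtain ⟨δ', hδ', hsub⟩ := Metric.isOpen_iff.1 hS a ha
  refine ⟨min δ δ', lt_min hδ hδ', (Metric.ball_subset_ball (min_le_right _ _)).trans hsub, |C|,
    abs_nonneg _, fun s hs t c => ?_⟩
  have hs' : s ∈ Metric.ball a δ ∩ S := ⟨Metric.ball_subset_ball (min_le_left _ _) hs,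
    hsub (Metric.ball_subset_ball (min_le_right _ _) hs)⟩
  refine ⟨?_, ?_, (hb s hs' 2 le_rfl _ _).trans (le_abs_self C)⟩
  · exact le_trans (by simpa using hb s hs' 0 (by norm_num) t c) (le_abs_self C)
  · exact le_trans (by simpa using hb s hs' 1 (by norm_num) t c) (le_abs_self C)

end Calculus

/-! ### Expansions for the two bridge functions -/

section Setup

variable {Ω 𝒰 𝒳 𝒵 𝒲 : Type*}
    [MeasurableSpace Ω] [MeasurableSpace 𝒰] [MeasurableSpace 𝒳] [MeasurableSpace 𝒵]
    [MeasurableSpace 𝒲]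

/-- The law of `(W, X)`. -/
abbrev Variables.lawWX (v : Variables Ω 𝒰 𝒳 𝒵 𝒲) (P : Measure Ω) : Measure (𝒲 × 𝒳) :=
  P.map fun ω => (v.W ω, v.X ω)

/-- The law of `(Z, X)`. -/
abbrev Variables.lawZX (v : Variables Ω 𝒰 𝒳 𝒵 𝒲) (P : Measure Ω) : Measure (𝒵 × 𝒳) :=
  P.map fun ω => (v.Z ω, v.X ω)

/-- What the asymptotic expansions use about the model: the two bridge functions enter through
the moment equation for the outcome, `β(a) = E[h(a, W, X)]`, and `∫ q(a, z, x) p(a, z | w, x) dz = 1`. -/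
structure Variables.Regular (v : Variables Ω 𝒰 𝒳 𝒵 𝒲) (P : Measure Ω) (S : Set ℝ)
    (h₀ : ℝ → 𝒲 → 𝒳 → ℝ) (q₀ : ℝ → 𝒵 → 𝒳 → ℝ) (μZ : Measure 𝒵) (μW : Measure 𝒲) (μY : Measure ℝ)
    (pZ : ℝ × 𝒵 → 𝒲 × 𝒳 → ℝ) (pW : ℝ × 𝒲 → 𝒵 × 𝒳 → ℝ) (pYW : ℝ × ℝ × 𝒲 → 𝒵 × 𝒳 → ℝ) (a : ℝ) :
    Prop where
  isOpen : IsOpen S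
  ae_mem : ∀ᵐ ω ∂P, v.A ω ∈ S
  mem : a ∈ S
  memLp_Y : MemLp v.Y 2 P
  outcome : v.IsOutcomeBridge P h₀
  smooth : SmoothBounded S h₀
  bounded_h : UniformlyBounded S h₀
  measurable_q : Measurable fun t : ℝ × 𝒵 × 𝒳 => q₀ t.1 t.2.1 t.2.2
  bounded_q : UniformlyBounded S q₀
  densities : v.RegularDensities P S μZ μW μY pZ pW pYW
  beta_eq : v.beta P a = ∫ ω, h₀ a (v.W ω) (v.X ω) ∂P
  integral_q : ∀ᵐ c ∂(v.lawWX P), ∫ z, pZ (a, z) c * q₀ a z c.2 ∂μZ = 1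

variable {P : Measure Ω} [IsProbabilityMeasure P] {v : Variables Ω 𝒰 𝒳 𝒵 𝒲} {S : Set ℝ}
  {h₀ : ℝ → 𝒲 → 𝒳 → ℝ} {q₀ : ℝ → 𝒵 → 𝒳 → ℝ} {μZ : Measure 𝒵} [SigmaFinite μZ] {μW : Measure 𝒲}
  [SigmaFinite μW] {μY : Measure ℝ} [SigmaFinite μY] {pZ : ℝ × 𝒵 → 𝒲 × 𝒳 → ℝ}
  {pW : ℝ × 𝒲 → 𝒵 × 𝒳 → ℝ} {pYW : ℝ × ℝ × 𝒲 → 𝒵 × 𝒳 → ℝ} {a : ℝ} {K : ℝ → ℝ}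

lemma Variables.measurable_WX (v : Variables Ω 𝒰 𝒳 𝒵 𝒲) : Measurable fun ω => (v.W ω, v.X ω) :=
  v.measurable_W.prodMk v.measurable_X

lemma Variables.measurable_ZX (v : Variables Ω 𝒰 𝒳 𝒵 𝒲) : Measurable fun ω => (v.Z ω, v.X ω) :=
  v.measurable_Z.prodMk v.measurable_X

/-- `biasIntegrand` as a function of `(w, (z, x))`. -/
def biasDensity (h₀ : ℝ → 𝒲 → 𝒳 → ℝ) (pW : ℝ × 𝒲 → 𝒵 × 𝒳 → ℝ) (a : ℝ) (e : 𝒲 × 𝒵 × 𝒳) : ℝ :=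
  biasIntegrand h₀ pW a e.1 e.2.1 e.2.2

omit [SigmaFinite μZ] [SigmaFinite μW] [SigmaFinite μY] [IsProbabilityMeasure P] in
lemma Variables.Regular.measurable_h (hR : v.Regular P S h₀ q₀ μZ μW μY pZ pW pYW a) (s : ℝ) :
    Measurable fun x : 𝒲 × 𝒳 => h₀ s x.1 x.2 :=
  hR.outcome.measurable.comp (measurable_const.prodMk measurable_id)

omit [SigmaFinite μZ] [SigmaFinite μW] [SigmaFinite μY] [IsProbabilityMeasure P] in
lemma Variables.Regular.measurable_q' (hR : v.Regular P S h₀ q₀ μZ μW μY pZ pW pYW a) (s : ℝ) :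
    Measurable fun x : 𝒵 × 𝒳 => q₀ s x.1 x.2 :=
  hR.measurable_q.comp (measurable_const.prodMk measurable_id)

omit [SigmaFinite μZ] [SigmaFinite μY] in
/-- The kernel-weighted smoothing error of `h₀`. -/
lemma Variables.Regular.exists_outcome_expansion (hR : v.Regular P S h₀ q₀ μZ μW μY pZ pW pYW a)
    (hK : IsSecondOrderKernel K) :
    Measurable (biasDensity h₀ pW a) ∧
    Integrable (biasDensity h₀ pW a) (μW.prod (v.lawZX P)) ∧
    ∃ r : ℝ → ℝ, Tendsto r (𝓝 0) (𝓝 0) ∧ ∀ b > 0, ∀ (B : ℝ) (Q : 𝒵 × 𝒳 → ℝ), Measurable Q →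
      (∀ x, |Q x| ≤ B) →
      |(∫ ω, 1 / b * K ((v.A ω - a) / b) *
          (h₀ (v.A ω) (v.W ω) (v.X ω) - h₀ a (v.W ω) (v.X ω)) * Q (v.Z ω, v.X ω) ∂P)
        - b ^ 2 / 2 * kappaTwo K * ∫ e, biasDensity h₀ pW a e * Q e.2 ∂(μW.prod (v.lawZX P))|
        ≤ B * (b ^ 2 * r b) := by
  obtain ⟨c, hpA, C, hpC⟩ := hR.densities.bounded_A
  obtain ⟨δ₁, hδ₁, hsub₁, M, hM, hM0, hMb⟩ := hR.densities.smooth_W.exists_ball hR.isOpen hR.mem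
  obtain ⟨δ₂, hδ₂, hsub₂, D, hD0, hDb⟩ := hR.smooth.exists_ball hR.isOpen hR.mem
  obtain ⟨ch, hch⟩ := hR.bounded_h
  have hpm := hR.densities.density_W.measurable
  set δ := min δ₁ δ₂ with hδdef
  have hδ : 0 < δ := lt_min hδ₁ hδ₂
  have hb1 : ∀ s ∈ Metric.ball a δ, s ∈ Metric.ball a δ₁ := fun s hs =>
    Metric.ball_subset_ball (min_le_left _ _) hs
  have hb2 : ∀ s ∈ Metric.ball a δ, s ∈ Metric.ball a δ₂ := fun s hs =>
    Metric.ball_subset_ball (min_le_right _ _) hs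
  have haδ : a ∈ Metric.ball a δ := Metric.mem_ball_self hδ
  -- Because `φ` vanishes at s = a, the product p φ has no zeroth-order term and its second
  -- derivative at a is 2 ∂p ∂h + p ∂²h, the integrand of B.
  set φ : ℝ → 𝒲 × 𝒵 × 𝒳 → ℝ := fun s e => h₀ s e.1 e.2.2 - h₀ a e.1 e.2.2 with hφ
  set p : ℝ → 𝒲 × 𝒵 × 𝒳 → ℝ := fun s e => pW (s, e.1) e.2 with hp
  set h₁ : ℝ → 𝒲 × 𝒵 × 𝒳 → ℝ := fun s e => deriv (fun s => h₀ s e.1 e.2.2) s with hh₁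
  set h₂ : ℝ → 𝒲 × 𝒵 × 𝒳 → ℝ := fun s e => iteratedDeriv 2 (fun s => h₀ s e.1 e.2.2) s with hh₂
  set p₁ : ℝ → 𝒲 × 𝒵 × 𝒳 → ℝ := fun s e => deriv (fun s => p s e) s with hp₁
  set p₂ : ℝ → 𝒲 × 𝒵 × 𝒳 → ℝ := fun s e => iteratedDeriv 2 (fun s => p s e) s with hp₂
  set F₁ : ℝ → 𝒲 × 𝒵 × 𝒳 → ℝ := fun s e => p₁ s e * φ s e + p s e * h₁ s e with hF₁
  set F₂ : ℝ → 𝒲 × 𝒵 × 𝒳 → ℝ := fun s e => (p₂ s e * φ s e + p₁ s e * h₁ s e) +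
    (p₁ s e * h₁ s e + p s e * h₂ s e) with hF₂
  have hφm : Measurable (Function.uncurry φ) := by
    have e1 : Measurable fun x : ℝ × 𝒲 × 𝒵 × 𝒳 => (x.1, x.2.1, x.2.2.2) := by fun_prop
    have e2 : Measurable fun x : ℝ × 𝒲 × 𝒵 × 𝒳 => (a, x.2.1, x.2.2.2) := by fun_prop
    exact (hR.outcome.measurable.comp e1).sub (hR.outcome.measurable.comp e2)
  have hpms : ∀ s, Measurable (p s) := fun s => by
    have : Measurable fun e : 𝒲 × 𝒵 × 𝒳 => ((s, e.1), e.2) := by fun_prop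
    exact hpm.comp this
  have hhms : ∀ s, Measurable fun e : 𝒲 × 𝒵 × 𝒳 => h₀ s e.1 e.2.2 := fun s => by
    have : Measurable fun e : 𝒲 × 𝒵 × 𝒳 => (s, e.1, e.2.2) := by fun_prop
    exact hR.outcome.measurable.comp this
  have hφms : Measurable (φ a) := (hhms a).sub (hhms a)
  have hpc : ∀ e, ContDiffOn ℝ 2 (fun s => p s e) S := fun e => hR.densities.smooth_W.1 _ _
  have hhc : ∀ e : 𝒲 × 𝒵 × 𝒳, ContDiffOn ℝ 2 (fun s => h₀ s e.1 e.2.2) S := fun e =>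
    hR.smooth.1 _ _
  have mp₁ : Measurable (p₁ a) := measurable_deriv_param hR.isOpen (fun s _ => hpms s) hpc hR.mem
  have mp₂ : Measurable (p₂ a) :=
    measurable_iteratedDeriv_two_param hR.isOpen (fun s _ => hpms s) hpc hR.mem
  have mh₁ : Measurable (h₁ a) := measurable_deriv_param (F := fun s (e : 𝒲 × 𝒵 × 𝒳) =>
    h₀ s e.1 e.2.2) hR.isOpen (fun s _ => hhms s) hhc hR.mem
  have mh₂ : Measurable (h₂ a) :=
    measurable_iteratedDeriv_two_param (F := fun s (e : 𝒲 × 𝒵 × 𝒳) =>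
      h₀ s e.1 e.2.2) hR.isOpen (fun s _ => hhms s) hhc hR.mem
  have hφa : ∀ e, φ a e = 0 := fun e => sub_self _
  have hF₂a : F₂ a = biasDensity h₀ pW a := by
    ext e
    simp only [hF₂, hφa, biasDensity, biasIntegrand, hh₁, hh₂, hp₁, hp₂, hp]
    ring
  have mF₁ : Measurable (F₁ a) := (mp₁.mul hφms).add ((hpms a).mul mh₁)
  have mF₂ : Measurable (F₂ a) := ((mp₂.mul hφms).add (mp₁.mul mh₁)).add
    ((mp₁.mul mh₁).add ((hpms a).mul mh₂))
  have hφb : ∀ s ∈ Metric.ball a δ, ∀ e, |φ s e| ≤ 2 * D := fun s hs e => by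
    have e1 := (hDb s (hb2 s hs) e.1 e.2.2).1
    have e2 := (hDb a (hb2 a haδ) e.1 e.2.2).1
    exact (abs_sub _ _).trans (by linarith)
  have hmul : ∀ {x y X Y : ℝ}, |x| ≤ X → |y| ≤ Y → |x * y| ≤ X * Y := fun hx hy => by
    rw [abs_mul]; exact mul_le_mul hx hy (abs_nonneg _) ((abs_nonneg _).trans hx)
  -- With |φ| ≤ 2 D, the four products in the second derivative contribute 2 + 1 + 1 + 1 = 5 times D
  -- M.
  set N : 𝒲 × 𝒵 × 𝒳 → ℝ := fun e => 5 * D * M e with hN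
  have hNi : Integrable N (μW.prod (v.lawZX P)) := hM.const_mul _
  have hbF₁ : ∀ e, |F₁ a e| ≤ N e := fun e => by
    have e1 := hmul (hMb a (hb1 a haδ) e).2.1 (hφb a haδ e)
    have e2 := hmul (hMb a (hb1 a haδ) e).1 (hDb a (hb2 a haδ) e.1 e.2.2).2.1
    refine (abs_add_le _ _).trans ((add_le_add e1 e2).trans ?_)
    have := mul_nonneg hD0 (hM0 e)
    simp only [hN]; nlinarith
  have hbF₂ : ∀ e, ∀ s ∈ Metric.ball a δ, |F₂ s e| ≤ N e := fun e s hs => by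
    have e1 := hmul (hMb s (hb1 s hs) e).2.2 (hφb s hs e)
    have e2 := hmul (hMb s (hb1 s hs) e).2.1 (hDb s (hb2 s hs) e.1 e.2.2).2.1
    have e3 := hmul (hMb s (hb1 s hs) e).1 (hDb s (hb2 s hs) e.1 e.2.2).2.2
    refine (abs_add_le _ _).trans ((add_le_add ((abs_add_le _ _).trans (add_le_add e1 e2))
      ((abs_add_le _ _).trans (add_le_add e2 e3))).trans (le_of_eq ?_))
    simp only [hN]; ring
  have hd : ∀ e, ∀ s ∈ Metric.ball a δ, HasDerivAt (fun s => p s e * φ s e) (F₁ s e) s :=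
    fun e s hs => by
    have hsS := hsub₁ (hb1 s hs)
    exact (hasDerivAt_of_contDiffOn_two (hpc e) hR.isOpen hsS).1.mul
      ((hasDerivAt_of_contDiffOn_two (hhc e) hR.isOpen hsS).1.sub_const _)
  have hd₁ : ∀ e, ∀ s ∈ Metric.ball a δ, HasDerivAt (fun s => F₁ s e) (F₂ s e) s :=
    fun e s hs => by
    have hsS := hsub₁ (hb1 s hs)
    have d1 := hasDerivAt_of_contDiffOn_two (hpc e) hR.isOpen hsS
    have d2 := hasDerivAt_of_contDiffOn_two (hhc e) hR.isOpen hsS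
    exact (d1.2.mul (d2.1.sub_const _)).add (d1.1.mul d2.2)
  have hφc : ∀ᵐ ω ∂P, |φ (v.A ω) (v.W ω, v.Z ω, v.X ω)| ≤ 2 * ch := by
    filter_upwards [hR.ae_mem] with ω hω
    have e1 := hch _ hω (v.W ω) (v.X ω)
    have e2 := hch _ hR.mem (v.W ω) (v.X ω)
    exact (abs_sub _ _).trans (by linarith)
  have hFa0 : ∀ e, p a e * φ a e = 0 := fun e => by rw [hφa, mul_zero]
  obtain ⟨r, hr, hle⟩ := hK.exists_localized_expansion hpA hpC v.measurable_A
    (v.measurable_Z.prodMk v.measurable_WX) v.measurable_W v.measurable_ZX hR.densities.density_W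
    hφm hφc (F := fun s e => p s e * φ s e) (F₁ := F₁) (F₂ := F₂) (N := N) (a := a) hδ
    (fun s e => rfl) mF₁ mF₂ hNi hd hd₁
    (fun e => by rw [hFa0, abs_zero]; exact mul_nonneg (by positivity) (hM0 e)) hbF₁ hbF₂
  refine ⟨hF₂a ▸ mF₂, ?_, r, hr, fun b hb B Q hQ hQB => ?_⟩
  · rw [← hF₂a]
    exact hNi.mono' mF₂.aestronglyMeasurable (ae_of_all _ fun e => hbF₂ e a haδ)
  · have := hle b hb B (fun e => Q e.2) (hQ.comp measurable_snd) (fun e => hQB _)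
    simp only [hFa0, zero_mul, integral_zero, sub_zero, hF₂a] at this
    exact this

/-- Second derivative in the treatment of `p(a, z | w, x)`, as a function of `(z, (w, x))`. -/
def densityCurvature (pZ : ℝ × 𝒵 → 𝒲 × 𝒳 → ℝ) (a : ℝ) (e : 𝒵 × 𝒲 × 𝒳) : ℝ :=
  iteratedDeriv 2 (fun s => pZ (s, e.1) e.2) a

-- Only the density p(a,z|w,x) is expanded in the level; q₀(a,·) is frozen at a and absorbed into
-- the bounded weight. The zeroth-order term is E[D] because q₀ integrates the density to one, so
-- the effect of an error D in the outcome bridge is of second order in the bandwidth.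
omit [SigmaFinite μW] [SigmaFinite μY] in
lemma Variables.Regular.exists_treatment_expansion (hR : v.Regular P S h₀ q₀ μZ μW μY pZ pW pYW a)
    (hK : IsSecondOrderKernel K) :
    Measurable (densityCurvature pZ a) ∧
    Integrable (densityCurvature pZ a) (μZ.prod (v.lawWX P)) ∧
    ∃ r : ℝ → ℝ, Tendsto r (𝓝 0) (𝓝 0) ∧ ∃ cq, 0 ≤ cq ∧ (∀ z x, |q₀ a z x| ≤ cq) ∧
      ∀ b > 0, ∀ (B : ℝ) (D : 𝒲 × 𝒳 → ℝ), Measurable D → (∀ x, |D x| ≤ B) →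
      |(∫ ω, 1 / b * K ((v.A ω - a) / b) * (D (v.W ω, v.X ω) * q₀ a (v.Z ω) (v.X ω)) ∂P)
        - ∫ ω, D (v.W ω, v.X ω) ∂P
        - b ^ 2 / 2 * kappaTwo K * ∫ e, densityCurvature pZ a e * (D e.2 * q₀ a e.1 e.2.2)
          ∂(μZ.prod (v.lawWX P))|
        ≤ B * cq * (b ^ 2 * r b) := by
  obtain ⟨c, hpA, C, hpC⟩ := hR.densities.bounded_A
  obtain ⟨δ, hδ, hsub, M, hM, hM0, hMb⟩ := hR.densities.smooth_Z.exists_ball hR.isOpen hR.mem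
  obtain ⟨cq, hcq⟩ := hR.bounded_q
  have haδ : a ∈ Metric.ball a δ := Metric.mem_ball_self hδ
  have hpm := hR.densities.density_Z.measurable
  set p : ℝ → 𝒵 × 𝒲 × 𝒳 → ℝ := fun s e => pZ (s, e.1) e.2 with hp
  have hpms : ∀ s, Measurable (p s) := fun s => by
    have : Measurable fun e : 𝒵 × 𝒲 × 𝒳 => ((s, e.1), e.2) := by fun_prop
    exact hpm.comp this
  have hpc : ∀ e, ContDiffOn ℝ 2 (fun s => p s e) S := fun e => hR.densities.smooth_Z.1 _ _
  have mp₁ : Measurable fun e => deriv (fun s => p s e) a :=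
    measurable_deriv_param hR.isOpen (fun s _ => hpms s) hpc hR.mem
  have mp₂ : Measurable fun e => iteratedDeriv 2 (fun s => p s e) a :=
    measurable_iteratedDeriv_two_param hR.isOpen (fun s _ => hpms s) hpc hR.mem
  obtain ⟨r, hr, hle⟩ := hK.exists_localized_expansion hpA hpC v.measurable_A
    (v.measurable_Z.prodMk v.measurable_WX) v.measurable_Z v.measurable_WX hR.densities.density_Z
    (φ := fun _ _ => 1) (cφ := 1) measurable_const (ae_of_all _ fun ω => by simp)
    (F := p) (F₁ := fun s e => deriv (fun s => p s e) s)
    (F₂ := fun s e => iteratedDeriv 2 (fun s => p s e) s) (N := M) (a := a) hδ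
    (fun s e => by simp [hp]) mp₁ mp₂ hM
    (fun e s hs => (hasDerivAt_of_contDiffOn_two (hpc e) hR.isOpen (hsub hs)).1)
    (fun e s hs => (hasDerivAt_of_contDiffOn_two (hpc e) hR.isOpen (hsub hs)).2)
    (fun e => (hMb a haδ e).1) (fun e => (hMb a haδ e).2.1) (fun e s hs => (hMb s hs e).2.2)
  have hcqa : ∀ z x, |q₀ a z x| ≤ |cq| := fun z x => (hcq a hR.mem z x).trans (le_abs_self _)
  have hmq : Measurable fun e : 𝒵 × 𝒲 × 𝒳 => q₀ a e.1 e.2.2 := by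
    have : Measurable fun e : 𝒵 × 𝒲 × 𝒳 => (e.1, e.2.2) := by fun_prop
    exact (hR.measurable_q' a).comp this
  refine ⟨mp₂, hM.mono' mp₂.aestronglyMeasurable (ae_of_all _ fun e => (hMb a haδ e).2.2),
    r, hr, |cq|, abs_nonneg _, hcqa, fun b hb B D hD hDB => ?_⟩
  have hGm : Measurable fun e : 𝒵 × 𝒲 × 𝒳 => D e.2 * q₀ a e.1 e.2.2 :=
    (hD.comp measurable_snd).mul hmq
  have hGb : ∀ e : 𝒵 × 𝒲 × 𝒳, |D e.2 * q₀ a e.1 e.2.2| ≤ B * |cq| := fun e => by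
    rw [abs_mul]
    exact mul_le_mul (hDB _) (hcqa _ _) (abs_nonneg _) ((abs_nonneg _).trans (hDB e.2))
  have h1 := hle b hb (B * |cq|) (fun e => D e.2 * q₀ a e.1 e.2.2) hGm hGb
  have hpi : Integrable (fun e => p a e * (D e.2 * q₀ a e.1 e.2.2)) (μZ.prod (v.lawWX P)) :=
    (hM.mono' (hpms a).aestronglyMeasurable (ae_of_all _ fun e => (hMb a haδ e).1)).mul_bdd
      (c := B * |cq|) hGm.aestronglyMeasurable (ae_of_all _ hGb)
  -- Integrating over z first, the weight D(w,x) comes out and the remaining integral is 1.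
  have h2 : ∫ e, p a e * (D e.2 * q₀ a e.1 e.2.2) ∂(μZ.prod (v.lawWX P)) =
      ∫ ω, D (v.W ω, v.X ω) ∂P := by
    rw [integral_prod_symm _ hpi, ← integral_map v.measurable_WX.aemeasurable
      hD.aestronglyMeasurable]
    refine integral_congr_ae ?_
    filter_upwards [hR.integral_q] with x hx
    have : ∀ z, p a (z, x) * (D x * q₀ a z x.2) = D x * (pZ (a, z) x * q₀ a z x.2) := fun z => by
      simp only [hp]; ring
    simp only [this]
    rw [integral_const_mul, hx, mul_one]
  rw [h2] at h1
  simp only [mul_one] at h1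
  exact h1

end Setup

lemma integral_mul_le_sqrt {α : Type*} [MeasurableSpace α] {μ : Measure α} {f g : α → ℝ}
    (hf : MemLp f 2 μ) (hg : MemLp g 2 μ) (hf0 : ∀ x, 0 ≤ f x) (hg0 : ∀ x, 0 ≤ g x) :
    ∫ x, f x * g x ∂μ ≤ √((∫ x, f x ^ 2 ∂μ) * ∫ x, g x ^ 2 ∂μ) := by
  have h := integral_mul_le_Lp_mul_Lq_of_nonneg (μ := μ) (p := 2) (q := 2)
    Real.HolderConjugate.two_two (ae_of_all _ hf0) (ae_of_all _ hg0)
    (by simpa using hf) (by simpa using hg)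
  rw [Real.sqrt_mul (integral_nonneg fun x => sq_nonneg _), Real.sqrt_eq_rpow, Real.sqrt_eq_rpow]
  simpa using h

/-! ### Conditional bias of one score -/

section Bias

variable {Ω 𝒰 𝒳 𝒵 𝒲 : Type*}
    [MeasurableSpace Ω] [MeasurableSpace 𝒰] [MeasurableSpace 𝒳] [MeasurableSpace 𝒵]
    [MeasurableSpace 𝒲]

/-- The contribution of one observation to `pkdr`, with nuisance functions `H`, `Q` at `a`. -/
def score (K : ℝ → ℝ) (b a : ℝ) (H : 𝒲 × 𝒳 → ℝ) (Q : 𝒵 × 𝒳 → ℝ) (o : Obs 𝒳 𝒵 𝒲) : ℝ :=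
  1 / b * K ((o.1 - a) / b) * (o.2.2.2.2 - H (o.2.2.1, o.2.2.2.1)) * Q (o.2.1, o.2.2.2.1)
    + H (o.2.2.1, o.2.2.2.1)

variable {P : Measure Ω} [IsProbabilityMeasure P] {v : Variables Ω 𝒰 𝒳 𝒵 𝒲} {S : Set ℝ}
  {h₀ : ℝ → 𝒲 → 𝒳 → ℝ} {q₀ : ℝ → 𝒵 → 𝒳 → ℝ} {μZ : Measure 𝒵} [SigmaFinite μZ] {μW : Measure 𝒲}
  [SigmaFinite μW] {μY : Measure ℝ} [SigmaFinite μY] {pZ : ℝ × 𝒵 → 𝒲 × 𝒳 → ℝ}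
  {pW : ℝ × 𝒲 → 𝒵 × 𝒳 → ℝ} {pYW : ℝ × ℝ × 𝒲 → 𝒵 × 𝒳 → ℝ} {a : ℝ} {K : ℝ → ℝ}

/-- Mean square distance of `H` to `h₀ a`. -/
def Variables.distH (v : Variables Ω 𝒰 𝒳 𝒵 𝒲) (P : Measure Ω) (h₀ : ℝ → 𝒲 → 𝒳 → ℝ) (a : ℝ)
    (H : 𝒲 × 𝒳 → ℝ) : ℝ := ∫ ω, (H (v.W ω, v.X ω) - h₀ a (v.W ω) (v.X ω)) ^ 2 ∂P

/-- Mean square distance of `Q` to `q₀ a`. -/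
def Variables.distQ (v : Variables Ω 𝒰 𝒳 𝒵 𝒲) (P : Measure Ω) (q₀ : ℝ → 𝒵 → 𝒳 → ℝ) (a : ℝ)
    (Q : 𝒵 × 𝒳 → ℝ) : ℝ := ∫ ω, (Q (v.Z ω, v.X ω) - q₀ a (v.Z ω) (v.X ω)) ^ 2 ∂P

omit [IsProbabilityMeasure P] in
lemma Variables.distH_nonneg (v : Variables Ω 𝒰 𝒳 𝒵 𝒲) (H : 𝒲 × 𝒳 → ℝ) : 0 ≤ v.distH P h₀ a H :=
  integral_nonneg fun _ => sq_nonneg _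

omit [IsProbabilityMeasure P] in
lemma Variables.distQ_nonneg (v : Variables Ω 𝒰 𝒳 𝒵 𝒲) (Q : 𝒵 × 𝒳 → ℝ) : 0 ≤ v.distQ P q₀ a Q :=
  integral_nonneg fun _ => sq_nonneg _

omit [SigmaFinite μZ] [SigmaFinite μW] [SigmaFinite μY] [IsProbabilityMeasure P] in
lemma Variables.Regular.distH_eq (hR : v.Regular P S h₀ q₀ μZ μW μY pZ pW pYW a)
    {H : 𝒲 × 𝒳 → ℝ} (hH : Measurable H) :
    v.distH P h₀ a H = ∫ x, (H x - h₀ a x.1 x.2) ^ 2 ∂(v.lawWX P) :=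
  (integral_map v.measurable_WX.aemeasurable
    ((hH.sub (hR.measurable_h a)).pow_const 2).aestronglyMeasurable).symm

omit [SigmaFinite μZ] [SigmaFinite μW] [SigmaFinite μY] [IsProbabilityMeasure P] in
lemma Variables.Regular.distQ_eq (hR : v.Regular P S h₀ q₀ μZ μW μY pZ pW pYW a)
    {Q : 𝒵 × 𝒳 → ℝ} (hQ : Measurable Q) :
    v.distQ P q₀ a Q = ∫ x, (Q x - q₀ a x.1 x.2) ^ 2 ∂(v.lawZX P) :=
  (integral_map v.measurable_ZX.aemeasurable
    ((hQ.sub (hR.measurable_q' a)).pow_const 2).aestronglyMeasurable).symm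

omit [SigmaFinite μZ] [SigmaFinite μY] in
lemma Variables.Regular.integrable_biasDensity_mul
    (hR : v.Regular P S h₀ q₀ μZ μW μY pZ pW pYW a) (hK : IsSecondOrderKernel K) :
    Integrable (fun e => biasDensity h₀ pW a e * q₀ a e.2.1 e.2.2) (μW.prod (v.lawZX P)) := by
  obtain ⟨cq, hcq⟩ := hR.bounded_q
  exact (hR.exists_outcome_expansion hK).2.1.mul_bdd (c := cq)
    ((hR.measurable_q' a).comp measurable_snd).aestronglyMeasurable
    (ae_of_all _ fun e => hcq a hR.mem _ _)

omit [SigmaFinite μZ] [SigmaFinite μY] in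
lemma Variables.Regular.biasConst_eq (hR : v.Regular P S h₀ q₀ μZ μW μY pZ pW pYW a)
    (hK : IsSecondOrderKernel K) :
    v.biasConst P μW h₀ q₀ pW a =
      ∫ e, biasDensity h₀ pW a e * q₀ a e.2.1 e.2.2 ∂(μW.prod (v.lawZX P)) := by
  have hi := hR.integrable_biasDensity_mul hK
  rw [integral_prod_symm _ hi]
  have h1 : ∀ x : 𝒵 × 𝒳, ∫ w, biasDensity h₀ pW a (w, x) * q₀ a x.1 x.2 ∂μW =
      q₀ a x.1 x.2 * ∫ w, biasIntegrand h₀ pW a w x.1 x.2 ∂μW := fun x => by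
    rw [integral_mul_const, mul_comm]; rfl
  have h2 := hi.integral_prod_right
  simp only [h1] at h2 ⊢
  rw [integral_map v.measurable_ZX.aemeasurable h2.1]
  rfl

omit [SigmaFinite μY] in
set_option maxHeartbeats 1600000 in
/-- Conditional bias of the estimator for given nuisance functions. -/
theorem Variables.Regular.exists_bias_bound (hR : v.Regular P S h₀ q₀ μZ μW μY pZ pW pYW a)
    (hK : IsSecondOrderKernel K) {B : ℝ} :
    ∃ C, 0 ≤ C ∧ ∀ ε > 0, ∃ R, 0 ≤ R ∧ ∀ᶠ b in 𝓝[>] (0 : ℝ), ∀ (H : 𝒲 × 𝒳 → ℝ) (Q : 𝒵 × 𝒳 → ℝ),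
      Measurable H → Measurable Q → (∀ x, |H x| ≤ B) → (∀ x, |Q x| ≤ B) →
      |(∫ ω, score K b a H Q (v.obs ω) ∂P) - v.beta P a
        - b ^ 2 / 2 * kappaTwo K * v.biasConst P μW h₀ q₀ pW a| ≤
      b ^ 2 * (ε + R * (v.distH P h₀ a H + v.distQ P q₀ a Q)) +
        C * √(v.distH P h₀ a H * v.distQ P q₀ a Q) := by
  obtain ⟨mD, iD, r₁, hr₁, hexp₁⟩ := hR.exists_outcome_expansion hK
  obtain ⟨mC, iC, r₃, hr₃, cq, hcq0, hcq, hexp₃⟩ := hR.exists_treatment_expansion hK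
  obtain ⟨c, hpA, cA, hpC⟩ := hR.densities.bounded_A
  obtain ⟨ch', hch'⟩ := hR.bounded_h
  set ch := |ch'| with hch
  have hchb : ∀ s ∈ S, ∀ w x, |h₀ s w x| ≤ ch := fun s hs w x =>
    (hch' s hs w x).trans (le_abs_self _)
  have mA := v.measurable_A
  have mY := v.measurable_Y
  have mWX := v.measurable_WX
  have mZX := v.measurable_ZX
  have mZWX : Measurable fun ω => (v.Z ω, v.W ω, v.X ω) := v.measurable_Z.prodMk mWX
  have hcA : 0 ≤ cA := by
    obtain ⟨ω⟩ : Nonempty Ω := nonempty_of_isProbabilityMeasure P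
    exact (hpA.nonneg 0 (v.Z ω, v.W ω, v.X ω)).trans (hpC 0 _)
  set κ : ℝ := |kappaTwo K| / 2 with hκ
  have hκ0 : 0 ≤ κ := by positivity
  -- This constant belongs to the product term: the sup of p(a|z,w,x) times the L¹ norm of the
  -- kernel.
  refine ⟨cA * ∫ u, |K u|, mul_nonneg hcA (integral_nonneg fun _ => abs_nonneg _), fun ε hε => ?_⟩
  -- The allowance ε is shared by the two smoothing remainders and by the two absolute continuity
  -- errors, which together cost κ (1 + cq) ε₁ ≤ ε/4. The added 1 covers κ = 0.
  set ε₁ : ℝ := ε / (4 * (κ * (1 + cq) + 1)) with hε₁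
  have hden : 0 < 4 * (κ * (1 + cq) + 1) := by positivity
  have hε₁0 : 0 < ε₁ := by positivity
  obtain ⟨R₁, hR₁, hle₁⟩ := exists_integral_abs_mul_le (μ := v.lawZX P) (π := Prod.snd)
    (m := μW.prod (v.lawZX P)) (M := fun e => |biasDensity h₀ pW a e|) measurable_snd iD.abs
    (fun e => abs_nonneg _)
    (map_withDensity_absolutelyContinuous Measure.quasiMeasurePreserving_snd _)
    (C := B + cq) hε₁0
  obtain ⟨R₃, hR₃, hle₃⟩ := exists_integral_abs_mul_le (μ := v.lawWX P) (π := Prod.snd)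
    (m := μZ.prod (v.lawWX P)) (M := fun e => |densityCurvature pZ a e|) measurable_snd iC.abs
    (fun e => abs_nonneg _)
    (map_withDensity_absolutelyContinuous Measure.quasiMeasurePreserving_snd _)
    (C := B + ch) hε₁0
  refine ⟨κ * R₁ + κ * cq * R₃, by positivity, ?_⟩
  have hlim₁ : ∀ᶠ b in 𝓝 (0 : ℝ), B * r₁ b < ε / 4 := by
    have := hr₁.const_mul B
    rw [mul_zero] at this
    exact this.eventually (gt_mem_nhds (by positivity))
  have hlim₃ : ∀ᶠ b in 𝓝 (0 : ℝ), (B + ch) * cq * r₃ b < ε / 4 := by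
    have := hr₃.const_mul ((B + ch) * cq)
    rw [mul_zero] at this
    exact this.eventually (gt_mem_nhds (by positivity))
  filter_upwards [self_mem_nhdsWithin, nhdsWithin_le_nhds hlim₁, nhdsWithin_le_nhds hlim₃]
    with b hb hl₁ hl₃ H Q hH hQ hHB hQB
  have hb0 : (0 : ℝ) < b := hb
  obtain ⟨cK, hcK⟩ := hK.bounded
  set k : Ω → ℝ := fun ω => 1 / b * K ((v.A ω - a) / b) with hk
  have hkm : Measurable k := by
    have h3 : Measurable fun ω => (v.A ω - a) / b := by fun_prop
    exact measurable_const.mul (hK.continuous.measurable.comp h3)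
  have hkb : ∀ ω, |k ω| ≤ 1 / b * cK := fun ω => by
    rw [hk, abs_mul, abs_of_pos (by positivity : 0 < 1 / b)]
    exact mul_le_mul_of_nonneg_left (hcK _) (by positivity)
  set D : 𝒲 × 𝒳 → ℝ := fun x => h₀ a x.1 x.2 - H x with hD
  have hDm : Measurable D := (hR.measurable_h a).sub hH
  have hDb : ∀ x, |D x| ≤ B + ch := fun x => by
    refine (abs_sub _ _).trans ?_
    have := hchb a hR.mem x.1 x.2
    have := hHB x
    linarith
  set Δ : 𝒵 × 𝒳 → ℝ := fun x => Q x - q₀ a x.1 x.2 with hΔ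
  have hΔm : Measurable Δ := hQ.sub (hR.measurable_q' a)
  have hΔb : ∀ x, |Δ x| ≤ B + cq := fun x => by
    refine (abs_sub _ _).trans ?_
    have := hcq x.1 x.2
    have := hQB x
    linarith
  -- integrability of the pieces
  have hYi : Integrable v.Y P := hR.memLp_Y.integrable one_le_two
  have hhi : Integrable (fun ω => h₀ (v.A ω) (v.W ω) (v.X ω)) P :=
    (hR.outcome.memLp hR.ae_mem ⟨ch, hchb⟩).integrable one_le_two
  have hhai : Integrable (fun ω => h₀ a (v.W ω) (v.X ω)) P :=
    Integrable.of_bound ((hR.measurable_h a).comp mWX).aestronglyMeasurable ch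
      (ae_of_all _ fun ω => hchb a hR.mem _ _)
  have hHi : Integrable (fun ω => H (v.W ω, v.X ω)) P :=
    Integrable.of_bound (hH.comp mWX).aestronglyMeasurable B (ae_of_all _ fun ω => hHB _)
  have hbdd : ∀ {f g : Ω → ℝ} {cg : ℝ}, Integrable f P → Measurable g → (∀ ω, |g ω| ≤ cg) →
      Integrable (fun ω => k ω * f ω * g ω) P := fun {f g cg} hf hg hgb =>
    (hf.bdd_mul (c := 1 / b * cK) hkm.aestronglyMeasurable (ae_of_all _ hkb)).mul_bdd
      (c := cg) hg.aestronglyMeasurable (ae_of_all _ hgb)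
  have i0 : Integrable (fun ω => k ω * (v.Y ω - h₀ (v.A ω) (v.W ω) (v.X ω)) *
      Q (v.Z ω, v.X ω)) P := hbdd (hYi.sub hhi) (hQ.comp mZX) (fun ω => hQB _)
  have i1 : Integrable (fun ω => k ω * (h₀ (v.A ω) (v.W ω) (v.X ω) - h₀ a (v.W ω) (v.X ω)) *
      Q (v.Z ω, v.X ω)) P := hbdd (hhi.sub hhai) (hQ.comp mZX) (fun ω => hQB _)
  have i2 : Integrable (fun ω => k ω * D (v.W ω, v.X ω) * Δ (v.Z ω, v.X ω)) P :=
    hbdd (hhai.sub hHi) (hΔm.comp mZX) (fun ω => hΔb _)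
  have i3 : Integrable (fun ω => k ω * (D (v.W ω, v.X ω) * q₀ a (v.Z ω) (v.X ω))) P := by
    have := hbdd (hhai.sub hHi) ((hR.measurable_q' a).comp mZX) (fun ω => hcq (v.Z ω) (v.X ω))
    refine this.congr (ae_of_all _ fun ω => ?_)
    simp only [hD, Function.comp, Pi.sub_apply]; ring
  -- the bridge equation removes the residual
  have z0 : ∫ ω, k ω * (v.Y ω - h₀ (v.A ω) (v.W ω) (v.X ω)) * Q (v.Z ω, v.X ω) ∂P = 0 := by
    have mAZX : Measurable fun ω => (v.A ω, v.Z ω, v.X ω) := mA.prodMk mZX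
    have hψ : StronglyMeasurable[MeasurableSpace.comap (fun ω => (v.A ω, v.Z ω, v.X ω))
        inferInstance] fun ω => k ω * Q (v.Z ω, v.X ω) := by
      have h1 : Measurable fun x : ℝ × 𝒵 × 𝒳 => 1 / b * K ((x.1 - a) / b) * Q x.2 := by
        have h3 : Measurable fun x : ℝ × 𝒵 × 𝒳 => (x.1 - a) / b := by fun_prop
        exact (measurable_const.mul (hK.continuous.measurable.comp h3)).mul
          (hQ.comp measurable_snd)
      exact (h1.comp (comap_measurable (fun ω => (v.A ω, v.Z ω, v.X ω)))).stronglyMeasurable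
    have h2 := integral_mul_eq_zero_of_condExp_eq_zero mAZX.comap_le (hYi.sub hhi)
      hR.outcome.bridge hψ (by
        refine i0.congr (ae_of_all _ fun ω => ?_)
        simp only [Pi.mul_apply, Pi.sub_apply]; ring)
    rw [← h2]
    congr 1; ext ω; simp only [Pi.sub_apply]; ring
  -- The doubly robust decomposition: smoothing error of h₀, product of the two nuisance errors, and
  -- the treatment bridge discrepancy of D. The nuisance errors enter to first order only through
  -- the product and through b² terms.
  have hsplit : (∫ ω, score K b a H Q (v.obs ω) ∂P) - v.beta P a =
      (∫ ω, k ω * (h₀ (v.A ω) (v.W ω) (v.X ω) - h₀ a (v.W ω) (v.X ω)) * Q (v.Z ω, v.X ω) ∂P) +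
      (∫ ω, k ω * D (v.W ω, v.X ω) * Δ (v.Z ω, v.X ω) ∂P) +
      ((∫ ω, k ω * (D (v.W ω, v.X ω) * q₀ a (v.Z ω) (v.X ω)) ∂P) -
        ∫ ω, D (v.W ω, v.X ω) ∂P) := by
    have hDi : ∫ ω, D (v.W ω, v.X ω) ∂P = v.beta P a - ∫ ω, H (v.W ω, v.X ω) ∂P := by
      rw [hR.beta_eq, ← integral_sub hhai hHi]
    have hpt : ∀ ω, score K b a H Q (v.obs ω) =
        (((k ω * (v.Y ω - h₀ (v.A ω) (v.W ω) (v.X ω)) * Q (v.Z ω, v.X ω) +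
        k ω * (h₀ (v.A ω) (v.W ω) (v.X ω) - h₀ a (v.W ω) (v.X ω)) * Q (v.Z ω, v.X ω)) +
        k ω * D (v.W ω, v.X ω) * Δ (v.Z ω, v.X ω)) +
        k ω * (D (v.W ω, v.X ω) * q₀ a (v.Z ω) (v.X ω))) + H (v.W ω, v.X ω) := fun ω => by
      simp only [score, Variables.obs, hk, hD, hΔ]; ring
    have j1 := i0.add i1
    have j2 := j1.add i2
    have j3 := j2.add i3
    have e1 := integral_add j3 hHi
    have e2 := integral_add j2 i3
    have e3 := integral_add j1 i2
    have e4 := integral_add i0 i1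
    simp only [Pi.add_apply] at e1 e2 e3 e4
    simp only [hpt]
    rw [e1, e2, e3, e4, z0, hDi]
    ring
  have t1 := hexp₁ b hb0 B Q hQ hQB
  have t3 := hexp₃ b hb0 (B + ch) D hDm hDb
  -- product term
  have t2 : |∫ ω, k ω * D (v.W ω, v.X ω) * Δ (v.Z ω, v.X ω) ∂P| ≤
      (cA * ∫ u, |K u|) * √(v.distH P h₀ a H * v.distQ P q₀ a Q) := by
    have hDL : MemLp (fun ω => |D (v.W ω, v.X ω)|) 2 P :=
      MemLp.of_bound (hDm.comp mWX).norm.aestronglyMeasurable (B + ch)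
        (ae_of_all _ fun ω => by simpa using hDb (v.W ω, v.X ω))
    have hΔL : MemLp (fun ω => |Δ (v.Z ω, v.X ω)|) 2 P :=
      MemLp.of_bound (hΔm.comp mZX).norm.aestronglyMeasurable (B + cq)
        (ae_of_all _ fun ω => by simpa using hΔb (v.Z ω, v.X ω))
    have hψm : Measurable fun x : 𝒵 × 𝒲 × 𝒳 => |D x.2| * |Δ (x.1, x.2.2)| := by
      have h1 : Measurable fun x : 𝒵 × 𝒲 × 𝒳 => (x.1, x.2.2) := by fun_prop
      exact (hDm.comp measurable_snd).norm.mul (hΔm.comp h1).norm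
    -- The bounded density given (Z,W,X) removes the kernel while keeping the factors D and Δ
    -- together; Cauchy–Schwarz follows.
    obtain ⟨hi, hle⟩ := hpA.integral_rescale_mul_le hpC mA mZWX hb0 a (g := fun u => |K u|)
      hK.continuous.measurable.norm (fun _ => abs_nonneg _) hK.integrable.abs hψm
      (fun x => mul_nonneg (abs_nonneg _) (abs_nonneg _)) (hDL.integrable_mul hΔL)
    have hcs := integral_mul_le_sqrt hDL hΔL (fun _ => abs_nonneg _) (fun _ => abs_nonneg _)
    have e1 : ∫ ω, |D (v.W ω, v.X ω)| ^ 2 ∂P = v.distH P h₀ a H := by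
      unfold Variables.distH
      congr 1; ext ω; rw [sq_abs]; simp only [hD]; ring
    have e2 : ∫ ω, |Δ (v.Z ω, v.X ω)| ^ 2 ∂P = v.distQ P q₀ a Q := by
      unfold Variables.distQ
      congr 1; ext ω; rw [sq_abs]
    rw [e1, e2] at hcs
    refine abs_integral_le_integral_abs.trans ((le_of_eq ?_).trans (hle.trans
      (mul_le_mul_of_nonneg_left hcs
        (mul_nonneg hcA (integral_nonneg fun _ => abs_nonneg _)))))
    congr 1; ext ω
    simp only [hk, abs_mul, abs_of_pos (by positivity : 0 < 1 / b)]; ring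
  -- replacing `Q` by `q₀` in the leading term
  have hBc := hR.biasConst_eq hK
  have iDQ : Integrable (fun e : 𝒲 × 𝒵 × 𝒳 => biasDensity h₀ pW a e * Q e.2)
      (μW.prod (v.lawZX P)) :=
    iD.mul_bdd (c := B) (hQ.comp measurable_snd).aestronglyMeasurable
      (ae_of_all _ fun e => hQB _)
  obtain ⟨-, l1⟩ := hle₁ Δ hΔm hΔb
  rw [← hR.distQ_eq hQ] at l1
  have u1 : |(∫ e, biasDensity h₀ pW a e * Q e.2 ∂(μW.prod (v.lawZX P))) -
      v.biasConst P μW h₀ q₀ pW a| ≤ ε₁ + R₁ * v.distQ P q₀ a Q := by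
    rw [hBc, ← integral_sub iDQ (hR.integrable_biasDensity_mul hK)]
    refine abs_integral_le_integral_abs.trans ((le_of_eq ?_).trans l1)
    congr 1; ext e
    rw [← mul_sub, abs_mul, mul_comm]
  obtain ⟨k3, l3⟩ := hle₃ D hDm hDb
  have e3 : ∫ x, D x ^ 2 ∂(v.lawWX P) = v.distH P h₀ a H := by
    rw [hR.distH_eq hH]; congr 1; ext x; simp only [hD]; ring
  rw [e3] at l3
  have u3 : |∫ e, densityCurvature pZ a e * (D e.2 * q₀ a e.1 e.2.2) ∂(μZ.prod (v.lawWX P))| ≤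
      cq * (ε₁ + R₃ * v.distH P h₀ a H) := by
    refine abs_integral_le_integral_abs.trans (le_trans ?_ (mul_le_mul_of_nonneg_left l3 hcq0))
    rw [← integral_const_mul]
    refine integral_mono_of_nonneg (ae_of_all _ fun e => abs_nonneg _) (k3.const_mul cq)
      (ae_of_all _ fun e => ?_)
    simp only [abs_mul]
    have := hcq e.1 e.2.2
    calc _ = |q₀ a e.1 e.2.2| * (|D e.2| * |densityCurvature pZ a e|) := by ring
      _ ≤ _ := by gcongr
  rw [hsplit]
  set I1 := ∫ ω, k ω * (h₀ (v.A ω) (v.W ω) (v.X ω) - h₀ a (v.W ω) (v.X ω)) * Q (v.Z ω, v.X ω) ∂P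
  set I2 := ∫ ω, k ω * D (v.W ω, v.X ω) * Δ (v.Z ω, v.X ω) ∂P
  set I3 := ∫ ω, k ω * (D (v.W ω, v.X ω) * q₀ a (v.Z ω) (v.X ω)) ∂P
  set I4 := ∫ ω, D (v.W ω, v.X ω) ∂P
  set J1 := ∫ e, biasDensity h₀ pW a e * Q e.2 ∂(μW.prod (v.lawZX P))
  set J3 := ∫ e, densityCurvature pZ a e * (D e.2 * q₀ a e.1 e.2.2) ∂(μZ.prod (v.lawWX P))
  set Bc := v.biasConst P μW h₀ q₀ pW a
  set eH := v.distH P h₀ a H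
  set eQ := v.distQ P q₀ a Q
  have habs : |b ^ 2 / 2 * kappaTwo K| = b ^ 2 * κ := by
    rw [abs_mul, abs_of_nonneg (by positivity : 0 ≤ b ^ 2 / 2), hκ]; ring
  have hdec : I1 + I2 + (I3 - I4) - b ^ 2 / 2 * kappaTwo K * Bc =
      (I1 - b ^ 2 / 2 * kappaTwo K * J1) + (b ^ 2 / 2 * kappaTwo K) * (J1 - Bc) + I2 +
      (I3 - I4 - b ^ 2 / 2 * kappaTwo K * J3) + (b ^ 2 / 2 * kappaTwo K) * J3 := by ring
  rw [hdec]
  have w1 : |(b ^ 2 / 2 * kappaTwo K) * (J1 - Bc)| ≤ b ^ 2 * κ * (ε₁ + R₁ * eQ) := by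
    rw [abs_mul, habs]; exact mul_le_mul_of_nonneg_left u1 (by positivity)
  have w3 : |(b ^ 2 / 2 * kappaTwo K) * J3| ≤ b ^ 2 * κ * (cq * (ε₁ + R₃ * eH)) := by
    rw [abs_mul, habs]; exact mul_le_mul_of_nonneg_left u3 (by positivity)
  have htri : ∀ x y z s t : ℝ, |x + y + z + s + t| ≤ |x| + |y| + |z| + |s| + |t| :=
    fun x y z s t => by
    refine (abs_add_le _ _).trans (add_le_add ?_ le_rfl)
    refine (abs_add_le _ _).trans (add_le_add ?_ le_rfl)
    exact abs_add_three _ _ _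
  refine (htri _ _ _ _ _).trans ?_
  have hεκ : κ * (1 + cq) * ε₁ ≤ ε / 4 := by
    rw [hε₁, mul_div_assoc', div_le_iff₀ hden]
    nlinarith [mul_nonneg hκ0 (add_nonneg zero_le_one hcq0)]
  have hb2 : 0 ≤ b ^ 2 := sq_nonneg b
  have heH : 0 ≤ eH := v.distH_nonneg H
  have heQ : 0 ≤ eQ := v.distQ_nonneg Q
  have f1 : b ^ 2 * (B * r₁ b) ≤ b ^ 2 * (ε / 4) := mul_le_mul_of_nonneg_left hl₁.le hb2
  have f3 : b ^ 2 * ((B + ch) * cq * r₃ b) ≤ b ^ 2 * (ε / 4) :=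
    mul_le_mul_of_nonneg_left hl₃.le hb2
  have f4 : b ^ 2 * (κ * (1 + cq) * ε₁) ≤ b ^ 2 * (ε / 4) := mul_le_mul_of_nonneg_left hεκ hb2
  have f5 : 0 ≤ b ^ 2 * (κ * R₁ * eH) := by positivity
  have f6 : 0 ≤ b ^ 2 * (κ * cq * R₃ * eQ) := by positivity
  have f7 : 0 ≤ b ^ 2 * (ε / 4) := by positivity
  have g1 := t1
  have g3 := t3
  nlinarith [g1, g3, t2, w1, w3, f1, f3, f4, f5, f6, f7]

end Bias

/-- The bounded density of A is conditional on (Z,W,X) and gives no control jointly with Y². The far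
part of the squared kernel therefore has to be small pointwise: after division by b it is at most D
b, and E[1 + Y²] is finite. -/
lemma IsSecondOrderKernel.exists_tail_bound {K : ℝ → ℝ} (hK : IsSecondOrderKernel K) {δ : ℝ}
    (hδ : 0 < δ) : ∃ D, 0 ≤ D ∧ ∀ b u, K u ^ 2 * (1 - cutoff δ b u) ≤ D * b ^ 2 := by
  obtain ⟨D, hD, hle⟩ := hK.exists_decay
  refine ⟨D / δ ^ 2, by positivity, fun b u => ?_⟩
  unfold cutoff
  split_ifs with h
  · simp only [sub_self, mul_zero]; positivity
  · rw [sub_zero, mul_one, div_mul_eq_mul_div, le_div_iff₀ (by positivity)]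
    have h1 : δ ^ 2 ≤ (b * u) ^ 2 := by
      rw [← sq_abs (b * u)]; exact pow_le_pow_left₀ hδ.le (not_lt.1 h) 2
    calc K u ^ 2 * δ ^ 2 ≤ K u ^ 2 * (b * u) ^ 2 := by gcongr
      _ = b ^ 2 * (u ^ 2 * K u ^ 2) := by ring
      _ ≤ b ^ 2 * D := by gcongr; exact hle u
      _ = D * b ^ 2 := mul_comm _ _

/-! ### Weak limit of the squared kernel -/

section Variance

variable {Ω 𝒰 𝒳 𝒵 𝒲 : Type*}
    [MeasurableSpace Ω] [MeasurableSpace 𝒰] [MeasurableSpace 𝒳] [MeasurableSpace 𝒵]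
    [MeasurableSpace 𝒲]

/-- The density `p(s, y, w | z, x)` as a function of `s` and `((y, w), (z, x))`. -/
def outcomeDensity (pYW : ℝ × ℝ × 𝒲 → 𝒵 × 𝒳 → ℝ) (s : ℝ) (e : (ℝ × 𝒲) × (𝒵 × 𝒳)) : ℝ :=
  pYW (s, e.1) e.2

variable {P : Measure Ω} [IsProbabilityMeasure P] {v : Variables Ω 𝒰 𝒳 𝒵 𝒲} {S : Set ℝ}
  {h₀ : ℝ → 𝒲 → 𝒳 → ℝ} {q₀ : ℝ → 𝒵 → 𝒳 → ℝ} {μZ : Measure 𝒵} {μW : Measure 𝒲}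
  [SigmaFinite μW] {μY : Measure ℝ} [SigmaFinite μY] {pZ : ℝ × 𝒵 → 𝒲 × 𝒳 → ℝ}
  {pW : ℝ × 𝒲 → 𝒵 × 𝒳 → ℝ} {pYW : ℝ × ℝ × 𝒲 → 𝒵 × 𝒳 → ℝ} {a : ℝ} {K : ℝ → ℝ}

omit [SigmaFinite μW] [SigmaFinite μY] [IsProbabilityMeasure P] in
lemma Variables.Regular.measurable_outcomeDensity
    (hR : v.Regular P S h₀ q₀ μZ μW μY pZ pW pYW a) :
    Measurable (Function.uncurry (outcomeDensity pYW)) := by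
  have h : Measurable fun x : ℝ × (ℝ × 𝒲) × (𝒵 × 𝒳) => ((x.1, x.2.1), x.2.2) := by fun_prop
  exact hR.densities.density_YW.measurable.comp h

omit [SigmaFinite μW] [SigmaFinite μY] [IsProbabilityMeasure P] in
lemma Variables.Regular.continuousAt_outcomeDensity
    (hR : v.Regular P S h₀ q₀ μZ μW μY pZ pW pYW a) (e : (ℝ × 𝒲) × (𝒵 × 𝒳)) :
    ContinuousAt (fun s => outcomeDensity pYW s e) a :=
  (hR.densities.continuous_YW e.1 e.2).continuousAt (hR.isOpen.mem_nhds hR.mem)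

/-- The law of `(W, X)` under the density `p(a, y, w | z, x)` of the observation at treatment level
`a` is absolutely continuous. -/
lemma Variables.Regular.map_outcomeDensity_absolutelyContinuous
    (hR : v.Regular P S h₀ q₀ μZ μW μY pZ pW pYW a) (w : (ℝ × 𝒲) × (𝒵 × 𝒳) → ℝ) :
    (((μY.prod μW).prod (v.lawZX P)).withDensity fun e =>
      ENNReal.ofReal (w e * outcomeDensity pYW a e)).map (fun e => (e.1.2, e.2.2)) ≪ v.lawWX P := by
  have hπ : Measurable fun e : (ℝ × 𝒲) × (𝒵 × 𝒳) => (e.1.2, e.2.2) := by fun_prop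
  refine Measure.AbsolutelyContinuous.mk fun N hN h0 => ?_
  have hm := hR.densities.density_YW.map_eq_prod v.measurable_A
    (v.measurable_Y.prodMk v.measurable_W) v.measurable_ZX
  have mT : Measurable fun ω => (v.A ω, ((v.Y ω, v.W ω), (v.Z ω, v.X ω))) :=
    v.measurable_A.prodMk ((v.measurable_Y.prodMk v.measurable_W).prodMk v.measurable_ZX)
  have hs : MeasurableSet {x : ℝ × (ℝ × 𝒲) × (𝒵 × 𝒳) | (x.2.1.2, x.2.2.2) ∉ N} :=
    (hπ.comp measurable_snd) hN.compl
  have h1 : ∀ᵐ x ∂(volume.prod ((μY.prod μW).prod (v.lawZX P))),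
      0 < outcomeDensity pYW x.1 x.2 → (x.2.1.2, x.2.2.2) ∉ N := by
    refine (ae_comp_iff_of_map_eq_withDensity mT hR.measurable_outcomeDensity hm hs).1 ?_
    have h2 : ∀ᵐ x ∂(v.lawWX P), x ∉ N := measure_eq_zero_iff_ae_notMem.1 h0
    exact ae_of_ae_map v.measurable_WX.aemeasurable h2
  -- The law of the data gives the vanishing of the density on N only for almost every level,
  -- possibly not for a. Good levels are dense, and continuity of the density carries the vanishing
  -- to a.
  obtain ⟨s, hs1, hs2⟩ := mem_closure_iff_seq_limit.1
    (Measure.dense_of_ae (Measure.ae_ae_of_ae_prod h1) a)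
  have h3 : ∀ᵐ e ∂((μY.prod μW).prod (v.lawZX P)), ∀ k, 0 < outcomeDensity pYW (s k) e →
      (e.1.2, e.2.2) ∉ N := ae_all_iff.2 hs1
  rw [Measure.map_apply hπ hN, withDensity_apply _ (hπ hN),
    setLIntegral_congr_fun_ae (g := fun _ => 0) (hπ hN), lintegral_zero]
  filter_upwards [h3] with e he heN
  have h4 : ∀ k, outcomeDensity pYW (s k) e = 0 := fun k =>
    le_antisymm (not_lt.1 fun h => he k h heN) (hR.densities.density_YW.nonneg _ _)
  have h5 := (hR.continuousAt_outcomeDensity e).tendsto.comp hs2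
  have h6 : outcomeDensity pYW a e = 0 :=
    tendsto_nhds_unique h5 (by simp only [Function.comp_def, h4]; exact tendsto_const_nhds)
  rw [h6, mul_zero, ENNReal.ofReal_zero]

/-- Weak limit of the squared kernel, uniformly over functions of at most quadratic growth in the
outcome. -/
lemma Variables.Regular.exists_square_expansion
    (hR : v.Regular P S h₀ q₀ μZ μW μY pZ pW pYW a) (hK : IsSecondOrderKernel K) :
    Integrable (fun e => (1 + e.1.1 ^ 2) * outcomeDensity pYW a e)
      ((μY.prod μW).prod (v.lawZX P)) ∧
    ∃ r : ℝ → ℝ, Tendsto r (𝓝 0) (𝓝 0) ∧ ∀ b > 0, ∀ (B : ℝ) (G : (ℝ × 𝒲) × (𝒵 × 𝒳) → ℝ),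
      Measurable G → (∀ e, |G e| ≤ B * (1 + e.1.1 ^ 2)) →
      |(∫ ω, 1 / b * K ((v.A ω - a) / b) ^ 2 * G ((v.Y ω, v.W ω), (v.Z ω, v.X ω)) ∂P)
        - omegaTwo K * ∫ e, outcomeDensity pYW a e * G e ∂((μY.prod μW).prod (v.lawZX P))|
        ≤ B * r b := by
  set m := (μY.prod μW).prod (v.lawZX P) with hm
  obtain ⟨δ₁, hδ₁, M, hM, hMb⟩ := hR.densities.dominated_YW a hR.mem
  obtain ⟨δ₂, hδ₂, hsub⟩ := Metric.isOpen_iff.1 hR.isOpen a hR.mem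
  set δ := min δ₁ δ₂ with hδdef
  have hδ : 0 < δ := lt_min hδ₁ hδ₂
  have hpm := hR.measurable_outcomeDensity
  have hp0 : ∀ s e, 0 ≤ outcomeDensity pYW s e := fun s e => hR.densities.density_YW.nonneg _ _
  have hpM : ∀ h, |h| < δ → ∀ e, outcomeDensity pYW (a + h) e ≤ M e := fun h hh e => by
    have h1 : a + h ∈ Metric.ball a δ := by
      rw [Metric.mem_ball, Real.dist_eq]; simpa using hh
    exact hMb _ ⟨Metric.ball_subset_ball (min_le_left _ _) h1,
      hsub (Metric.ball_subset_ball (min_le_right _ _) h1)⟩ _ _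
  have hw0 : ∀ e : (ℝ × 𝒲) × (𝒵 × 𝒳), 0 < 1 + e.1.1 ^ 2 := fun e => by positivity
  have hM0 : ∀ e, 0 ≤ M e := fun e =>
    (hp0 _ e).trans (hpM 0 (by simpa using hδ) e)
  -- The growth factor 1 + y² is moved into the density, where the dominating function has a second
  -- moment; the test function divided by it is bounded.
  set Φ : ℝ → (ℝ × 𝒲) × (𝒵 × 𝒳) → ℝ := fun h e => (1 + e.1.1 ^ 2) * outcomeDensity pYW (a + h) e
    with hΦ
  have hΦm : Measurable (Function.uncurry Φ) := by
    have h1 : Measurable fun x : ℝ × (ℝ × 𝒲) × (𝒵 × 𝒳) => (a + x.1, x.2) := by fun_prop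
    have h2 : Measurable fun x : ℝ × (ℝ × 𝒲) × (𝒵 × 𝒳) => 1 + x.2.1.1 ^ 2 := by fun_prop
    exact h2.mul (hpm.comp h1)
  have hΦN : ∀ h, |h| < δ → ∀ e, |Φ h e| ≤ (1 + e.1.1 ^ 2) * M e := fun h hh e => by
    rw [abs_of_nonneg (mul_nonneg (hw0 e).le (hp0 _ e))]
    exact mul_le_mul_of_nonneg_left (hpM h hh e) (hw0 e).le
  have hΦ0 : ∀ e, ContinuousAt (fun h => Φ h e) 0 := fun e => by
    have h1 : ContinuousAt (fun h => a + h) (0 : ℝ) := by fun_prop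
    have h2 : ContinuousAt (fun s => outcomeDensity pYW s e) (a + 0) := by
      rw [add_zero]; exact hR.continuousAt_outcomeDensity e
    exact continuousAt_const.mul (ContinuousAt.comp (f := fun h => a + h) h2 h1)
  have hN0 : ∀ e : (ℝ × 𝒲) × (𝒵 × 𝒳), 0 ≤ (1 + e.1.1 ^ 2) * M e := fun e =>
    mul_nonneg (hw0 e).le (hM0 e)
  have hlim := tendsto_integral_approx hδ hK.integrable_sq hΦm hM hN0 hΦN hΦ0
  obtain ⟨D, hD, hDle⟩ := hK.exists_tail_bound hδ
  have hY2 : Integrable (fun ω => 1 + v.Y ω ^ 2) P :=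
    (integrable_const 1).add hR.memLp_Y.integrable_sq
  have iΦa : Integrable (Φ 0) m := by
    refine hM.mono' (hΦm.comp (measurable_const.prodMk measurable_id)).aestronglyMeasurable
      (ae_of_all _ fun e => hΦN 0 (by simpa using hδ) e)
  refine ⟨by simpa only [hΦ, add_zero] using iΦa,
    fun b => (∫ x : ℝ × ((ℝ × 𝒲) × (𝒵 × 𝒳)), |K x.1 ^ 2 *
      (cutoff δ b x.1 * Φ (b * x.1) x.2 - Φ 0 x.2)| ∂(volume.prod m)) +
      D * b * ∫ ω, (1 + v.Y ω ^ 2) ∂P, ?_, fun b hb B G hG hGB => ?_⟩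
  · have h1 : Tendsto (fun b : ℝ => D * b * ∫ ω, (1 + v.Y ω ^ 2) ∂P) (𝓝 0) (𝓝 0) := by
      have h2 : Continuous fun b : ℝ => D * b * ∫ ω, (1 + v.Y ω ^ 2) ∂P := by fun_prop
      simpa using h2.tendsto 0
    simpa using hlim.add h1
  have mK := hK.continuous.measurable
  have mA := v.measurable_A
  have mT : Measurable fun ω => ((v.Y ω, v.W ω), (v.Z ω, v.X ω)) :=
    (v.measurable_Y.prodMk v.measurable_W).prodMk v.measurable_ZX
  have mu : Measurable fun ω => (v.A ω - a) / b := by fun_prop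
  have hmap := hR.densities.density_YW.map_eq_prod v.measurable_A
    (v.measurable_Y.prodMk v.measurable_W) v.measurable_ZX
  have mw : Measurable fun e : (ℝ × 𝒲) × (𝒵 × 𝒳) => 1 + e.1.1 ^ 2 := by fun_prop
  set G' : (ℝ × 𝒲) × (𝒵 × 𝒳) → ℝ := fun e => G e / (1 + e.1.1 ^ 2) with hG'
  have hG'm : Measurable G' := hG.div mw
  have hG'B : ∀ e, |G' e| ≤ B := fun e => by
    rw [hG', abs_div, abs_of_pos (hw0 e), div_le_iff₀ (hw0 e)]; exact hGB e
  have hGG : ∀ e, (1 + e.1.1 ^ 2) * G' e = G e := fun e => mul_div_cancel₀ _ (hw0 e).ne'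
  obtain ⟨-, hnear⟩ := abs_integral_approx_le hδ hK.integrable_sq hΦm hM hN0 hΦN b hG'm hG'B
  obtain ⟨cK, hcK⟩ := hK.bounded
  have hGi : Integrable (fun ω => G ((v.Y ω, v.W ω), (v.Z ω, v.X ω))) P :=
    (hY2.const_mul B).mono' (hG.comp mT).aestronglyMeasurable (ae_of_all _ fun ω => hGB _)
  have hsplit : ∀ g : ℝ → ℝ, Measurable g → (∀ u, 0 ≤ g u) → (∀ u, g u ≤ 1) →
      Integrable (fun ω => 1 / b * (K ((v.A ω - a) / b) ^ 2 * g ((v.A ω - a) / b)) *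
        G ((v.Y ω, v.W ω), (v.Z ω, v.X ω))) P := fun g hg hg0 hg1 => by
    refine hGi.bdd_mul (c := 1 / b * cK ^ 2) (measurable_const.mul
      (((mK.comp mu).pow_const 2).mul (hg.comp mu))).aestronglyMeasurable (ae_of_all _ fun ω => ?_)
    rw [Real.norm_eq_abs, abs_mul, abs_of_pos (by positivity : 0 < 1 / b), abs_mul,
      abs_of_nonneg (hg0 _), abs_of_nonneg (sq_nonneg _)]
    refine mul_le_mul_of_nonneg_left ?_ (by positivity)
    calc _ ≤ K ((v.A ω - a) / b) ^ 2 * 1 := by gcongr; exact hg1 _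
      _ ≤ _ := by
        rw [mul_one, ← sq_abs]; exact pow_le_pow_left₀ (abs_nonneg _) (hcK _) 2
  have i1 := hsplit (cutoff δ b) (measurable_cutoff δ b) (cutoff_nonneg δ b) (cutoff_le_one δ b)
  have i2 := hsplit (fun u => 1 - cutoff δ b u) (measurable_one_sub_cutoff δ b)
    (one_sub_cutoff_nonneg δ b) (one_sub_cutoff_le_one δ b)
  have hsum : ∫ ω, 1 / b * K ((v.A ω - a) / b) ^ 2 * G ((v.Y ω, v.W ω), (v.Z ω, v.X ω)) ∂P =
      (∫ ω, 1 / b * (K ((v.A ω - a) / b) ^ 2 * cutoff δ b ((v.A ω - a) / b)) *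
        G ((v.Y ω, v.W ω), (v.Z ω, v.X ω)) ∂P) +
      ∫ ω, 1 / b * (K ((v.A ω - a) / b) ^ 2 * (1 - cutoff δ b ((v.A ω - a) / b))) *
        G ((v.Y ω, v.W ω), (v.Z ω, v.X ω)) ∂P := by
    rw [← integral_add i1 i2]
    congr 1; ext ω; ring
  have e1 : ∫ ω, 1 / b * (K ((v.A ω - a) / b) ^ 2 * cutoff δ b ((v.A ω - a) / b)) *
        G ((v.Y ω, v.W ω), (v.Z ω, v.X ω)) ∂P =
      ∫ x : ℝ × ((ℝ × 𝒲) × (𝒵 × 𝒳)), K x.1 ^ 2 * (cutoff δ b x.1 * Φ (b * x.1) x.2) * G' x.2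
        ∂(volume.prod m) := by
    have mg : Measurable fun x : ℝ × ((ℝ × 𝒲) × (𝒵 × 𝒳)) =>
        1 / b * (K x.1 ^ 2 * cutoff δ b x.1) * G x.2 :=
      (measurable_const.mul (((mK.comp measurable_fst).pow_const 2).mul
        ((measurable_cutoff δ b).comp measurable_fst))).mul (hG.comp measurable_snd)
    have := integral_rescaled hb a mA mT hpm (fun x => hp0 x.1 x.2) hmap mg
    simp only at this
    rw [this, ← integral_const_mul]
    congr 1; ext x
    rw [← hGG x.2]
    simp only [hΦ, Function.uncurry]
    field_simp
  have e2 : ∫ e, Φ 0 e * G' e ∂m = ∫ e, outcomeDensity pYW a e * G e ∂m := by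
    congr 1; ext e
    rw [← hGG e]; simp only [hΦ, add_zero]; ring
  have e3 : |∫ ω, 1 / b * (K ((v.A ω - a) / b) ^ 2 * (1 - cutoff δ b ((v.A ω - a) / b))) *
        G ((v.Y ω, v.W ω), (v.Z ω, v.X ω)) ∂P| ≤ B * (D * b * ∫ ω, (1 + v.Y ω ^ 2) ∂P) := by
    have : B * (D * b * ∫ ω, (1 + v.Y ω ^ 2) ∂P) = ∫ ω, (D * b) * (B * (1 + v.Y ω ^ 2)) ∂P := by
      rw [integral_const_mul, integral_const_mul]; ring
    rw [this]
    refine abs_integral_le_integral_abs.trans (integral_mono_of_nonneg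
      (ae_of_all _ fun ω => abs_nonneg _) ((hY2.const_mul B).const_mul _)
      (ae_of_all _ fun ω => ?_))
    simp only [abs_mul]
    have h1 := hDle b ((v.A ω - a) / b)
    have h0 := mul_nonneg (sq_nonneg (K ((v.A ω - a) / b)))
      (one_sub_cutoff_nonneg δ b ((v.A ω - a) / b))
    rw [← abs_mul (K ((v.A ω - a) / b) ^ 2), abs_of_nonneg h0,
      abs_of_pos (by positivity : 0 < 1 / b)]
    refine mul_le_mul ?_ (hGB _) (abs_nonneg _) (by positivity)
    calc _ ≤ 1 / b * (D * b ^ 2) := mul_le_mul_of_nonneg_left h1 (by positivity)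
      _ = D * b := by field_simp
  rw [hsum, e1]
  rw [e2] at hnear
  have hΩ : ∫ u, K u ^ 2 = omegaTwo K := rfl
  rw [hΩ] at hnear
  rw [mul_add, add_sub_right_comm]
  exact (abs_add_le _ _).trans (add_le_add hnear e3)

omit [SigmaFinite μW] [SigmaFinite μY] in
lemma Variables.Regular.memLp_score (hR : v.Regular P S h₀ q₀ μZ μW μY pZ pW pYW a)
    (hK : IsSecondOrderKernel K) {B b : ℝ} (hb : 0 < b) {H : 𝒲 × 𝒳 → ℝ} {Q : 𝒵 × 𝒳 → ℝ}
    (hH : Measurable H) (hQ : Measurable Q) (hHB : ∀ x, |H x| ≤ B) (hQB : ∀ x, |Q x| ≤ B) :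
    MemLp (fun ω => score K b a H Q (v.obs ω)) 2 P := by
  obtain ⟨cK, hcK⟩ := hK.bounded
  have mA := v.measurable_A
  have mu : Measurable fun ω => (v.A ω - a) / b := by fun_prop
  have hHL : MemLp (fun ω => H (v.W ω, v.X ω)) 2 P :=
    MemLp.of_bound (hH.comp v.measurable_WX).aestronglyMeasurable B (ae_of_all _ fun ω => hHB _)
  have hres : MemLp (fun ω => v.Y ω - H (v.W ω, v.X ω)) 2 P := hR.memLp_Y.sub hHL
  have mc : Measurable fun ω => 1 / b * K ((v.A ω - a) / b) * Q (v.Z ω, v.X ω) :=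
    (measurable_const.mul (hK.continuous.measurable.comp mu)).mul (hQ.comp v.measurable_ZX)
  have h1 : MemLp (fun ω => 1 / b * K ((v.A ω - a) / b) * Q (v.Z ω, v.X ω) *
      (v.Y ω - H (v.W ω, v.X ω))) 2 P := by
    refine hres.of_le_mul (c := 1 / b * cK * B) (mc.aestronglyMeasurable.mul hres.1)
      (ae_of_all _ fun ω => ?_)
    rw [norm_mul]
    refine mul_le_mul_of_nonneg_right ?_ (norm_nonneg _)
    rw [Real.norm_eq_abs, abs_mul, abs_mul, abs_of_pos (by positivity : 0 < 1 / b)]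
    have := (abs_nonneg _).trans (hcK 0)
    gcongr
    · exact hcK _
    · exact hQB _
  refine (h1.add hHL).ae_eq (ae_of_all _ fun ω => ?_)
  simp only [Pi.add_apply, score, Variables.obs]
  ring

end Variance

/-- The squared residual `(y - H)² Q²` depends Lipschitz continuously on bounded `H`, `Q`. -/
lemma abs_sq_residual_sub_le {y H h Q q B : ℝ} (hH : |H| ≤ B) (hh : |h| ≤ B) (hQ : |Q| ≤ B)
    (hq : |q| ≤ B) : |(y - H) ^ 2 * Q ^ 2 - (y - h) ^ 2 * q ^ 2| ≤
      4 * (1 + B) ^ 3 * (|h - H| + |Q - q|) * (1 + y ^ 2) := by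
  have hB : 0 ≤ B := (abs_nonneg _).trans hH
  have e : (y - H) ^ 2 * Q ^ 2 - (y - h) ^ 2 * q ^ 2 =
      (h - H) * ((y - H) + (y - h)) * Q ^ 2 + (Q - q) * ((y - h) ^ 2 * (Q + q)) := by ring
  have hy : |y| ≤ (1 + y ^ 2) / 2 := by
    rw [abs_le]; constructor <;> nlinarith [sq_nonneg (y - 1), sq_nonneg (y + 1)]
  have hQ2 : Q ^ 2 ≤ B ^ 2 := by rw [← sq_abs]; exact pow_le_pow_left₀ (abs_nonneg _) hQ 2
  have hh2 : h ^ 2 ≤ B ^ 2 := by rw [← sq_abs]; exact pow_le_pow_left₀ (abs_nonneg _) hh 2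
  have b1 : |((y - H) + (y - h)) * Q ^ 2| ≤ 4 * (1 + B) ^ 3 * (1 + y ^ 2) := by
    rw [abs_mul, abs_of_nonneg (sq_nonneg Q)]
    have h1 : |(y - H) + (y - h)| ≤ (1 + y ^ 2) * (1 + 2 * B) := by
      have := abs_add_le (y - H) (y - h)
      have := abs_sub y H
      have := abs_sub y h
      nlinarith [mul_nonneg hB (sq_nonneg y)]
    calc _ ≤ ((1 + y ^ 2) * (1 + 2 * B)) * B ^ 2 := by gcongr
      _ = ((1 + 2 * B) * B ^ 2) * (1 + y ^ 2) := by ring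
      _ ≤ _ := by
        refine mul_le_mul_of_nonneg_right ?_ (by positivity)
        nlinarith [pow_nonneg hB 2, pow_nonneg hB 3]
  have b2 : |(y - h) ^ 2 * (Q + q)| ≤ 4 * (1 + B) ^ 3 * (1 + y ^ 2) := by
    rw [abs_mul, abs_of_nonneg (sq_nonneg _)]
    have h1 : (y - h) ^ 2 ≤ 2 * (1 + B ^ 2) * (1 + y ^ 2) := by
      nlinarith [sq_nonneg (y + h), mul_nonneg (sq_nonneg B) (sq_nonneg y)]
    have h2 : |Q + q| ≤ 2 * B := by
      have := abs_add_le Q q; linarith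
    calc _ ≤ (2 * (1 + B ^ 2) * (1 + y ^ 2)) * (2 * B) := by gcongr
      _ = (4 * (1 + B ^ 2) * B) * (1 + y ^ 2) := by ring
      _ ≤ _ := by
        refine mul_le_mul_of_nonneg_right ?_ (by positivity)
        nlinarith [pow_nonneg hB 2, pow_nonneg hB 3]
  rw [e]
  refine (abs_add_le _ _).trans ?_
  rw [mul_assoc, abs_mul, abs_mul (Q - q)]
  calc _ ≤ |h - H| * (4 * (1 + B) ^ 3 * (1 + y ^ 2)) + |Q - q| * (4 * (1 + B) ^ 3 * (1 + y ^ 2)) := by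
        gcongr
    _ = _ := by ring

lemma sq_residual_le {y H Q B : ℝ} (hH : |H| ≤ B) (hQ : |Q| ≤ B) :
    (y - H) ^ 2 * Q ^ 2 ≤ 2 * (1 + B ^ 2) * B ^ 2 * (1 + y ^ 2) := by
  have hB : 0 ≤ B := (abs_nonneg _).trans hH
  have hQ2 : Q ^ 2 ≤ B ^ 2 := by rw [← sq_abs]; exact pow_le_pow_left₀ (abs_nonneg _) hQ 2
  have hh2 : H ^ 2 ≤ B ^ 2 := by rw [← sq_abs]; exact pow_le_pow_left₀ (abs_nonneg _) hH 2
  have h1 : (y - H) ^ 2 ≤ 2 * (1 + B ^ 2) * (1 + y ^ 2) := by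
    nlinarith [sq_nonneg (y + H), mul_nonneg (sq_nonneg B) (sq_nonneg y)]
  calc _ ≤ (2 * (1 + B ^ 2) * (1 + y ^ 2)) * B ^ 2 := by gcongr
    _ = _ := by ring

/-- Second order part of a square, with the cross term absorbed. -/
lemma abs_mul_sq_add_sub_le {b x h : ℝ} (hb : 0 < b) :
    |b * (x + h) ^ 2 - b * x ^ 2| ≤ √b * (b * x ^ 2) + (√b + b) * h ^ 2 := by
  -- With b = s² the cross term 2 s² x h is absorbed through s (s x ± h)² ≥ 0.
  obtain ⟨s, hs, rfl⟩ : ∃ s : ℝ, 0 < s ∧ b = s ^ 2 :=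
    ⟨√b, Real.sqrt_pos.2 hb, (Real.sq_sqrt hb.le).symm⟩
  rw [Real.sqrt_sq hs.le, abs_le]
  have h1 : 0 ≤ s * (s * x - h) ^ 2 := by positivity
  have h2 : 0 ≤ s * (s * x + h) ^ 2 := by positivity
  have h3 : 0 ≤ s ^ 2 * h ^ 2 := by positivity
  constructor <;> linarith

/-! ### Conditional second moment of one score -/

section Variance

variable {Ω 𝒰 𝒳 𝒵 𝒲 : Type*}
    [MeasurableSpace Ω] [MeasurableSpace 𝒰] [MeasurableSpace 𝒳] [MeasurableSpace 𝒵]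
    [MeasurableSpace 𝒲]

/-- The integrand `(y - h(a, w, x))² q(a, z, x)²` of `varConst`. -/
def sqResidual (H : 𝒲 × 𝒳 → ℝ) (Q : 𝒵 × 𝒳 → ℝ) (e : (ℝ × 𝒲) × (𝒵 × 𝒳)) : ℝ :=
  (e.1.1 - H (e.1.2, e.2.2)) ^ 2 * Q e.2 ^ 2

lemma measurable_sqResidual {H : 𝒲 × 𝒳 → ℝ} {Q : 𝒵 × 𝒳 → ℝ} (hH : Measurable H)
    (hQ : Measurable Q) : Measurable (sqResidual H Q) := by
  have hπ : Measurable fun e : (ℝ × 𝒲) × (𝒵 × 𝒳) => (e.1.2, e.2.2) := by fun_prop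
  have hy : Measurable fun e : (ℝ × 𝒲) × (𝒵 × 𝒳) => e.1.1 := by fun_prop
  exact ((hy.sub (hH.comp hπ)).pow_const 2).mul ((hQ.comp measurable_snd).pow_const 2)

variable {P : Measure Ω} [IsProbabilityMeasure P] {v : Variables Ω 𝒰 𝒳 𝒵 𝒲} {S : Set ℝ}
  {h₀ : ℝ → 𝒲 → 𝒳 → ℝ} {q₀ : ℝ → 𝒵 → 𝒳 → ℝ} {μZ : Measure 𝒵} {μW : Measure 𝒲}
  [SigmaFinite μW] {μY : Measure ℝ} [SigmaFinite μY] {pZ : ℝ × 𝒵 → 𝒲 × 𝒳 → ℝ}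
  {pW : ℝ × 𝒲 → 𝒵 × 𝒳 → ℝ} {pYW : ℝ × ℝ × 𝒲 → 𝒵 × 𝒳 → ℝ} {a : ℝ} {K : ℝ → ℝ}

lemma Variables.Regular.integrable_outcomeDensity_mul
    (hR : v.Regular P S h₀ q₀ μZ μW μY pZ pW pYW a) (hK : IsSecondOrderKernel K)
    {G : (ℝ × 𝒲) × (𝒵 × 𝒳) → ℝ} (hG : Measurable G) {B : ℝ}
    (hGB : ∀ e, |G e| ≤ B * (1 + e.1.1 ^ 2)) :
    Integrable (fun e => outcomeDensity pYW a e * G e) ((μY.prod μW).prod (v.lawZX P)) := by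
  have hp : Measurable (outcomeDensity pYW a) :=
    hR.measurable_outcomeDensity.comp (measurable_const.prodMk measurable_id)
  refine ((hR.exists_square_expansion hK).1.const_mul B).mono' (hp.mul hG).aestronglyMeasurable
    (ae_of_all _ fun e => ?_)
  have h0 : 0 ≤ outcomeDensity pYW a e := hR.densities.density_YW.nonneg _ _
  rw [Real.norm_eq_abs, abs_mul, abs_of_nonneg h0]
  calc _ ≤ outcomeDensity pYW a e * (B * (1 + e.1.1 ^ 2)) := by gcongr; exact hGB e
    _ = _ := by ring

lemma Variables.Regular.integrable_varDensity
    (hR : v.Regular P S h₀ q₀ μZ μW μY pZ pW pYW a) (hK : IsSecondOrderKernel K) :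
    Integrable (fun e => outcomeDensity pYW a e *
      sqResidual (fun x => h₀ a x.1 x.2) (fun x => q₀ a x.1 x.2) e)
      ((μY.prod μW).prod (v.lawZX P)) := by
  obtain ⟨ch, hch⟩ := hR.bounded_h
  obtain ⟨cq, hcq⟩ := hR.bounded_q
  refine hR.integrable_outcomeDensity_mul hK
    (measurable_sqResidual (hR.measurable_h a) (hR.measurable_q' a))
    (B := 2 * (1 + (max ch cq) ^ 2) * (max ch cq) ^ 2) fun e => ?_
  rw [abs_of_nonneg (by unfold sqResidual; positivity)]
  exact sq_residual_le ((hch a hR.mem _ _).trans (le_max_left _ _))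
    ((hcq a hR.mem _ _).trans (le_max_right _ _))

lemma Variables.Regular.varConst_eq (hR : v.Regular P S h₀ q₀ μZ μW μY pZ pW pYW a)
    (hK : IsSecondOrderKernel K) :
    v.varConst P μY μW h₀ q₀ pYW a = ∫ e, outcomeDensity pYW a e *
      sqResidual (fun x => h₀ a x.1 x.2) (fun x => q₀ a x.1 x.2) e
      ∂((μY.prod μW).prod (v.lawZX P)) := by
  have hi := hR.integrable_varDensity hK
  rw [integral_prod_symm _ hi]
  have h1 : ∀ x : 𝒵 × 𝒳, ∫ t : ℝ × 𝒲, outcomeDensity pYW a (t, x) *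
      sqResidual (fun x => h₀ a x.1 x.2) (fun x => q₀ a x.1 x.2) (t, x) ∂(μY.prod μW) =
      q₀ a x.1 x.2 ^ 2 * ∫ t : ℝ × 𝒲, (t.1 - h₀ a t.2 x.2) ^ 2 * pYW (a, t) x
        ∂(μY.prod μW) := fun x => by
    rw [← integral_const_mul]
    congr 1; ext t
    simp only [outcomeDensity, sqResidual]; ring
  have h2 := hi.integral_prod_right
  simp only [h1] at h2 ⊢
  rw [integral_map v.measurable_ZX.aemeasurable h2.1]
  rfl

/-- Conditional second moment of one summand of the estimator for given nuisance functions. -/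
theorem Variables.Regular.exists_second_moment_bound
    (hR : v.Regular P S h₀ q₀ μZ μW μY pZ pW pYW a) (hK : IsSecondOrderKernel K) (B : ℝ)
    {ε : ℝ} (hε : 0 < ε) :
    ∃ R, 0 ≤ R ∧ ∀ᶠ b in 𝓝[>] (0 : ℝ), ∀ (H : 𝒲 × 𝒳 → ℝ) (Q : 𝒵 × 𝒳 → ℝ),
      Measurable H → Measurable Q → (∀ x, |H x| ≤ B) → (∀ x, |Q x| ≤ B) →
      |b * (∫ ω, score K b a H Q (v.obs ω) ^ 2 ∂P) - omegaTwo K * v.varConst P μY μW h₀ q₀ pYW a| ≤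
        ε + R * (v.distH P h₀ a H + v.distQ P q₀ a Q) := by
  obtain ⟨iw, r, hr, hexp⟩ := hR.exists_square_expansion hK
  obtain ⟨ch, hch⟩ := hR.bounded_h
  obtain ⟨cq, hcq⟩ := hR.bounded_q
  set m := (μY.prod μW).prod (v.lawZX P) with hm
  set B₁ := max B (max ch cq) with hB₁
  have hB₁h : ∀ x : 𝒲 × 𝒳, |h₀ a x.1 x.2| ≤ B₁ := fun x =>
    (hch a hR.mem _ _).trans ((le_max_left _ _).trans (le_max_right _ _))
  have hB₁q : ∀ x : 𝒵 × 𝒳, |q₀ a x.1 x.2| ≤ B₁ := fun x =>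
    (hcq a hR.mem _ _).trans ((le_max_right _ _).trans (le_max_right _ _))
  have hB₁0 : 0 ≤ B₁ := by
    obtain ⟨ω⟩ : Nonempty Ω := nonempty_of_isProbabilityMeasure P
    exact (abs_nonneg _).trans (hB₁h (v.W ω, v.X ω))
  have hΩ := hK.omegaTwo_pos
  set w : (ℝ × 𝒲) × (𝒵 × 𝒳) → ℝ := fun e => 1 + e.1.1 ^ 2 with hw
  have hp0 : ∀ e, 0 ≤ outcomeDensity pYW a e := fun e => hR.densities.density_YW.nonneg _ _
  have hwp0 : ∀ e, 0 ≤ w e * outcomeDensity pYW a e := fun e =>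
    mul_nonneg (by simp only [hw]; positivity) (hp0 e)
  set L : ℝ := 4 * (1 + B₁) ^ 3 with hL
  have hL0 : 0 < L := by positivity
  set Ω₂ := omegaTwo K with hΩ₂
  -- Each of the two nuisance replacements then costs ε/4; the kernel limit and the lower-order part
  -- of the square take the other two quarters.
  set ε₁ := ε / (4 * (Ω₂ * L)) with hε₁
  have hε₁0 : 0 < ε₁ := by positivity
  have hπ : Measurable fun e : (ℝ × 𝒲) × (𝒵 × 𝒳) => (e.1.2, e.2.2) := by fun_prop
  -- The error in h is small in L² of the law of (W,X), whereas V integrates over w against the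
  -- reference measure and the density at level a. Absolute continuity of the image on (W,X) bridges
  -- the two.
  obtain ⟨R₁, hR₁, hle₁⟩ := exists_integral_abs_mul_le (μ := v.lawWX P)
    (π := fun e : (ℝ × 𝒲) × (𝒵 × 𝒳) => (e.1.2, e.2.2)) (m := m) hπ iw hwp0
    (hR.map_outcomeDensity_absolutelyContinuous w) (C := 2 * B₁) hε₁0
  obtain ⟨R₂, hR₂, hle₂⟩ := exists_integral_abs_mul_le (μ := v.lawZX P) (π := Prod.snd)
    (m := m) measurable_snd iw hwp0
    (map_withDensity_absolutelyContinuous Measure.quasiMeasurePreserving_snd _)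
    (C := 2 * B₁) hε₁0
  set C := 2 * (1 + B₁ ^ 2) * B₁ ^ 2 with hC
  have hC0 : 0 ≤ C := by positivity
  set I := ∫ e, w e * outcomeDensity pYW a e ∂m with hI
  refine ⟨Ω₂ * L * (R₁ + R₂), by positivity, ?_⟩
  have hlim₁ : ∀ᶠ b in 𝓝 (0 : ℝ), C * r b < ε / 4 := by
    have := hr.const_mul C
    rw [mul_zero] at this
    exact this.eventually (gt_mem_nhds (by positivity))
  -- The bracket is the later bound for the quadratic term `T`, so this controls the cross term of
  -- the score with H and the square of H.
  have hlim₂ : ∀ᶠ b in 𝓝 (0 : ℝ), √b * (Ω₂ * (C * I) + ε / 4) + (√b + b) * B₁ ^ 2 < ε / 4 := by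
    have h1 : Continuous fun b : ℝ => √b * (Ω₂ * (C * I) + ε / 4) + (√b + b) * B₁ ^ 2 := by
      fun_prop
    have h2 := h1.tendsto 0
    simp only [Real.sqrt_zero, zero_mul, add_zero] at h2
    exact h2.eventually (gt_mem_nhds (by positivity))
  filter_upwards [self_mem_nhdsWithin, nhdsWithin_le_nhds hlim₁, nhdsWithin_le_nhds hlim₂]
    with b hb hl₁ hl₂ H Q hH hQ hHB hQB
  have hb0 : (0 : ℝ) < b := hb
  replace hHB : ∀ x, |H x| ≤ B₁ := fun x => (hHB x).trans (le_max_left _ _)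
  replace hQB : ∀ x, |Q x| ≤ B₁ := fun x => (hQB x).trans (le_max_left _ _)
  set G := sqResidual H Q with hG
  set G₀ := sqResidual (fun x : 𝒲 × 𝒳 => h₀ a x.1 x.2) (fun x : 𝒵 × 𝒳 => q₀ a x.1 x.2) with hG₀
  have hGm : Measurable G := measurable_sqResidual hH hQ
  have hGC : ∀ e, |G e| ≤ C * (1 + e.1.1 ^ 2) := fun e => by
    rw [abs_of_nonneg (by simp only [hG, sqResidual]; positivity)]
    exact sq_residual_le (hHB _) (hQB _)
  have hmain := hexp b hb0 C G hGm hGC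
  have iG := hR.integrable_outcomeDensity_mul hK hGm hGC
  have iG₀ := hR.integrable_varDensity hK
  -- the quadratic part against its limit
  set J := ∫ e, outcomeDensity pYW a e * G e ∂m with hJ
  have hJI : J ≤ C * I := by
    rw [hJ, hI, ← integral_const_mul]
    refine integral_mono iG (iw.const_mul C) fun e => ?_
    have := (le_abs_self _).trans (hGC e)
    calc _ ≤ outcomeDensity pYW a e * (C * (1 + e.1.1 ^ 2)) :=
          mul_le_mul_of_nonneg_left this (hp0 e)
      _ = _ := by simp only [hw]; ring
  have hJV : |J - v.varConst P μY μW h₀ q₀ pYW a| ≤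
      L * ((ε₁ + R₁ * v.distH P h₀ a H) + (ε₁ + R₂ * v.distQ P q₀ a Q)) := by
    set D : 𝒲 × 𝒳 → ℝ := fun x => h₀ a x.1 x.2 - H x with hD
    set Δ : 𝒵 × 𝒳 → ℝ := fun x => Q x - q₀ a x.1 x.2 with hΔ
    obtain ⟨i1, l1⟩ := hle₁ D ((hR.measurable_h a).sub hH) fun x =>
      (abs_sub _ _).trans (by linarith [hB₁h x, hHB x])
    obtain ⟨i2, l2⟩ := hle₂ Δ (hQ.sub (hR.measurable_q' a)) fun x =>
      (abs_sub _ _).trans (by linarith [hB₁q x, hQB x])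
    rw [← hR.distQ_eq hQ] at l2
    have e3 : ∫ x, D x ^ 2 ∂(v.lawWX P) = v.distH P h₀ a H := by
      rw [hR.distH_eq hH]; congr 1; ext x; simp only [hD]; ring
    rw [e3] at l1
    rw [hR.varConst_eq hK, hJ, ← integral_sub iG iG₀]
    refine abs_integral_le_integral_abs.trans (le_trans ?_
      (mul_le_mul_of_nonneg_left (add_le_add l1 l2) hL0.le))
    rw [← integral_add i1 i2, ← integral_const_mul]
    refine integral_mono_of_nonneg (ae_of_all _ fun e => abs_nonneg _)
      ((i1.add i2).const_mul L) (ae_of_all _ fun e => ?_)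
    simp only [← mul_sub, abs_mul, abs_of_nonneg (hp0 e)]
    have h1 := abs_sq_residual_sub_le (y := e.1.1) (hHB (e.1.2, e.2.2)) (hB₁h (e.1.2, e.2.2))
      (hQB e.2) (hB₁q e.2)
    calc _ ≤ outcomeDensity pYW a e * (L * (|D (e.1.2, e.2.2)| + |Δ e.2|) * (1 + e.1.1 ^ 2)) :=
          mul_le_mul_of_nonneg_left h1 (hp0 e)
      _ = _ := by ring
  -- the remaining terms of the square
  set T := ∫ ω, 1 / b * K ((v.A ω - a) / b) ^ 2 * G ((v.Y ω, v.W ω), (v.Z ω, v.X ω)) ∂P with hT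
  set x : Ω → ℝ := fun ω => 1 / b * K ((v.A ω - a) / b) * (v.Y ω - H (v.W ω, v.X ω)) *
    Q (v.Z ω, v.X ω) with hx
  have hxsq : ∀ ω, b * x ω ^ 2 = 1 / b * K ((v.A ω - a) / b) ^ 2 *
      G ((v.Y ω, v.W ω), (v.Z ω, v.X ω)) := fun ω => by
    simp only [hx, hG, sqResidual]; field_simp
  have hsL := hR.memLp_score hK hb0 hH hQ hHB hQB
  have hHL : MemLp (fun ω => H (v.W ω, v.X ω)) 2 P :=
    MemLp.of_bound (hH.comp v.measurable_WX).aestronglyMeasurable B₁ (ae_of_all _ fun ω => hHB _)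
  have hxL : MemLp x 2 P := (hsL.sub hHL).ae_eq (ae_of_all _ fun ω => by
    simp only [Pi.sub_apply, score, Variables.obs, hx]; ring)
  have ix := hxL.integrable_sq.const_mul b
  have is := hsL.integrable_sq.const_mul b
  have hTx : T = ∫ ω, b * x ω ^ 2 ∂P := by simp only [hT, hxsq]
  have hrest : |b * (∫ ω, score K b a H Q (v.obs ω) ^ 2 ∂P) - T| ≤
      √b * T + (√b + b) * B₁ ^ 2 := by
    rw [hTx, ← integral_const_mul, ← integral_sub is ix, ← integral_const_mul]
    have hc : (√b + b) * B₁ ^ 2 = ∫ _ω, (√b + b) * B₁ ^ 2 ∂P := by simp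
    rw [hc, ← integral_add (ix.const_mul _) (integrable_const _)]
    refine abs_integral_le_integral_abs.trans (integral_mono_of_nonneg
      (ae_of_all _ fun ω => abs_nonneg _) ((ix.const_mul _).add (integrable_const _))
      (ae_of_all _ fun ω => ?_))
    have h1 := abs_mul_sq_add_sub_le (x := x ω) (h := H (v.W ω, v.X ω)) hb0
    have h2 : H (v.W ω, v.X ω) ^ 2 ≤ B₁ ^ 2 := by
      rw [← sq_abs]; exact pow_le_pow_left₀ (abs_nonneg _) (hHB _) 2
    have h3 : score K b a H Q (v.obs ω) = x ω + H (v.W ω, v.X ω) := rfl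
    simp only [h3]
    exact h1.trans (by gcongr)
  set dH := v.distH P h₀ a H
  set dQ := v.distQ P q₀ a Q
  set V := v.varConst P μY μW h₀ q₀ pYW a
  have hdH : 0 ≤ dH := v.distH_nonneg H
  have hdQ : 0 ≤ dQ := v.distQ_nonneg Q
  have hT1 : T ≤ Ω₂ * (C * I) + ε / 4 := by
    have h1 := (le_abs_self _).trans hmain
    have h2 := mul_le_mul_of_nonneg_left hJI hΩ.le
    linarith
  have hs1 := mul_le_mul_of_nonneg_left hT1 (Real.sqrt_nonneg b)
  have hJV' := mul_le_mul_of_nonneg_left hJV hΩ.le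
  have hε₂ : Ω₂ * L * ε₁ = ε / 4 := by rw [hε₁]; field_simp
  rw [← abs_of_pos hΩ, ← abs_mul, abs_of_pos hΩ] at hJV'
  have hdec : b * (∫ ω, score K b a H Q (v.obs ω) ^ 2 ∂P) - Ω₂ * V =
      (b * (∫ ω, score K b a H Q (v.obs ω) ^ 2 ∂P) - T) + (T - Ω₂ * J) + Ω₂ * (J - V) := by ring
  rw [hdec]
  refine (abs_add_three _ _ _).trans ?_
  have f1 : 0 ≤ Ω₂ * L * R₁ * dQ := by positivity
  have f2 : 0 ≤ Ω₂ * L * R₂ * dH := by positivity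
  linarith

end Variance

/-! ### Moments of a sample mean given an independent random element -/

section Sampling

variable {D O : Type*} [MeasurableSpace D] [MeasurableSpace O] {μ : Measure D} {ρ : Measure O}
  [IsProbabilityMeasure μ] [IsProbabilityMeasure ρ] {s : D × O → ℝ}

/-- Average over a sample, with a summand that depends on a further random element. -/
def average (s : D × O → ℝ) (n : ℕ) (x : D × (Fin n → O)) : ℝ :=
  1 / (n : ℝ) * ∑ i, s (x.1, x.2 i)

lemma measurePreserving_prod_eval {n : ℕ} (i : Fin n) :
    MeasurePreserving (fun x : D × (Fin n → O) => (x.1, x.2 i))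
      (μ.prod (Measure.pi fun _ => ρ)) (μ.prod ρ) :=
  (MeasurePreserving.id μ).prod (measurePreserving_eval (fun _ : Fin n => ρ) i)

lemma memLp_average (hs : MemLp s 2 (μ.prod ρ)) (n : ℕ) :
    MemLp (average s n) 2 (μ.prod (Measure.pi fun _ => ρ)) :=
  (memLp_finsetSum _ fun i _ =>
    hs.comp_measurePreserving (measurePreserving_prod_eval i)).const_mul _

/-- Each summand sees a pair with law μ ⊗ ρ. The condition on n excludes the empty average, which is
0. -/
lemma integral_average (hs : MemLp s 2 (μ.prod ρ)) {n : ℕ} (hn : 1 ≤ n) :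
    ∫ x, average s n x ∂(μ.prod (Measure.pi fun _ => ρ)) = ∫ d, ∫ o, s (d, o) ∂ρ ∂μ := by
  have hi := hs.integrable one_le_two
  have hi' : ∀ i : Fin n, Integrable (fun x : D × (Fin n → O) => s (x.1, x.2 i))
      (μ.prod (Measure.pi fun _ => ρ)) := fun i =>
    (measurePreserving_prod_eval i).integrable_comp_of_integrable hi
  have h1 : ∀ i : Fin n, ∫ x : D × (Fin n → O), s (x.1, x.2 i) ∂(μ.prod (Measure.pi fun _ => ρ)) =
      ∫ y, s y ∂(μ.prod ρ) := fun i => by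
    have hmp := measurePreserving_prod_eval (μ := μ) (ρ := ρ) i
    have := integral_map (μ := μ.prod (Measure.pi fun _ : Fin n => ρ)) (f := s)
      hmp.measurable.aemeasurable (by rw [hmp.map_eq]; exact hs.1)
    rw [← this, hmp.map_eq]
  have hn0 : (n : ℝ) ≠ 0 := by positivity
  simp only [average]
  rw [integral_const_mul, integral_finsetSum _ fun i _ => hi' i]
  simp only [h1, Finset.sum_const, Finset.card_univ, Fintype.card_fin, nsmul_eq_mul]
  rw [← integral_prod _ hi]
  field_simp

omit [IsProbabilityMeasure μ] in
lemma ae_memLp_section [SFinite μ] (hs : MemLp s 2 (μ.prod ρ)) :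
    ∀ᵐ d ∂μ, MemLp (fun o => s (d, o)) 2 ρ := by
  filter_upwards [hs.integrable_sq.prod_right_ae, hs.1.prodMk_left] with d hd hm
  exact (memLp_two_iff_integrable_sq hm).2 hd

-- Jensen's inequality, read off from nonnegativity of the variance of almost every section.
omit [IsProbabilityMeasure μ] in
lemma ae_sq_integral_le [SFinite μ] (hs : MemLp s 2 (μ.prod ρ)) :
    ∀ᵐ d ∂μ, (∫ o, s (d, o) ∂ρ) ^ 2 ≤ ∫ o, s (d, o) ^ 2 ∂ρ := by
  filter_upwards [ae_memLp_section hs] with d hd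
  have h1 := variance_eq_sub hd
  have h2 := variance_nonneg (fun o => s (d, o)) ρ
  simp only [Pi.pow_apply] at h1
  linarith

lemma integrable_mean (hs : MemLp s 2 (μ.prod ρ)) : Integrable (fun d => ∫ o, s (d, o) ∂ρ) μ :=
  (hs.integrable one_le_two).integral_prod_left

omit [IsProbabilityMeasure μ] in
lemma integrable_second_moment [SFinite μ] (hs : MemLp s 2 (μ.prod ρ)) :
    Integrable (fun d => ∫ o, s (d, o) ^ 2 ∂ρ) μ :=
  hs.integrable_sq.integral_prod_left

lemma integrable_sq_mean (hs : MemLp s 2 (μ.prod ρ)) :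
    Integrable (fun d => (∫ o, s (d, o) ∂ρ) ^ 2) μ := by
  refine (integrable_second_moment hs).mono' ((integrable_mean hs).1.pow 2) ?_
  filter_upwards [ae_sq_integral_le hs] with d hd
  rwa [Real.norm_eq_abs, abs_of_nonneg (sq_nonneg _)]

lemma integral_sq_average_pi {f : O → ℝ} (hf : MemLp f 2 ρ) {n : ℕ} (hn : 1 ≤ n) :
    ∫ o : Fin n → O, (1 / (n : ℝ) * ∑ i, f (o i)) ^ 2 ∂(Measure.pi fun _ => ρ) =
      ((∫ o, f o ^ 2 ∂ρ) - (∫ o, f o ∂ρ) ^ 2) / n + (∫ o, f o ∂ρ) ^ 2 := by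
  have hn0 : (n : ℝ) ≠ 0 := by positivity
  have hL : ∀ i : Fin n, MemLp (fun o : Fin n → O => f (o i)) 2 (Measure.pi fun _ => ρ) := fun i =>
    hf.comp_measurePreserving (measurePreserving_eval (fun _ : Fin n => ρ) i)
  have hS : MemLp (∑ i, fun o : Fin n → O => f (o i)) 2 (Measure.pi fun _ => ρ) :=
    memLp_finsetSum' _ fun i _ => hL i
  have hv := variance_sum_pi (μ := fun _ : Fin n => ρ) (X := fun _ => f) fun _ => hf
  rw [variance_eq_sub hS] at hv
  have hm : ∫ o : Fin n → O, (∑ i, fun o : Fin n → O => f (o i)) o ∂(Measure.pi fun _ => ρ) =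
      n * ∫ o, f o ∂ρ := by
    simp only [Finset.sum_apply]
    rw [integral_finsetSum _ fun i _ => (hL i).integrable one_le_two]
    have : ∀ i : Fin n, ∫ o : Fin n → O, f (o i) ∂(Measure.pi fun _ => ρ) = ∫ o, f o ∂ρ :=
      fun i => integral_comp_eval (μ := fun _ : Fin n => ρ) hf.1
    simp [this]
  rw [hm, variance_eq_sub hf] at hv
  simp only [Pi.pow_apply, Finset.sum_apply, Finset.sum_const, Finset.card_univ, Fintype.card_fin,
    nsmul_eq_mul] at hv
  simp only [mul_pow]
  rw [integral_const_mul]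
  rw [sub_eq_iff_eq_add] at hv
  rw [hv]
  field_simp

/-- Law of total variance: the mean of the conditional variance is divided by n, while the variance
of the conditional mean is not. The latter must therefore be shown to be o(1/(nb)) by itself. -/
lemma variance_average (hs : MemLp s 2 (μ.prod ρ)) {n : ℕ} (hn : 1 ≤ n) :
    variance (average s n) (μ.prod (Measure.pi fun _ => ρ)) =
      ((∫ d, ∫ o, s (d, o) ^ 2 ∂ρ ∂μ) - ∫ d, (∫ o, s (d, o) ∂ρ) ^ 2 ∂μ) / n +
        ((∫ d, (∫ o, s (d, o) ∂ρ) ^ 2 ∂μ) - (∫ d, ∫ o, s (d, o) ∂ρ ∂μ) ^ 2) := by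
  have hL := memLp_average hs n
  rw [variance_eq_sub hL, integral_average hs hn]
  have h1 : ∫ x, (average s n ^ 2) x ∂(μ.prod (Measure.pi fun _ => ρ)) =
      ∫ d, (((∫ o, s (d, o) ^ 2 ∂ρ) - (∫ o, s (d, o) ∂ρ) ^ 2) / n + (∫ o, s (d, o) ∂ρ) ^ 2) ∂μ := by
    simp only [Pi.pow_apply]
    rw [integral_prod _ hL.integrable_sq]
    refine integral_congr_ae ?_
    filter_upwards [ae_memLp_section hs] with d hd
    exact integral_sq_average_pi hd hn
  have i2 := integrable_second_moment hs
  have i1 := integrable_sq_mean hs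
  have e1 := integral_add ((i2.sub i1).div_const (n : ℝ)) i1
  have e2 := integral_sub i2 i1
  simp only [Pi.sub_apply] at e1
  rw [h1, e1, integral_div, e2]
  ring

lemma integral_sub_sq_eq {f : D → ℝ} (hf : MemLp f 2 μ) (c : ℝ) :
    ∫ x, (f x - c) ^ 2 ∂μ = variance f μ + ((∫ x, f x ∂μ) - c) ^ 2 := by
  have h1 := hf.integrable_sq
  have h2 := hf.integrable one_le_two
  have e : ∀ x, (f x - c) ^ 2 = f x ^ 2 - (2 * c) * f x + c ^ 2 := fun x => by ring
  simp only [e]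
  have e1 := integral_add (h1.sub (h2.const_mul (2 * c))) (integrable_const (c ^ 2))
  have e2 := integral_sub h1 (h2.const_mul (2 * c))
  simp only [Pi.sub_apply] at e1
  rw [e1, e2, integral_const_mul, variance_eq_sub hf]
  simp only [integral_const, probReal_univ, smul_eq_mul, Pi.pow_apply]
  ring

end Sampling

/-! ### Averaging over the auxiliary sample -/

section Asymptotic

lemma isLittleO_rpow_neg_half {x y : ℕ → ℝ} (hy : ∀ᶠ n in atTop, 0 < y n)
    (h : Tendsto (fun n => y n * x n ^ 2) atTop (𝓝 0)) :
    x =o[atTop] fun n => y n ^ (-(1 / 2) : ℝ) := by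
  refine isLittleO_of_tendsto' ?_ ?_
  · filter_upwards [hy] with n hn h0
    exact absurd h0 (Real.rpow_pos_of_pos hn _).ne'
  · have h1 : Tendsto (fun n => √(y n * x n ^ 2)) atTop (𝓝 0) := by
      have := (Real.continuous_sqrt.tendsto 0).comp h
      rwa [Real.sqrt_zero] at this
    refine squeeze_zero_norm' ?_ h1
    filter_upwards [hy] with n hn
    rw [Real.sqrt_mul hn.le, Real.sqrt_sq_eq_abs, Real.rpow_neg hn.le, div_inv_eq_mul,
      ← Real.sqrt_eq_rpow, norm_mul, Real.norm_eq_abs, Real.norm_eq_abs,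
      abs_of_nonneg (Real.sqrt_nonneg _), mul_comm]

lemma tendsto_zero_of_forall_le {x : ℕ → ℝ} (hx : ∀ᶠ n in atTop, 0 ≤ x n)
    (h : ∀ ε > 0, ∀ᶠ n in atTop, x n ≤ ε) : Tendsto x atTop (𝓝 0) := by
  rw [tendsto_order]
  refine ⟨fun c hc => ?_, fun c hc => ?_⟩
  · filter_upwards [hx] with n hn using hc.trans_le hn
  · filter_upwards [h (c / 2) (by positivity)] with n hn using by linarith

variable {D : ℕ → Type*} [∀ n, MeasurableSpace (D n)] {μ : ∀ n, Measure (D n)}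
  [∀ n, IsProbabilityMeasure (μ n)] {M S eH eQ : ∀ n, D n → ℝ} {b : ℕ → ℝ} {β κ V E : ℝ}

/-- The mean square of the conditional bias beyond its leading term is `o((nb)⁻¹)`. -/
lemma tendsto_mean_sq_remainder (hb : ∀ n, 0 < b n)
    (hb5 : (fun n : ℕ => (n : ℝ) * b n ^ 5) =O[atTop] fun _ => (1 : ℝ))
    (hH0 : ∀ n d, 0 ≤ eH n d) (hQ0 : ∀ n d, 0 ≤ eQ n d)
    (hHE : ∀ n d, eH n d ≤ E) (hQE : ∀ n d, eQ n d ≤ E)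
    (hHi : ∀ n, Integrable (eH n) (μ n)) (hQi : ∀ n, Integrable (eQ n) (μ n))
    (hH : Tendsto (fun n => ∫ d, eH n d ∂(μ n)) atTop (𝓝 0))
    (hQ : Tendsto (fun n => ∫ d, eQ n d ∂(μ n)) atTop (𝓝 0))
    (hHQ : (fun n => ∫ d, eH n d * eQ n d ∂(μ n)) =o[atTop] fun n : ℕ => ((n : ℝ) * b n)⁻¹)
    (hbias : ∃ C, 0 ≤ C ∧ ∀ ε > 0, ∃ R, 0 ≤ R ∧ ∀ᶠ n in atTop, ∀ d, |M n d - β - b n ^ 2 * κ| ≤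
      b n ^ 2 * (ε + R * (eH n d + eQ n d)) + C * √(eH n d * eQ n d)) :
    Tendsto (fun n : ℕ => n * b n * ∫ d, (M n d - β - b n ^ 2 * κ) ^ 2 ∂(μ n)) atTop (𝓝 0) := by
  obtain ⟨C, hC, hb'⟩ := hbias
  have hHQi : ∀ n, Integrable (fun d => eH n d * eQ n d) (μ n) := fun n =>
    (hHi n).mul_bdd (c := E) (hQi n).1 (ae_of_all _ fun d => by
      rw [Real.norm_eq_abs, abs_of_nonneg (hQ0 n d)]; exact hQE n d)
  have hb0 : ∀ n : ℕ, 0 ≤ (n : ℝ) * b n := fun n => mul_nonneg n.cast_nonneg (hb n).le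
  obtain ⟨A, hA⟩ := hb5.bound
  have hA' : ∀ᶠ n : ℕ in atTop, (n : ℝ) * b n ^ 5 ≤ |A| := by
    filter_upwards [hA] with n hn
    have := (le_abs_self _).trans hn
    simp only [norm_one, mul_one] at this
    exact this.trans (le_abs_self _)
  have hHQ' : Tendsto (fun n : ℕ => n * b n * ∫ d, eH n d * eQ n d ∂(μ n)) atTop (𝓝 0) := by
    have := hHQ.tendsto_div_nhds_zero
    simpa only [div_inv_eq_mul, mul_comm] using this
  refine tendsto_zero_of_forall_le (Eventually.of_forall fun n =>
    mul_nonneg (hb0 n) (integral_nonneg fun d => sq_nonneg _)) fun η hη => ?_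
  -- After multiplication by n b the term 4 ε² b⁴ is at most 4 ε² |A|, which this choice makes at
  -- most η/4.
  set ε := √(η / (16 * (|A| + 1))) with hε
  have hε0 : 0 < ε := Real.sqrt_pos.2 (by positivity)
  have hε2 : ε ^ 2 = η / (16 * (|A| + 1)) := Real.sq_sqrt (by positivity)
  obtain ⟨R, hR, hev⟩ := hb' ε hε0
  have hE : ∀ᶠ n in atTop, 8 * |A| * R ^ 2 * E * ((∫ d, eH n d ∂(μ n)) + ∫ d, eQ n d ∂(μ n)) <
      η / 4 := by
    have := (hH.add hQ).const_mul (8 * |A| * R ^ 2 * E)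
    rw [add_zero, mul_zero] at this
    exact this.eventually (gt_mem_nhds (by positivity))
  have hP : ∀ᶠ n : ℕ in atTop, 2 * C ^ 2 * (n * b n * ∫ d, eH n d * eQ n d ∂(μ n)) < η / 4 := by
    have := hHQ'.const_mul (2 * C ^ 2)
    rw [mul_zero] at this
    exact this.eventually (gt_mem_nhds (by positivity))
  filter_upwards [hev, hE, hP, hA'] with n hn hEn hPn hAn
  have hpt : ∀ d, (M n d - β - b n ^ 2 * κ) ^ 2 ≤ b n ^ 4 * (4 * ε ^ 2) +
      b n ^ 4 * (8 * R ^ 2 * E) * (eH n d + eQ n d) + 2 * C ^ 2 * (eH n d * eQ n d) := fun d => by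
    have h1 := pow_le_pow_left₀ (abs_nonneg _) (hn d) 2
    rw [sq_abs] at h1
    have h2 : √(eH n d * eQ n d) ^ 2 = eH n d * eQ n d :=
      Real.sq_sqrt (mul_nonneg (hH0 n d) (hQ0 n d))
    have h3 : ∀ x y : ℝ, (x + y) ^ 2 ≤ 2 * x ^ 2 + 2 * y ^ 2 := fun x y => by
      nlinarith [sq_nonneg (x - y)]
    have h4 := h3 (b n ^ 2 * (ε + R * (eH n d + eQ n d))) (C * √(eH n d * eQ n d))
    have h5 := h3 ε (R * (eH n d + eQ n d))
    -- Only the means of the squared errors are known to vanish; the uniform bound E reduces their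
    -- squares to first powers. The square root term, once squared, is exactly the product whose
    -- mean has the assumed rate.
    have h6 : (eH n d + eQ n d) ^ 2 ≤ 2 * E * (eH n d + eQ n d) := by
      rw [sq]
      exact mul_le_mul_of_nonneg_right (by linarith [hHE n d, hQE n d])
        (add_nonneg (hH0 n d) (hQ0 n d))
    have h7 := mul_le_mul_of_nonneg_left h6 (sq_nonneg R)
    have h8 : (ε + R * (eH n d + eQ n d)) ^ 2 ≤ 2 * ε ^ 2 + 4 * R ^ 2 * E * (eH n d + eQ n d) := by
      rw [mul_pow] at h5; linarith
    have h9 := mul_le_mul_of_nonneg_left h8 (by positivity : 0 ≤ b n ^ 4)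
    have h10 : (b n ^ 2) ^ 2 = b n ^ 4 := by ring
    rw [mul_pow C, h2, mul_pow, h10] at h4
    linarith
  have hE0 : ∫ d, (M n d - β - b n ^ 2 * κ) ^ 2 ∂(μ n) ≤ b n ^ 4 * (4 * ε ^ 2) +
      b n ^ 4 * (8 * R ^ 2 * E) * ((∫ d, eH n d ∂(μ n)) + ∫ d, eQ n d ∂(μ n)) +
      2 * C ^ 2 * ∫ d, eH n d * eQ n d ∂(μ n) := by
    have i1 : Integrable (fun d => b n ^ 4 * (8 * R ^ 2 * E) * (eH n d + eQ n d)) (μ n) :=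
      ((hHi n).add (hQi n)).const_mul _
    have i2 := (hHQi n).const_mul (2 * C ^ 2)
    have i0 : Integrable (fun _ : D n => b n ^ 4 * (4 * ε ^ 2)) (μ n) := integrable_const _
    refine (integral_mono_of_nonneg (ae_of_all _ fun d => sq_nonneg _) ((i0.add i1).add i2)
      (ae_of_all _ hpt)).trans (le_of_eq ?_)
    simp only [Pi.add_apply]
    have e1 := integral_add (i0.add i1) i2
    have e2 := integral_add i0 i1
    simp only [Pi.add_apply] at e1 e2
    rw [e1, e2, integral_const_mul (b n ^ 4 * (8 * R ^ 2 * E)), integral_const_mul (2 * C ^ 2),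
      integral_add (hHi n) (hQi n)]
    simp
  have h1 := mul_le_mul_of_nonneg_left hE0 (hb0 n)
  set eh := ∫ d, eH n d ∂(μ n)
  set eq := ∫ d, eQ n d ∂(μ n)
  set ep := ∫ d, eH n d * eQ n d ∂(μ n)
  have heh : 0 ≤ eh := integral_nonneg (hH0 n)
  have heq : 0 ≤ eq := integral_nonneg (hQ0 n)
  have hE1 : 0 ≤ E := by
    obtain ⟨d⟩ : Nonempty (D n) := nonempty_of_isProbabilityMeasure (μ n)
    exact (hH0 n d).trans (hHE n d)
  have h2 := mul_le_mul_of_nonneg_right hAn (by positivity : 0 ≤ 4 * ε ^ 2)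
  have h3 := mul_le_mul_of_nonneg_right hAn (by positivity : 0 ≤ 8 * R ^ 2 * E * (eh + eq))
  have h4 : |A| * (4 * ε ^ 2) ≤ η / 4 := by
    rw [hε2]
    have : |A| * (4 * (η / (16 * (|A| + 1)))) = (η / 4) * (|A| / (|A| + 1)) := by field_simp; ring
    rw [this]
    exact mul_le_of_le_one_right (by positivity) ((div_le_one (by positivity)).2 (by linarith))
  linarith

/-- Bias and variance of an average over `n` observations from conditional bias and conditional
second moment. -/
theorem tendsto_bias_variance (hb : ∀ n, 0 < b n)
    (hb0 : Tendsto b atTop (𝓝 0)) (hnb : Tendsto (fun n : ℕ => (n : ℝ) * b n) atTop atTop)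
    (hHi : ∀ n, Integrable (eH n) (μ n)) (hQi : ∀ n, Integrable (eQ n) (μ n))
    (hH : Tendsto (fun n => ∫ d, eH n d ∂(μ n)) atTop (𝓝 0))
    (hQ : Tendsto (fun n => ∫ d, eQ n d ∂(μ n)) atTop (𝓝 0))
    (hMi : ∀ n, Integrable (M n) (μ n)) (hM2 : ∀ n, Integrable (fun d => M n d ^ 2) (μ n))
    (hSi : ∀ n, Integrable (S n) (μ n))
    (hΔ : Tendsto (fun n : ℕ => n * b n * ∫ d, (M n d - β - b n ^ 2 * κ) ^ 2 ∂(μ n)) atTop (𝓝 0))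
    (hsec : ∀ ε > 0, ∃ R, 0 ≤ R ∧ ∀ᶠ n in atTop, ∀ d, |b n * S n d - V| ≤
      ε + R * (eH n d + eQ n d)) :
    ((fun n => (∫ d, M n d ∂(μ n)) - β - b n ^ 2 * κ) =o[atTop]
      fun n : ℕ => ((n : ℝ) * b n) ^ (-(1 / 2) : ℝ)) ∧
    Tendsto (fun n : ℕ => n * b n * (((∫ d, S n d ∂(μ n)) - ∫ d, M n d ^ 2 ∂(μ n)) / n +
      ((∫ d, M n d ^ 2 ∂(μ n)) - (∫ d, M n d ∂(μ n)) ^ 2))) atTop (𝓝 V) := by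
  have hnb0 : ∀ᶠ n : ℕ in atTop, 0 < (n : ℝ) * b n := hnb.eventually_gt_atTop 0
  set c : ℕ → ℝ := fun n => β + b n ^ 2 * κ with hc
  set G : ℕ → ℝ := fun n => ∫ d, (M n d - β - b n ^ 2 * κ) ^ 2 ∂(μ n) with hG
  have hL : ∀ n, MemLp (M n) 2 (μ n) := fun n => (memLp_two_iff_integrable_sq (hMi n).1).2 (hM2 n)
  -- Both summands are nonnegative, so `hΔ` makes each of them o(1/(nb)): one is the squared bias
  -- remainder, the other the variance of the conditional mean.
  have hGe : ∀ n, G n = variance (M n) (μ n) + ((∫ d, M n d ∂(μ n)) - β - b n ^ 2 * κ) ^ 2 :=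
    fun n => by
    have := integral_sub_sq_eq (hL n) (c n)
    simp only [hc, ← sub_sub] at this
    exact this
  have hvar : ∀ n, variance (M n) (μ n) = (∫ d, M n d ^ 2 ∂(μ n)) - (∫ d, M n d ∂(μ n)) ^ 2 :=
    fun n => variance_eq_sub (hL n)
  have hv0 : ∀ n, 0 ≤ variance (M n) (μ n) := fun n => variance_nonneg _ _
  have hsq : Tendsto (fun n : ℕ => n * b n * ((∫ d, M n d ∂(μ n)) - β - b n ^ 2 * κ) ^ 2) atTop
      (𝓝 0) := by
    refine squeeze_zero' (hnb0.mono fun n hn => mul_nonneg hn.le (sq_nonneg _))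
      (hnb0.mono fun n hn => mul_le_mul_of_nonneg_left ?_ hn.le) hΔ
    have := hGe n
    have := hv0 n
    simp only [hG] at *
    linarith
  have hvt : Tendsto (fun n : ℕ => n * b n * variance (M n) (μ n)) atTop (𝓝 0) := by
    refine squeeze_zero' (hnb0.mono fun n hn => mul_nonneg hn.le (hv0 n))
      (hnb0.mono fun n hn => mul_le_mul_of_nonneg_left ?_ hn.le) hΔ
    have := hGe n
    have := sq_nonneg ((∫ d, M n d ∂(μ n)) - β - b n ^ 2 * κ)
    simp only [hG] at *
    linarith
  refine ⟨isLittleO_rpow_neg_half hnb0 hsq, ?_⟩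
  -- the second moment
  have hSt : Tendsto (fun n => b n * ∫ d, S n d ∂(μ n)) atTop (𝓝 V) := by
    rw [tendsto_iff_norm_sub_tendsto_zero]
    refine tendsto_zero_of_forall_le (Eventually.of_forall fun n => norm_nonneg _) fun η hη => ?_
    obtain ⟨R, hR, hev⟩ := hsec (η / 2) (by positivity)
    have hE : ∀ᶠ n in atTop, R * ((∫ d, eH n d ∂(μ n)) + ∫ d, eQ n d ∂(μ n)) < η / 2 := by
      have := (hH.add hQ).const_mul R
      rw [add_zero, mul_zero] at this
      exact this.eventually (gt_mem_nhds (by positivity))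
    filter_upwards [hev, hE] with n hn hEn
    have e1 : b n * (∫ d, S n d ∂(μ n)) - V = ∫ d, (b n * S n d - V) ∂(μ n) := by
      rw [integral_sub ((hSi n).const_mul _) (integrable_const _), integral_const_mul]; simp
    have i1 : Integrable (fun d => R * (eH n d + eQ n d)) (μ n) := ((hHi n).add (hQi n)).const_mul _
    rw [e1]
    refine (norm_integral_le_integral_norm _).trans ((integral_mono_of_nonneg
      (ae_of_all _ fun d => norm_nonneg _) ((integrable_const (η / 2)).add i1)
      (ae_of_all _ hn)).trans ?_)
    have e2 := integral_add (integrable_const (μ := μ n) (η / 2)) i1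
    simp only [Pi.add_apply] at e2 ⊢
    rw [e2, integral_const_mul, integral_add (hHi n) (hQi n)]
    simp only [integral_const, probReal_univ, smul_eq_mul, one_mul]
    linarith
  -- the square of the conditional mean is negligible
  have hG0 : Tendsto G atTop (𝓝 0) := by
    have h1 := hΔ.mul (tendsto_inv_atTop_zero.comp hnb)
    rw [mul_zero] at h1
    refine h1.congr' (hnb0.mono fun n hn => ?_)
    simp only [Function.comp, ← div_eq_mul_inv, hG]
    exact mul_div_cancel_left₀ _ hn.ne'
  have hMt : Tendsto (fun n => b n * ∫ d, M n d ^ 2 ∂(μ n)) atTop (𝓝 0) := by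
    have hct : Tendsto c atTop (𝓝 β) := by
      have := ((hb0.pow 2).mul_const κ).const_add β
      simpa using this
    have hlim : Tendsto (fun n => b n * (2 * c n ^ 2 + 2 * G n)) atTop (𝓝 0) := by
      have := hb0.mul (((hct.pow 2).const_mul 2).add (hG0.const_mul 2))
      simpa using this
    refine squeeze_zero (fun n => mul_nonneg (hb n).le (integral_nonneg fun d => sq_nonneg _))
      (fun n => mul_le_mul_of_nonneg_left ?_ (hb n).le) hlim
    have h1 := hGe n
    have h2 := hvar n
    have h3 := hv0 n
    have h4 : (∫ d, M n d ∂(μ n)) ^ 2 ≤ 2 * c n ^ 2 + 2 * ((∫ d, M n d ∂(μ n)) - c n) ^ 2 := by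
      nlinarith [sq_nonneg ((∫ d, M n d ∂(μ n)) - 2 * c n)]
    simp only [hc, ← sub_sub] at h4 ⊢
    linarith
  have hfin := (hSt.sub hMt).add hvt
  rw [sub_zero, add_zero] at hfin
  refine hfin.congr' (hnb0.mono fun n hn => ?_)
  have hn0 : (n : ℝ) ≠ 0 := by rintro h; simp [h] at hn
  rw [hvar n]
  field_simp

end Asymptotic

/-! ### Rates and optimality of the bandwidth -/

section Rates

variable {K : ℝ → ℝ} {B V : ℝ} {b bias var mse : ℕ → ℝ}

/-- The fifth power of the bandwidth is (1/n) times a bounded sequence. -/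
lemma tendsto_zero_of_isBigO_pow_five
    (hb5 : (fun n : ℕ => (n : ℝ) * b n ^ 5) =O[atTop] fun _ => (1 : ℝ)) :
    Tendsto b atTop (𝓝 0) := by
  have h1 : Tendsto (fun n : ℕ => ((n : ℝ))⁻¹) atTop (𝓝 0) := tendsto_inv_atTop_nhds_zero_nat
  have h2 : Tendsto (fun n : ℕ => ((n : ℝ))⁻¹ * ((n : ℝ) * b n ^ 5)) atTop (𝓝 0) := by
    refine ((isBigO_refl (fun n : ℕ => ((n : ℝ))⁻¹) atTop).mul hb5).trans_tendsto ?_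
    simpa using h1
  have h3 : Tendsto (fun n => b n ^ 5) atTop (𝓝 0) := by
    refine h2.congr' ?_
    filter_upwards [eventually_ge_atTop 1] with n hn
    have : (n : ℝ) ≠ 0 := by positivity
    field_simp
  rw [tendsto_zero_iff_norm_tendsto_zero] at h3 ⊢
  rw [tendsto_order] at h3 ⊢
  refine ⟨fun c hc => Eventually.of_forall fun n => hc.trans_le (norm_nonneg _), fun c hc => ?_⟩
  filter_upwards [h3.2 (c ^ 5) (by positivity)] with n hn
  rw [norm_pow] at hn
  exact lt_of_pow_lt_pow_left₀ 5 hc.le hn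

/-- Since b² √(nb) = √(n b⁵), the leading bias is of the order of the standard deviation. -/
lemma isBigO_sq_bandwidth (hb : ∀ n, 0 < b n)
    (hb5 : (fun n : ℕ => (n : ℝ) * b n ^ 5) =O[atTop] fun _ => (1 : ℝ)) :
    (fun n => b n ^ 2) =O[atTop] fun n : ℕ => ((n : ℝ) * b n) ^ (-(1 / 2) : ℝ) := by
  obtain ⟨A, hA⟩ := hb5.bound
  refine IsBigO.of_bound √A ?_
  filter_upwards [hA, eventually_ge_atTop 1] with n hn hn1
  have hn0 : (0 : ℝ) < n := by exact_mod_cast hn1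
  have hy : 0 < (n : ℝ) * b n := mul_pos hn0 (hb n)
  have hs : 0 < √((n : ℝ) * b n) := Real.sqrt_pos.2 hy
  rw [Real.rpow_neg hy.le, ← Real.sqrt_eq_rpow, norm_inv, Real.norm_eq_abs, Real.norm_eq_abs,
    abs_of_pos hs, abs_of_pos (pow_pos (hb n) 2), ← div_eq_mul_inv, le_div_iff₀ hs]
  rw [norm_one, mul_one, Real.norm_eq_abs, abs_of_pos (mul_pos hn0 (pow_pos (hb n) 5))] at hn
  have h1 : b n ^ 2 * √((n : ℝ) * b n) = √((n : ℝ) * b n ^ 5) := by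
    rw [show (n : ℝ) * b n ^ 5 = (b n ^ 2) ^ 2 * (n * b n) by ring,
      Real.sqrt_mul (sq_nonneg (b n ^ 2)), Real.sqrt_sq (pow_pos (hb n) 2).le]
  rw [h1]
  exact Real.sqrt_le_sqrt hn

/-- Mean squared error from bias and variance. -/
lemma mse_sub_amse_isLittleO (hb : ∀ n, 0 < b n)
    (hb5 : (fun n : ℕ => (n : ℝ) * b n ^ 5) =O[atTop] fun _ => (1 : ℝ))
    (hbias : (fun n => bias n - b n ^ 2 / 2 * kappaTwo K * B)
      =o[atTop] fun n : ℕ => ((n : ℝ) * b n) ^ (-(1 / 2) : ℝ))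
    (hvar : ∃ r : ℕ → ℝ, Tendsto r atTop (𝓝 0) ∧
      ∀ n : ℕ, 1 ≤ n → var n = omegaTwo K / (n * b n) * (V + r n))
    (hmse : ∀ n, mse n = var n + bias n ^ 2) :
    (fun n => mse n - amse K B V n (b n)) =o[atTop] fun n : ℕ => ((n : ℝ) * b n)⁻¹ := by
  obtain ⟨r, hr, hv⟩ := hvar
  have hc : (fun n => b n ^ 2 / 2 * kappaTwo K * B) =O[atTop]
      fun n : ℕ => ((n : ℝ) * b n) ^ (-(1 / 2) : ℝ) := by
    have := (isBigO_sq_bandwidth hb hb5).const_mul_left (kappaTwo K * B / 2)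
    refine this.congr_left fun n => by ring
  have hpow : ∀ n : ℕ, ((n : ℝ) * b n) ^ (-(1 / 2) : ℝ) * ((n : ℝ) * b n) ^ (-(1 / 2) : ℝ) =
      ((n : ℝ) * b n)⁻¹ := fun n => by
    have hy : 0 ≤ (n : ℝ) * b n := mul_nonneg n.cast_nonneg (hb n).le
    rw [Real.rpow_neg hy, ← mul_inv, ← Real.sqrt_eq_rpow, Real.mul_self_sqrt hy]
  have h1 := (hbias.mul hbias).congr_right hpow
  -- The cross term between bias remainder and leading bias is o·O of (nb)^(-1/2); this is where n
  -- b⁵ = O(1) is needed for the mean squared error.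
  have h2 := ((hbias.mul_isBigO hc).congr_right hpow).const_mul_left 2
  have h3 : (fun n : ℕ => omegaTwo K * r n * ((n : ℝ) * b n)⁻¹) =o[atTop]
      fun n : ℕ => ((n : ℝ) * b n)⁻¹ := by
    have h4 : (fun n => omegaTwo K * r n) =o[atTop] fun _ => (1 : ℝ) := by
      rw [isLittleO_one_iff]; simpa using hr.const_mul (omegaTwo K)
    simpa using h4.mul_isBigO (isBigO_refl (fun n : ℕ => ((n : ℝ) * b n)⁻¹) atTop)
  refine ((h1.add h2).add h3).congr' ?_ EventuallyEq.rfl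
  filter_upwards [eventually_ge_atTop 1] with n hn
  have hn0 : (n : ℝ) ≠ 0 := by positivity
  have hbn := (hb n).ne'
  rw [hmse, hv n hn, amse]
  field_simp
  ring

lemma isBigO_mse_of_isTheta
    (hmse : (fun n => mse n - amse K B V n (b n)) =o[atTop] fun n : ℕ => ((n : ℝ) * b n)⁻¹)
    (hΘ : (fun n => b n) =Θ[atTop] fun n : ℕ => (n : ℝ) ^ (-(1 / 5) : ℝ)) :
    mse =O[atTop] fun n : ℕ => (n : ℝ) ^ (-(4 / 5) : ℝ) := by
  have hb4 : (fun n => b n ^ 4) =O[atTop] fun n : ℕ => (n : ℝ) ^ (-(4 / 5) : ℝ) := by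
    refine (hΘ.1.pow 4).congr_right fun n => ?_
    rw [← Real.rpow_natCast, ← Real.rpow_mul n.cast_nonneg]
    norm_num
  have hinv : (fun n : ℕ => ((n : ℝ) * b n)⁻¹) =O[atTop] fun n : ℕ => (n : ℝ) ^ (-(4 / 5) : ℝ) := by
    have h1 : (fun n => (b n)⁻¹) =O[atTop] fun n : ℕ => ((n : ℝ) ^ (-(1 / 5) : ℝ))⁻¹ :=
      hΘ.inv.1
    refine ((isBigO_refl (fun n : ℕ => ((n : ℝ))⁻¹) atTop).mul h1).congr' ?_ ?_
    · exact Eventually.of_forall fun n => (mul_inv _ _).symm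
    · filter_upwards [eventually_ge_atTop 1] with n hn
      have hn0 : (0 : ℝ) < n := by exact_mod_cast hn
      rw [← Real.rpow_neg hn0.le, ← Real.rpow_neg_one, ← Real.rpow_add hn0]
      norm_num
  have h1 := hmse.isBigO.trans hinv
  have h2 := hb4.const_mul_left ((kappaTwo K * B) ^ 2 / 4)
  have h3 := hinv.const_mul_left (omegaTwo K * V)
  refine ((h1.add h2).add h3).congr_left fun n => ?_
  simp only [amse]
  ring

variable (hΩ : 0 < omegaTwo K) (hB : kappaTwo K * B ≠ 0) (hV : 0 < V)
include hΩ hB hV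

lemma optBandwidth_pos {n : ℕ} (hn : 1 ≤ n) : 0 < optBandwidth K B V n := by
  have hn0 : (0 : ℝ) < n := by exact_mod_cast hn
  have := pow_pos (abs_pos.2 hB) 2
  rw [sq_abs] at this
  unfold optBandwidth
  positivity

/-- The stationarity condition of the leading mean squared error. It expresses the variance constant
through the optimal bandwidth and reduces the minimisation to c⁴/4 + x⁵/c. -/
lemma optBandwidth_pow_five {n : ℕ} (hn : 1 ≤ n) :
    (kappaTwo K * B) ^ 2 * optBandwidth K B V n ^ 5 = omegaTwo K * V / n := by
  have hn0 : (0 : ℝ) < n := by exact_mod_cast hn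
  have hc : 0 < (kappaTwo K * B) ^ 2 := by positivity
  have h1 : ∀ x : ℝ, 0 < x → (x ^ (1 / 5 : ℝ)) ^ 5 = x := fun x hx => by
    rw [← Real.rpow_natCast, ← Real.rpow_mul hx.le]; norm_num
  have h2 : ((n : ℝ) ^ (-(1 / 5) : ℝ)) ^ 5 = (n : ℝ)⁻¹ := by
    rw [← Real.rpow_natCast, ← Real.rpow_mul hn0.le, ← Real.rpow_neg_one]; norm_num
  unfold optBandwidth
  set k := (kappaTwo K * B) ^ 2
  rw [mul_pow ((omegaTwo K * V / k) ^ (1 / 5 : ℝ)), h1 _ (by positivity), h2]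
  field_simp

lemma amse_eq_optBandwidth {n : ℕ} (hn : 1 ≤ n) (c : ℝ) :
    amse K B V n c = (kappaTwo K * B) ^ 2 * (c ^ 4 / 4 + optBandwidth K B V n ^ 5 / c) := by
  have hn0 : (0 : ℝ) < n := by exact_mod_cast hn
  rw [amse, ← div_div, ← optBandwidth_pow_five hΩ hB hV hn]
  ring

lemma amse_optBandwidth {n : ℕ} (hn : 1 ≤ n) :
    amse K B V n (optBandwidth K B V n) =
      5 / 4 * ((kappaTwo K * B) ^ 2 * optBandwidth K B V n ^ 4) := by
  have h := optBandwidth_pos hΩ hB hV hn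
  rw [amse_eq_optBandwidth hΩ hB hV hn]
  field_simp
  ring

lemma amse_optBandwidth_lt {n : ℕ} (hn : 1 ≤ n) {c : ℝ} (hc : 0 < c)
    (hne : c ≠ optBandwidth K B V n) :
    amse K B V n (optBandwidth K B V n) < amse K B V n c := by
  have h := optBandwidth_pos hΩ hB hV hn
  rw [amse_optBandwidth hΩ hB hV hn, amse_eq_optBandwidth hΩ hB hV hn]
  set x := optBandwidth K B V n
  have hk : 0 < (kappaTwo K * B) ^ 2 := by positivity
  -- The gap to the minimum 5 x⁴/4, multiplied by 4 c, has the double root c = x; the cofactor has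
  -- positive coefficients, which gives strictness and uniqueness without calculus.
  have h1 : 0 < (c - x) ^ 2 * (c ^ 3 + 2 * c ^ 2 * x + 3 * c * x ^ 2 + 4 * x ^ 3) :=
    mul_pos (by have := sub_ne_zero.2 hne; positivity) (by positivity)
  have h2 : c ^ 4 / 4 + x ^ 5 / c - 5 / 4 * x ^ 4 =
      (c - x) ^ 2 * (c ^ 3 + 2 * c ^ 2 * x + 3 * c * x ^ 2 + 4 * x ^ 3) / (4 * c) := by
    field_simp; ring
  have h3 : 0 < c ^ 4 / 4 + x ^ 5 / c - 5 / 4 * x ^ 4 := by rw [h2]; positivity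
  nlinarith [mul_pos hk h3]

lemma amse_optBandwidth_le {n : ℕ} (hn : 1 ≤ n) {c : ℝ} (hc : 0 < c) :
    amse K B V n (optBandwidth K B V n) ≤ amse K B V n c := by
  rcases eq_or_ne c (optBandwidth K B V n) with h | h
  · rw [← h]
  · exact (amse_optBandwidth_lt hΩ hB hV hn hc h).le

lemma amse_optBandwidth_eq {n : ℕ} (hn : 1 ≤ n) :
    amse K B V n (optBandwidth K B V n) = 5 / 4 * ((kappaTwo K * B) ^ 2) ^ (1 / 5 : ℝ) *
      (omegaTwo K * V) ^ (4 / 5 : ℝ) * (n : ℝ) ^ (-(4 / 5) : ℝ) := by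
  have hn0 : (0 : ℝ) < n := by exact_mod_cast hn
  have hk : 0 < (kappaTwo K * B) ^ 2 := by positivity
  have hD : 0 < omegaTwo K * V := by positivity
  rw [amse_optBandwidth hΩ hB hV hn, optBandwidth]
  set k := (kappaTwo K * B) ^ 2
  set D := omegaTwo K * V
  have h1 : ((D / k) ^ (1 / 5 : ℝ)) ^ 4 = D ^ (4 / 5 : ℝ) / k ^ (4 / 5 : ℝ) := by
    rw [← Real.rpow_natCast, ← Real.rpow_mul (by positivity), Real.div_rpow hD.le hk.le]
    norm_num
  have h2 : ((n : ℝ) ^ (-(1 / 5) : ℝ)) ^ 4 = (n : ℝ) ^ (-(4 / 5) : ℝ) := by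
    rw [← Real.rpow_natCast, ← Real.rpow_mul hn0.le]; norm_num
  have h3 : k = k ^ (1 / 5 : ℝ) * k ^ (4 / 5 : ℝ) := by
    rw [← Real.rpow_add hk]; norm_num
  rw [mul_pow, h1, h2]
  have h4 : 0 < k ^ (4 / 5 : ℝ) := by positivity
  calc _ = 5 / 4 * (k / k ^ (4 / 5 : ℝ)) * D ^ (4 / 5 : ℝ) * (n : ℝ) ^ (-(4 / 5) : ℝ) := by ring
    _ = _ := by
      congr 3
      rw [div_eq_iff h4.ne']
      exact h3

lemma amse_pos {n : ℕ} (hn : 1 ≤ n) {c : ℝ} (hc : 0 < c) : 0 < amse K B V n c := by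
  have hn0 : (0 : ℝ) < n := by exact_mod_cast hn
  unfold amse
  positivity

-- Since Ω₂V is positive, an error o(1/(nb)) is small relative to the variance part alone.
omit hB in
lemma eventually_abs_mse_sub_amse_le (hb : ∀ n, 0 < b n)
    (hmse : (fun n => mse n - amse K B V n (b n)) =o[atTop] fun n : ℕ => ((n : ℝ) * b n)⁻¹)
    {ε : ℝ} (hε : 0 < ε) : ∀ᶠ n : ℕ in atTop,
      |mse n - amse K B V n (b n)| ≤ ε * (omegaTwo K * V / (n * b n)) := by
  have hD : 0 < omegaTwo K * V := by positivity
  filter_upwards [hmse.bound (mul_pos hε hD)] with n hn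
  have hy : 0 ≤ ((n : ℝ) * b n)⁻¹ := inv_nonneg.2 (mul_nonneg n.cast_nonneg (hb n).le)
  rw [Real.norm_eq_abs, Real.norm_eq_abs, abs_of_nonneg hy] at hn
  calc _ ≤ _ := hn
    _ = _ := by rw [div_eq_mul_inv]; ring

lemma eventually_le_mse (hb : ∀ n, 0 < b n) (hmse0 : ∀ n, 0 ≤ mse n)
    (hmse : (fun n => mse n - amse K B V n (b n)) =o[atTop] fun n : ℕ => ((n : ℝ) * b n)⁻¹)
    {ε : ℝ} (hε : 0 < ε) : ∀ᶠ n : ℕ in atTop,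
      (1 - ε) * amse K B V n (optBandwidth K B V n) ≤ mse n := by
  filter_upwards [eventually_abs_mse_sub_amse_le hΩ hV hb hmse hε, eventually_ge_atTop 1]
    with n hn hn1
  have hp := amse_pos hΩ hB hV hn1 (optBandwidth_pos hΩ hB hV hn1)
  rcases le_or_gt 1 ε with h1 | h1
  · exact (mul_nonpos_of_nonpos_of_nonneg (by linarith) hp.le).trans (hmse0 n)
  · have h2 : omegaTwo K * V / (n * b n) ≤ amse K B V n (b n) := by
      unfold amse
      have : 0 ≤ b n ^ 4 / 4 * (kappaTwo K * B) ^ 2 := by positivity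
      linarith
    have h3 := mul_le_mul_of_nonneg_left h2 hε.le
    have h4 := mul_le_mul_of_nonneg_left (amse_optBandwidth_le hΩ hB hV hn1 (hb n))
      (by linarith : 0 ≤ 1 - ε)
    have h5 := (abs_le.1 hn).1
    linarith

/-- Half of the variance part absorbs the error, so a constant times n^(-4/5) bounds squared bias
and half the variance separately. The first bounds the bandwidth from above, the second from below.
-/
lemma isTheta_of_isBigO_mse (hb : ∀ n, 0 < b n)
    (hmse : (fun n => mse n - amse K B V n (b n)) =o[atTop] fun n : ℕ => ((n : ℝ) * b n)⁻¹)
    (hO : mse =O[atTop] fun n : ℕ => (n : ℝ) ^ (-(4 / 5) : ℝ)) :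
    (fun n => b n) =Θ[atTop] fun n : ℕ => (n : ℝ) ^ (-(1 / 5) : ℝ) := by
  obtain ⟨C, hC0, hC⟩ := hO.exists_pos
  have hD : 0 < omegaTwo K * V := by positivity
  have hk : 0 < (kappaTwo K * B) ^ 2 := by positivity
  set D := omegaTwo K * V with hDdef
  set k := (kappaTwo K * B) ^ 2 with hkdef
  have hmain : ∀ᶠ n : ℕ in atTop,
      b n ^ 4 / 4 * k + D / (2 * (n * b n)) ≤ C * (n : ℝ) ^ (-(4 / 5) : ℝ) := by
    filter_upwards [eventually_abs_mse_sub_amse_le hΩ hV hb hmse one_half_pos, hC.bound]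
      with n hn hCn
    have h1 := (abs_le.1 hn).1
    rw [Real.norm_eq_abs, Real.norm_eq_abs, abs_of_nonneg (Real.rpow_nonneg n.cast_nonneg _)] at hCn
    have h2 := (le_abs_self _).trans hCn
    have h3 : D / (2 * (n * b n)) = 1 / 2 * (D / (n * b n)) := by rw [mul_comm 2, ← div_div]; ring
    rw [amse] at h1
    linarith
  have hpow : ∀ n : ℕ, ((n : ℝ) ^ (-(1 / 5) : ℝ)) ^ 4 = (n : ℝ) ^ (-(4 / 5) : ℝ) := fun n => by
    rw [← Real.rpow_natCast, ← Real.rpow_mul n.cast_nonneg]; norm_num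
  constructor
  · have h4 : (fun n => b n ^ 4) =O[atTop] fun n : ℕ => ((n : ℝ) ^ (-(1 / 5) : ℝ)) ^ 4 := by
      refine IsBigO.of_bound (4 * C / k) ?_
      filter_upwards [hmain] with n hn
      have h1 : 0 ≤ D / (2 * (n * b n)) := by have := hb n; positivity
      rw [hpow, Real.norm_eq_abs, Real.norm_eq_abs, abs_of_pos (pow_pos (hb n) 4),
        abs_of_nonneg (Real.rpow_nonneg n.cast_nonneg _), div_mul_eq_mul_div, le_div_iff₀ hk]
      linarith
    exact h4.of_pow four_ne_zero
  · refine IsBigO.of_bound (2 * C / D) ?_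
    filter_upwards [hmain, eventually_ge_atTop 1] with n hn hn1
    have hn0 : (0 : ℝ) < n := by exact_mod_cast hn1
    have hbn := hb n
    have h1 : 0 ≤ b n ^ 4 / 4 * k := by positivity
    have h2 : D / (2 * (n * b n)) ≤ C * (n : ℝ) ^ (-(4 / 5) : ℝ) := by linarith
    rw [div_le_iff₀ (by positivity)] at h2
    have h3 : (n : ℝ) ^ (-(4 / 5) : ℝ) * n = ((n : ℝ) ^ (-(1 / 5) : ℝ))⁻¹ := by
      rw [← Real.rpow_neg hn0.le]
      nth_rewrite 2 [← Real.rpow_one (n : ℝ)]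
      rw [← Real.rpow_add hn0]; norm_num
    have hp : 0 < (n : ℝ) ^ (-(1 / 5) : ℝ) := Real.rpow_pos_of_pos hn0 _
    rw [Real.norm_eq_abs, Real.norm_eq_abs, abs_of_pos hp, abs_of_pos hbn, div_mul_eq_mul_div,
      le_div_iff₀ hD]
    have h4 : D ≤ 2 * C * b n * ((n : ℝ) ^ (-(1 / 5) : ℝ))⁻¹ := by rw [← h3]; linarith
    rw [← div_eq_mul_inv, le_div_iff₀ hp] at h4
    linarith

lemma tendsto_mse_div (hb : ∀ n, 0 < b n)
    (hmse : (fun n => mse n - amse K B V n (b n)) =o[atTop] fun n : ℕ => ((n : ℝ) * b n)⁻¹)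
    (ht : Tendsto (fun n => b n / optBandwidth K B V n) atTop (𝓝 1)) :
    Tendsto (fun n => mse n / amse K B V n (optBandwidth K B V n)) atTop (𝓝 1) := by
  have h1 : Tendsto (fun n => mse n / amse K B V n (b n)) atTop (𝓝 1) := by
    rw [Metric.tendsto_nhds]
    intro ε hε
    filter_upwards [eventually_abs_mse_sub_amse_le hΩ hV hb hmse (half_pos hε),
      eventually_ge_atTop 1] with n hn hn1
    have hp := amse_pos hΩ hB hV hn1 (hb n)
    have h2 : omegaTwo K * V / (n * b n) ≤ amse K B V n (b n) := by
      unfold amse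
      have : 0 ≤ b n ^ 4 / 4 * (kappaTwo K * B) ^ 2 := by positivity
      linarith
    have h3 := mul_le_mul_of_nonneg_left h2 (half_pos hε).le
    rw [Real.dist_eq, div_sub_one hp.ne', abs_div, abs_of_pos hp, div_lt_iff₀ hp]
    have := mul_pos (half_pos hε) hp
    linarith
  have h2 : Tendsto (fun n => amse K B V n (b n) / amse K B V n (optBandwidth K B V n)) atTop
      (𝓝 1) := by
    -- In terms of t, the bandwidth divided by the optimal one, the ratio of the leading errors is
    -- 4/5 (t⁴/4 + 1/t), which equals 1 at t = 1.
    have h3 : Tendsto (fun n => 4 / 5 * ((b n / optBandwidth K B V n) ^ 4 / 4 +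
        (b n / optBandwidth K B V n)⁻¹)) atTop (𝓝 (4 / 5 * (1 ^ 4 / 4 + 1⁻¹))) :=
      (((ht.pow 4).div_const 4).add (ht.inv₀ one_ne_zero)).const_mul _
    rw [show (4 / 5 * (1 ^ 4 / 4 + 1⁻¹) : ℝ) = 1 by norm_num] at h3
    refine h3.congr' ?_
    filter_upwards [eventually_ge_atTop 1] with n hn1
    have hx := optBandwidth_pos hΩ hB hV hn1
    have hbn := hb n
    have hk : (kappaTwo K * B) ^ 2 ≠ 0 := by positivity
    rw [amse_optBandwidth hΩ hB hV hn1, amse_eq_optBandwidth hΩ hB hV hn1]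
    set x := optBandwidth K B V n
    set k := (kappaTwo K * B) ^ 2
    field_simp
  have h3 := h1.mul h2
  rw [one_mul] at h3
  refine h3.congr' ?_
  filter_upwards [eventually_ge_atTop 1] with n hn1
  have hp := (amse_pos hΩ hB hV hn1 (hb n)).ne'
  rw [div_mul_div_cancel₀ hp]

end Rates

/-! ### Measurability and moments of the score with fitted nuisance functions -/

section Estimator

variable {Ω 𝒰 𝒳 𝒵 𝒲 D : Type*}
    [MeasurableSpace Ω] [MeasurableSpace 𝒰] [MeasurableSpace 𝒳] [MeasurableSpace 𝒵]
    [MeasurableSpace 𝒲] [MeasurableSpace D] {P : Measure Ω} [IsProbabilityMeasure P]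
    {K : ℝ → ℝ} {b a B : ℝ} {H : D → 𝒲 × 𝒳 → ℝ} {Q : D → 𝒵 × 𝒳 → ℝ}

lemma Variables.measurable_obs (v : Variables Ω 𝒰 𝒳 𝒵 𝒲) : Measurable v.obs :=
  v.measurable_A.prodMk (v.measurable_Z.prodMk (v.measurable_W.prodMk
    (v.measurable_X.prodMk v.measurable_Y)))

instance (v : Variables Ω 𝒰 𝒳 𝒵 𝒲) : IsProbabilityMeasure (P.map v.obs) :=
  Measure.isProbabilityMeasure_map v.measurable_obs.aemeasurable

instance (v : Variables Ω 𝒰 𝒳 𝒵 𝒲) (k : ℕ) : IsProbabilityMeasure (v.sampleLaw P k) :=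
  inferInstanceAs (IsProbabilityMeasure (Measure.pi fun _ => P.map v.obs))

lemma measurable_score (hK : Measurable K) (hH : Measurable (Function.uncurry H))
    (hQ : Measurable (Function.uncurry Q)) :
    Measurable fun x : D × Obs 𝒳 𝒵 𝒲 => score K b a (H x.1) (Q x.1) x.2 := by
  have m1 : Measurable fun x : D × Obs 𝒳 𝒵 𝒲 => (x.2.1 - a) / b := by fun_prop
  have m2 : Measurable fun x : D × Obs 𝒳 𝒵 𝒲 => (x.1, x.2.2.2.1, x.2.2.2.2.1) := by fun_prop
  have m3 : Measurable fun x : D × Obs 𝒳 𝒵 𝒲 => (x.1, x.2.2.1, x.2.2.2.2.1) := by fun_prop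
  have m4 : Measurable fun x : D × Obs 𝒳 𝒵 𝒲 => x.2.2.2.2.2 := by fun_prop
  exact (((measurable_const.mul (hK.comp m1)).mul (m4.sub (hH.comp m2))).mul
    (hQ.comp m3)).add (hH.comp m2)

/-- Kernel and nuisance functions are bounded, so for a fixed bandwidth the score is at most a
constant times |y| + 1. -/
lemma IsSecondOrderKernel.memLp_score_prod (hK : IsSecondOrderKernel K)
    {v : Variables Ω 𝒰 𝒳 𝒵 𝒲} (hY : MemLp v.Y 2 P) {μ : Measure D} [IsProbabilityMeasure μ]
    (hb : 0 < b)
    (hH : Measurable (Function.uncurry H)) (hQ : Measurable (Function.uncurry Q))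
    (hHB : ∀ d x, |H d x| ≤ B) (hQB : ∀ d x, |Q d x| ≤ B) :
    MemLp (fun x : D × Obs 𝒳 𝒵 𝒲 => score K b a (H x.1) (Q x.1) x.2) 2 (μ.prod (P.map v.obs)) := by
  obtain ⟨cK, hcK⟩ := hK.bounded
  have my : Measurable fun o : Obs 𝒳 𝒵 𝒲 => o.2.2.2.2 := by fun_prop
  have h1 : MemLp (fun o : Obs 𝒳 𝒵 𝒲 => o.2.2.2.2) 2 (P.map v.obs) :=
    (memLp_map_measure_iff my.aestronglyMeasurable v.measurable_obs.aemeasurable).2 hY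
  have h2 : MemLp (fun x : D × Obs 𝒳 𝒵 𝒲 => |x.2.2.2.2.2| + 1) 2 (μ.prod (P.map v.obs)) :=
    (h1.comp_measurePreserving (measurePreserving_snd (μ := μ))).abs.add (memLp_const 1)
  obtain ⟨ω⟩ : Nonempty Ω := nonempty_of_isProbabilityMeasure P
  obtain ⟨d⟩ : Nonempty D := nonempty_of_isProbabilityMeasure μ
  have hB : 0 ≤ B := (abs_nonneg _).trans (hHB d (v.W ω, v.X ω))
  have hc : 0 ≤ cK := (abs_nonneg _).trans (hcK 0)
  refine h2.of_le_mul (c := 1 / b * cK * (1 + B) * B + B)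
    (measurable_score hK.continuous.measurable hH hQ).aestronglyMeasurable (ae_of_all _ fun x => ?_)
  have e0 : 0 ≤ |x.2.2.2.2.2| := abs_nonneg _
  rw [Real.norm_eq_abs, Real.norm_eq_abs, abs_of_nonneg (add_nonneg e0 zero_le_one)]
  refine (abs_add_le _ _).trans ?_
  rw [abs_mul, abs_mul, abs_mul, abs_of_pos (by positivity : 0 < 1 / b), add_mul]
  have e1 : |x.2.2.2.2.2 - H x.1 (x.2.2.2.1, x.2.2.2.2.1)| ≤ (1 + B) * (|x.2.2.2.2.2| + 1) := by
    refine (abs_sub _ _).trans ?_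
    have := hHB x.1 (x.2.2.2.1, x.2.2.2.2.1)
    nlinarith [mul_nonneg hB e0]
  refine add_le_add ?_ ?_
  · calc _ ≤ 1 / b * cK * ((1 + B) * (|x.2.2.2.2.2| + 1)) * B := by
          gcongr
          · exact hcK _
          · exact hQB _ _
      _ = _ := by ring
  · have := hHB x.1 (x.2.2.2.1, x.2.2.2.2.1)
    nlinarith [mul_nonneg hB e0]

variable {v : Variables Ω 𝒰 𝒳 𝒵 𝒲} {h₀ : ℝ → 𝒲 → 𝒳 → ℝ} {q₀ : ℝ → 𝒵 → 𝒳 → ℝ}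

omit [MeasurableSpace D] in
lemma Variables.distH_le (hHB : ∀ d x, |H d x| ≤ B) (hhB : ∀ w x, |h₀ a w x| ≤ B) (d : D) :
    v.distH P h₀ a (H d) ≤ (2 * B) ^ 2 := by
  have h := integral_mono_of_nonneg (μ := P)
    (f := fun ω => (H d (v.W ω, v.X ω) - h₀ a (v.W ω) (v.X ω)) ^ 2) (g := fun _ => (2 * B) ^ 2)
    (ae_of_all _ fun ω => sq_nonneg _) (integrable_const _) (ae_of_all _ fun ω => by
      simp only
      rw [← sq_abs]
      refine pow_le_pow_left₀ (abs_nonneg _) ((abs_sub _ _).trans ?_) 2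
      linarith [hHB d (v.W ω, v.X ω), hhB (v.W ω) (v.X ω)])
  simpa [Variables.distH] using h

omit [MeasurableSpace D] in
lemma Variables.distQ_le (hQB : ∀ d x, |Q d x| ≤ B) (hqB : ∀ z x, |q₀ a z x| ≤ B) (d : D) :
    v.distQ P q₀ a (Q d) ≤ (2 * B) ^ 2 := by
  have h := integral_mono_of_nonneg (μ := P)
    (f := fun ω => (Q d (v.Z ω, v.X ω) - q₀ a (v.Z ω) (v.X ω)) ^ 2) (g := fun _ => (2 * B) ^ 2)
    (ae_of_all _ fun ω => sq_nonneg _) (integrable_const _) (ae_of_all _ fun ω => by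
      simp only
      rw [← sq_abs]
      refine pow_le_pow_left₀ (abs_nonneg _) ((abs_sub _ _).trans ?_) 2
      linarith [hQB d (v.Z ω, v.X ω), hqB (v.Z ω) (v.X ω)])
  simpa [Variables.distQ] using h

lemma Variables.integrable_distH {μ : Measure D} [IsProbabilityMeasure μ]
    (hH : Measurable (Function.uncurry H)) (hh : Measurable fun x : 𝒲 × 𝒳 => h₀ a x.1 x.2)
    (hHB : ∀ d x, |H d x| ≤ B) (hhB : ∀ w x, |h₀ a w x| ≤ B) :
    Integrable (fun d => v.distH P h₀ a (H d)) μ := by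
  have m1 : Measurable fun x : D × Ω => (x.1, v.W x.2, v.X x.2) :=
    measurable_fst.prodMk (v.measurable_WX.comp measurable_snd)
  have m2 : Measurable fun x : D × Ω => (H x.1 (v.W x.2, v.X x.2) - h₀ a (v.W x.2) (v.X x.2)) ^ 2 :=
    ((hH.comp m1).sub (hh.comp (v.measurable_WX.comp measurable_snd))).pow_const 2
  refine Integrable.of_bound (C := (2 * B) ^ 2)
    m2.stronglyMeasurable.integral_prod_right.aestronglyMeasurable (ae_of_all _ fun d => ?_)
  have h0 := v.distH_nonneg (P := P) (h₀ := h₀) (a := a) (H d)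
  exact (abs_of_nonneg h0).le.trans (Variables.distH_le hHB hhB d)

lemma Variables.integrable_distQ {μ : Measure D} [IsProbabilityMeasure μ]
    (hQ : Measurable (Function.uncurry Q)) (hq : Measurable fun x : 𝒵 × 𝒳 => q₀ a x.1 x.2)
    (hQB : ∀ d x, |Q d x| ≤ B) (hqB : ∀ z x, |q₀ a z x| ≤ B) :
    Integrable (fun d => v.distQ P q₀ a (Q d)) μ := by
  have m1 : Measurable fun x : D × Ω => (x.1, v.Z x.2, v.X x.2) :=
    measurable_fst.prodMk (v.measurable_ZX.comp measurable_snd)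
  have m2 : Measurable fun x : D × Ω => (Q x.1 (v.Z x.2, v.X x.2) - q₀ a (v.Z x.2) (v.X x.2)) ^ 2 :=
    ((hQ.comp m1).sub (hq.comp (v.measurable_ZX.comp measurable_snd))).pow_const 2
  refine Integrable.of_bound (C := (2 * B) ^ 2)
    m2.stronglyMeasurable.integral_prod_right.aestronglyMeasurable (ae_of_all _ fun d => ?_)
  have h0 := v.distQ_nonneg (P := P) (q₀ := q₀) (a := a) (Q d)
  exact (abs_of_nonneg h0).le.trans (Variables.distQ_le hQB hqB d)

end Estimator

/-! ### Absolute convergence of the integrals in B and V -/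

section Integrability

variable {Ω 𝒰 𝒳 𝒵 𝒲 : Type*}
    [MeasurableSpace Ω] [MeasurableSpace 𝒰] [MeasurableSpace 𝒳] [MeasurableSpace 𝒵]
    [MeasurableSpace 𝒲] {P : Measure Ω} [IsProbabilityMeasure P]
  {v : Variables Ω 𝒰 𝒳 𝒵 𝒲} {S : Set ℝ}
  {h₀ : ℝ → 𝒲 → 𝒳 → ℝ} {q₀ : ℝ → 𝒵 → 𝒳 → ℝ} {μZ : Measure 𝒵} {μW : Measure 𝒲}
  [SigmaFinite μW] {μY : Measure ℝ} [SigmaFinite μY] {pZ : ℝ × 𝒵 → 𝒲 × 𝒳 → ℝ}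
  {pW : ℝ × 𝒲 → 𝒵 × 𝒳 → ℝ} {pYW : ℝ × ℝ × 𝒲 → 𝒵 × 𝒳 → ℝ} {a : ℝ} {K : ℝ → ℝ}

omit [SigmaFinite μY] in
lemma Variables.Regular.integrable_biasIntegrand
    (hR : v.Regular P S h₀ q₀ μZ μW μY pZ pW pYW a) (hK : IsSecondOrderKernel K) :
    Integrable (fun t : (𝒵 × 𝒳) × 𝒲 => q₀ a t.1.1 t.1.2 * biasIntegrand h₀ pW a t.2 t.1.1 t.1.2)
      ((P.map fun ω => (v.Z ω, v.X ω)).prod μW) :=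
  (hR.integrable_biasDensity_mul hK).swap.congr (ae_of_all _ fun _ => mul_comm _ _)

lemma Variables.Regular.integrable_varIntegrand
    (hR : v.Regular P S h₀ q₀ μZ μW μY pZ pW pYW a) (hK : IsSecondOrderKernel K) :
    Integrable (fun t : (𝒵 × 𝒳) × ℝ × 𝒲 =>
        q₀ a t.1.1 t.1.2 ^ 2 * ((t.2.1 - h₀ a t.2.2 t.1.2) ^ 2 * pYW (a, t.2) t.1))
      ((P.map fun ω => (v.Z ω, v.X ω)).prod (μY.prod μW)) :=
  (hR.integrable_varDensity hK).swap.congr (ae_of_all _ fun t => by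
    simp only [Function.comp, Prod.swap, outcomeDensity, sqResidual]; ring)

end Integrability

end Proximal

end

/-! ### The theorem -/

theorem theorem4 {Ω 𝒰 𝒳 𝒵 𝒲 : Type*}
    [MeasurableSpace Ω] [StandardBorelSpace Ω] [MeasurableSpace 𝒰] [StandardBorelSpace 𝒰]
    [MeasurableSpace 𝒳] [StandardBorelSpace 𝒳] [MeasurableSpace 𝒵] [StandardBorelSpace 𝒵]
    [MeasurableSpace 𝒲] [StandardBorelSpace 𝒲]
    (P : Measure Ω) [IsProbabilityMeasure P] (v : Proximal.Variables Ω 𝒰 𝒳 𝒵 𝒲)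
    -- the treatment space
    (S : Set ℝ) (hS : IsOpen S) (hAS : ∀ᵐ ω ∂P, v.A ω ∈ S)
    -- causal assumptions
    (hcons : v.Consistency P) (hpos : v.Positivity P S) (hign : v.LatentIgnorability P)
    (hproxy : v.ProxyIndependence P) (hcompl : v.Completeness P)
    -- moments: the observed outcome is square integrable and `β` is finite and continuous
    (hY : MemLp v.Y 2 P) (hYpot : ∀ a ∈ S, Integrable (v.Ypot a) P)
    (hbeta : ContinuousOn (v.beta P) S)
    -- kernel
    (K : ℝ → ℝ) (hK : Proximal.IsSecondOrderKernel K)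
    -- bridge functions
    (h₀ : ℝ → 𝒲 → 𝒳 → ℝ) (hh₀ : v.IsOutcomeBridge P h₀)
    (hh₀_smooth : Proximal.SmoothBounded S h₀) (hh₀_bdd : Proximal.UniformlyBounded S h₀)
    (q₀ : ℝ → 𝒵 → 𝒳 → ℝ) (hq₀ : v.IsTreatmentBridge P q₀)
    (hq₀_cont : ∀ z x, ContinuousOn (fun a => q₀ a z x) S)
    (hq₀_bdd : Proximal.UniformlyBounded S q₀)
    -- conditional densities
    (μZ : Measure 𝒵) [SigmaFinite μZ] (μW : Measure 𝒲) [SigmaFinite μW]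
    (μY : Measure ℝ) [SigmaFinite μY]
    (pZ : ℝ × 𝒵 → 𝒲 × 𝒳 → ℝ) (pW : ℝ × 𝒲 → 𝒵 × 𝒳 → ℝ) (pYW : ℝ × ℝ × 𝒲 → 𝒵 × 𝒳 → ℝ)
    (hdens : v.RegularDensities P S μZ μW μY pZ pW pYW)
    -- the treatment level and the bandwidths
    (a : ℝ) (ha : a ∈ S) (b : ℕ → ℝ) (hb : ∀ n, 0 < b n)
    (hb5 : (fun n : ℕ => (n : ℝ) * b n ^ 5) =O[atTop] fun _ => (1 : ℝ))
    (hnb : Tendsto (fun n : ℕ => (n : ℝ) * b n) atTop atTop)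
    -- nuisance estimates, fitted on an independent sample of size `m n`
    (m : ℕ → ℕ)
    (hhat : (n : ℕ) → (Fin (m n) → Proximal.Obs 𝒳 𝒵 𝒲) → ℝ → 𝒲 → 𝒳 → ℝ)
    (qhat : (n : ℕ) → (Fin (m n) → Proximal.Obs 𝒳 𝒵 𝒲) → ℝ → 𝒵 → 𝒳 → ℝ)
    (hhat_meas : ∀ n, Measurable fun t : (Fin (m n) → Proximal.Obs 𝒳 𝒵 𝒲) × 𝒲 × 𝒳 =>
      hhat n t.1 a t.2.1 t.2.2)
    (qhat_meas : ∀ n, Measurable fun t : (Fin (m n) → Proximal.Obs 𝒳 𝒵 𝒲) × 𝒵 × 𝒳 =>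
      qhat n t.1 a t.2.1 t.2.2)
    (hhat_bdd : ∃ C : ℝ, ∀ n d w x, |hhat n d a w x| ≤ C)
    (qhat_bdd : ∃ C : ℝ, ∀ n d z x, |qhat n d a z x| ≤ C)
    (hhat_cons : Tendsto (fun n => ∫ d, v.sqErrH P a (hhat n d) h₀ ∂(v.sampleLaw P (m n)))
      atTop (𝓝 0))
    (qhat_cons : Tendsto (fun n => ∫ d, v.sqErrQ P a (qhat n d) q₀ ∂(v.sampleLaw P (m n)))
      atTop (𝓝 0))
    (hprod : (fun n => ∫ d, v.sqErrH P a (hhat n d) h₀ * v.sqErrQ P a (qhat n d) q₀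
        ∂(v.sampleLaw P (m n))) =o[atTop] fun n : ℕ => ((n : ℝ) * b n)⁻¹)
    -- the quantities of the conclusion
    (B V : ℝ) (hB : B = v.biasConst P μW h₀ q₀ pW a) (hV : V = v.varConst P μY μW h₀ q₀ pYW a)
    (est : (n : ℕ) →
      (Fin (m n) → Proximal.Obs 𝒳 𝒵 𝒲) × (Fin n → Proximal.Obs 𝒳 𝒵 𝒲) → ℝ)
    (hest : ∀ n, est n = Proximal.splitPkdr K (b n) a (hhat n) (qhat n))
    (bias var mse : ℕ → ℝ)
    (hbias : ∀ n, bias n = (∫ d, est n d ∂(v.splitLaw P (m n) n)) - v.beta P a)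
    (hvar : ∀ n, var n = variance (est n) (v.splitLaw P (m n) n))
    (hmse : ∀ n, mse n = ∫ d, (est n d - v.beta P a) ^ 2 ∂(v.splitLaw P (m n) n)) :
    -- all expectations exist
    (∀ n, MemLp (est n) 2 (v.splitLaw P (m n) n)) ∧
    Integrable (fun t : (𝒵 × 𝒳) × 𝒲 =>
        q₀ a t.1.1 t.1.2 * Proximal.biasIntegrand h₀ pW a t.2 t.1.1 t.1.2)
      ((P.map fun ω => (v.Z ω, v.X ω)).prod μW) ∧
    Integrable (fun t : (𝒵 × 𝒳) × ℝ × 𝒲 =>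
        q₀ a t.1.1 t.1.2 ^ 2 * ((t.2.1 - h₀ a t.2.2 t.1.2) ^ 2 * pYW (a, t.2) t.1))
      ((P.map fun ω => (v.Z ω, v.X ω)).prod (μY.prod μW)) ∧
    -- bias
    ((fun n => bias n - b n ^ 2 / 2 * Proximal.kappaTwo K * B)
      =o[atTop] fun n : ℕ => ((n : ℝ) * b n) ^ (-(1 / 2) : ℝ)) ∧
    -- variance
    (∃ r : ℕ → ℝ, Tendsto r atTop (𝓝 0) ∧
      ∀ n : ℕ, 1 ≤ n → var n = Proximal.omegaTwo K / (n * b n) * (V + r n)) ∧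
    -- mean squared error
    ((fun n => mse n - Proximal.amse K B V n (b n)) =o[atTop] fun n : ℕ => ((n : ℝ) * b n)⁻¹) ∧
    -- a bandwidth of exact order `n^{-1/5}` gives the rate `n^{-4/5}`
    (((fun n => b n) =Θ[atTop] fun n : ℕ => (n : ℝ) ^ (-(1 / 5) : ℝ)) →
      mse =O[atTop] fun n : ℕ => (n : ℝ) ^ (-(4 / 5) : ℝ)) ∧
    -- optimality of that bandwidth and of that rate
    (Proximal.kappaTwo K * B ≠ 0 → 0 < V →
      (∀ n : ℕ, 1 ≤ n →
        0 < Proximal.optBandwidth K B V n ∧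
        (∀ c : ℝ, 0 < c → c ≠ Proximal.optBandwidth K B V n →
          Proximal.amse K B V n (Proximal.optBandwidth K B V n) < Proximal.amse K B V n c) ∧
        Proximal.amse K B V n (Proximal.optBandwidth K B V n) =
          5 / 4 * ((Proximal.kappaTwo K * B) ^ 2) ^ (1 / 5 : ℝ) *
            (Proximal.omegaTwo K * V) ^ (4 / 5 : ℝ) * (n : ℝ) ^ (-(4 / 5) : ℝ)) ∧
      (∀ ε : ℝ, 0 < ε → ∀ᶠ n : ℕ in atTop,
        (1 - ε) * Proximal.amse K B V n (Proximal.optBandwidth K B V n) ≤ mse n) ∧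
      ((mse =O[atTop] fun n : ℕ => (n : ℝ) ^ (-(4 / 5) : ℝ)) →
        (fun n => b n) =Θ[atTop] fun n : ℕ => (n : ℝ) ^ (-(1 / 5) : ℝ)) ∧
      (Tendsto (fun n => b n / Proximal.optBandwidth K B V n) atTop (𝓝 1) →
        Tendsto (fun n => mse n / Proximal.amse K B V n (Proximal.optBandwidth K B V n))
          atTop (𝓝 1))) := by
  have hR : v.Regular P S h₀ q₀ μZ μW μY pZ pW pYW a :=
    { isOpen := hS
      ae_mem := hAS
      mem := ha
      memLp_Y := hY
      outcome := hh₀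
      smooth := hh₀_smooth
      bounded_h := hh₀_bdd
      measurable_q := hq₀.measurable
      bounded_q := hq₀_bdd
      densities := hdens
      beta_eq := hh₀.beta_eq hS hAS hcons hpos hign hproxy hcompl hY hYpot hbeta hh₀_bdd
        hh₀_smooth ha
      integral_q := hq₀.integral_eq_one hS hAS hq₀_bdd hq₀_cont hpos hproxy hdens.density_Z
        hdens.smooth_Z ha }
  have hΩ := hK.omegaTwo_pos
  obtain ⟨c₁, hc₁⟩ := hhat_bdd
  obtain ⟨c₂, hc₂⟩ := qhat_bdd
  obtain ⟨c₃, hc₃⟩ := hh₀_bdd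
  obtain ⟨c₄, hc₄⟩ := hq₀_bdd
  -- One bound for the fitted and the true bridge functions at a, as the uniform expansions and the
  -- bounds on the squared errors use a single constant.
  obtain ⟨Bd, hBd0, h1, h2, h3, h4⟩ : ∃ Bd : ℝ, 0 ≤ Bd ∧ c₁ ≤ Bd ∧ c₂ ≤ Bd ∧ c₃ ≤ Bd ∧ c₄ ≤ Bd :=
    ⟨|c₁| + |c₂| + |c₃| + |c₄|, by positivity, by
      have := le_abs_self c₁; linarith [abs_nonneg c₂, abs_nonneg c₃, abs_nonneg c₄], by
      have := le_abs_self c₂; linarith [abs_nonneg c₁, abs_nonneg c₃, abs_nonneg c₄], by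
      have := le_abs_self c₃; linarith [abs_nonneg c₁, abs_nonneg c₂, abs_nonneg c₄], by
      have := le_abs_self c₄; linarith [abs_nonneg c₁, abs_nonneg c₂, abs_nonneg c₃]⟩
  let H : ∀ n, (Fin (m n) → Proximal.Obs 𝒳 𝒵 𝒲) → 𝒲 × 𝒳 → ℝ := fun n d y => hhat n d a y.1 y.2
  let Q : ∀ n, (Fin (m n) → Proximal.Obs 𝒳 𝒵 𝒲) → 𝒵 × 𝒳 → ℝ := fun n d y => qhat n d a y.1 y.2
  have hHm : ∀ n, Measurable (Function.uncurry (H n)) := hhat_meas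
  have hQm : ∀ n, Measurable (Function.uncurry (Q n)) := qhat_meas
  have hHm' : ∀ n d, Measurable (H n d) := fun n d => (hHm n).comp measurable_prodMk_left
  have hQm' : ∀ n d, Measurable (Q n d) := fun n d => (hQm n).comp measurable_prodMk_left
  have hHB : ∀ n d y, |H n d y| ≤ Bd := fun n d y => (hc₁ n d _ _).trans h1
  have hQB : ∀ n d y, |Q n d y| ≤ Bd := fun n d y => (hc₂ n d _ _).trans h2
  have hhB : ∀ w x, |h₀ a w x| ≤ Bd := fun w x => (hc₃ a ha w x).trans h3
  have hqB : ∀ z x, |q₀ a z x| ≤ Bd := fun z x => (hc₄ a ha z x).trans h4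
  let s : ∀ n, (Fin (m n) → Proximal.Obs 𝒳 𝒵 𝒲) × Proximal.Obs 𝒳 𝒵 𝒲 → ℝ := fun n x =>
    Proximal.score K (b n) a (H n x.1) (Q n x.1) x.2
  have hsL : ∀ n, MemLp (s n) 2 ((v.sampleLaw P (m n)).prod (P.map v.obs)) := fun n =>
    hK.memLp_score_prod hY (hb n) (hHm n) (hQm n) (hHB n) (hQB n)
  have hsm : ∀ n, Measurable (s n) := fun n =>
    Proximal.measurable_score hK.continuous.measurable (hHm n) (hQm n)
  -- Holds by unfolding: the estimator is literally the average of scores, with the auxiliary sample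
  -- as the further random element.
  have hestA : ∀ n, est n = Proximal.average (s n) n := hest
  have hest2 : ∀ n, MemLp (est n) 2 (v.splitLaw P (m n) n) := fun n => by
    rw [hestA]; exact Proximal.memLp_average (hsL n) n
  have : ∀ n, IsProbabilityMeasure (v.splitLaw P (m n) n) := fun n => by
    unfold Proximal.Variables.splitLaw; infer_instance
  -- conditional moments given the auxiliary sample
  have hM : ∀ n d, ∫ o, s n (d, o) ∂(P.map v.obs) =
      ∫ ω, Proximal.score K (b n) a (H n d) (Q n d) (v.obs ω) ∂P := fun n d =>
    integral_map v.measurable_obs.aemeasurable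
      ((hsm n).comp measurable_prodMk_left).aestronglyMeasurable
  have hM2 : ∀ n d, ∫ o, s n (d, o) ^ 2 ∂(P.map v.obs) =
      ∫ ω, Proximal.score K (b n) a (H n d) (Q n d) (v.obs ω) ^ 2 ∂P := fun n d =>
    integral_map v.measurable_obs.aemeasurable
      (((hsm n).comp measurable_prodMk_left).pow_const 2).aestronglyMeasurable
  have hb0 := Proximal.tendsto_zero_of_isBigO_pow_five hb5
  have hbw : Tendsto b atTop (𝓝[>] 0) :=
    tendsto_nhdsWithin_iff.2 ⟨hb0, Eventually.of_forall hb⟩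
  have hHi : ∀ n, Integrable (fun d => v.distH P h₀ a (H n d)) (v.sampleLaw P (m n)) := fun n =>
    Proximal.Variables.integrable_distH (hHm n) (hR.measurable_h a) (hHB n) hhB
  have hQi : ∀ n, Integrable (fun d => v.distQ P q₀ a (Q n d)) (v.sampleLaw P (m n)) := fun n =>
    Proximal.Variables.integrable_distQ (hQm n) (hR.measurable_q' a) (hQB n) hqB
  have hbiasd : ∃ C, 0 ≤ C ∧ ∀ ε > 0, ∃ R, 0 ≤ R ∧ ∀ᶠ n in atTop, ∀ d,
      |(∫ o, s n (d, o) ∂(P.map v.obs)) - v.beta P a - b n ^ 2 * (Proximal.kappaTwo K * B / 2)| ≤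
      b n ^ 2 * (ε + R * (v.distH P h₀ a (H n d) + v.distQ P q₀ a (Q n d))) +
        C * √(v.distH P h₀ a (H n d) * v.distQ P q₀ a (Q n d)) := by
    obtain ⟨C, hC, hall⟩ := hR.exists_bias_bound hK (B := Bd)
    refine ⟨C, hC, fun ε hε => ?_⟩
    obtain ⟨R, hR0, hev⟩ := hall ε hε
    refine ⟨R, hR0, (hbw.eventually hev).mono fun n hn d => ?_⟩
    rw [hM, hB, show b n ^ 2 * (Proximal.kappaTwo K * v.biasConst P μW h₀ q₀ pW a / 2) =
      b n ^ 2 / 2 * Proximal.kappaTwo K * v.biasConst P μW h₀ q₀ pW a by ring]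
    exact hn _ _ (hHm' n d) (hQm' n d) (hHB n d) (hQB n d)
  have hsecd : ∀ ε > 0, ∃ R, 0 ≤ R ∧ ∀ᶠ n in atTop, ∀ d,
      |b n * (∫ o, s n (d, o) ^ 2 ∂(P.map v.obs)) - Proximal.omegaTwo K * V| ≤
      ε + R * (v.distH P h₀ a (H n d) + v.distQ P q₀ a (Q n d)) := fun ε hε => by
    obtain ⟨R, hR0, hev⟩ := hR.exists_second_moment_bound hK Bd hε
    refine ⟨R, hR0, (hbw.eventually hev).mono fun n hn d => ?_⟩
    rw [hM2, hV]
    exact hn _ _ (hHm' n d) (hQm' n d) (hHB n d) (hQB n d)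
  -- The assumptions on `sqErrH` and `sqErrQ` apply as they stand, since these unfold to `distH` and
  -- `distQ` of the functions fitted at level a.
  have hrem := Proximal.tendsto_mean_sq_remainder (μ := fun n => v.sampleLaw P (m n)) hb hb5
    (fun n d => v.distH_nonneg (H n d)) (fun n d => v.distQ_nonneg (Q n d))
    (fun n d => Proximal.Variables.distH_le (hHB n) hhB d)
    (fun n d => Proximal.Variables.distQ_le (hQB n) hqB d) hHi hQi hhat_cons qhat_cons hprod hbiasd
  obtain ⟨hbo, hvo⟩ := Proximal.tendsto_bias_variance (μ := fun n => v.sampleLaw P (m n)) hb hb0 hnb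
    hHi hQi hhat_cons qhat_cons (fun n => Proximal.integrable_mean (hsL n))
    (fun n => Proximal.integrable_sq_mean (hsL n))
    (fun n => Proximal.integrable_second_moment (hsL n)) hrem hsecd
  have hbias' : (fun n => bias n - b n ^ 2 / 2 * Proximal.kappaTwo K * B)
      =o[atTop] fun n : ℕ => ((n : ℝ) * b n) ^ (-(1 / 2) : ℝ) := by
    refine hbo.congr' ?_ EventuallyEq.rfl
    filter_upwards [eventually_ge_atTop 1] with n hn
    have hmean : ∫ d, est n d ∂(v.splitLaw P (m n) n) =
        ∫ d, ∫ o, s n (d, o) ∂(P.map v.obs) ∂(v.sampleLaw P (m n)) := by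
      rw [hestA]; exact Proximal.integral_average (hsL n) hn
    rw [hbias, hmean]
    ring
  have hvar' : ∃ r : ℕ → ℝ, Tendsto r atTop (𝓝 0) ∧
      ∀ n : ℕ, 1 ≤ n → var n = Proximal.omegaTwo K / (n * b n) * (V + r n) := by
    -- The relative error is defined by solving the claimed identity for it, which needs Ω₂ ≠ 0 and
    -- n ≥ 1; only its limit is then left to prove.
    refine ⟨fun n => n * b n * var n / Proximal.omegaTwo K - V, ?_, fun n hn => ?_⟩
    · have hlim : Tendsto (fun n : ℕ => n * b n * var n) atTop (𝓝 (Proximal.omegaTwo K * V)) := by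
        refine hvo.congr' ?_
        filter_upwards [eventually_ge_atTop 1] with n hn
        rw [hvar, hestA]
        exact congrArg _ (Proximal.variance_average (hsL n) hn).symm
      have := (hlim.div_const (Proximal.omegaTwo K)).sub_const V
      rwa [mul_div_cancel_left₀ _ hΩ.ne', sub_self] at this
    · have hn0 : (n : ℝ) ≠ 0 := by positivity
      have hbn := (hb n).ne'
      have hΩ' := hΩ.ne'
      field_simp
      ring
  have hmse' : ∀ n, mse n = var n + bias n ^ 2 := fun n => by
    rw [hmse, hvar, hbias]
    exact Proximal.integral_sub_sq_eq (hest2 n) _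
  have hmse0 : ∀ n, 0 ≤ mse n := fun n => by
    rw [hmse]; exact integral_nonneg fun d => sq_nonneg _
  have hms := Proximal.mse_sub_amse_isLittleO hb hb5 hbias' hvar' hmse'
  refine ⟨hest2, hR.integrable_biasIntegrand hK, hR.integrable_varIntegrand hK, hbias', hvar', hms,
    fun hΘ => Proximal.isBigO_mse_of_isTheta hms hΘ, fun hB0 hV0 => ⟨fun n hn =>
      ⟨Proximal.optBandwidth_pos hΩ hB0 hV0 hn,
        fun c hc hne => Proximal.amse_optBandwidth_lt hΩ hB0 hV0 hn hc hne,
        Proximal.amse_optBandwidth_eq hΩ hB0 hV0 hn⟩,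
      fun ε hε => Proximal.eventually_le_mse hΩ hB0 hV0 hb hmse0 hms hε,
      fun hO => Proximal.isTheta_of_isBigO_mse hΩ hB0 hV0 hb hms hO,
      fun ht => Proximal.tendsto_mse_div hΩ hB0 hV0 hb hms ht⟩⟩
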